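/- Let $k$ be a field and $[m]=\{1,\dots,m\}$, and let $k[x]=k[x_1,\dots,x_m]$ act on $k$ with every $x_i$ acting as $0$. For $\sigma\subseteq[m]$ put $x_\sigma=\prod_{i\in\sigma}x_i$. Let $K$ be an abstract simplicial complex on $[m]$ (a family of subsets of $[m]$ closed under passing to subsets; not every vertex need be a face), $K^c$ the set of subsets of $[m]$ not in $K$, $I_K=\langle x_\sigma : \sigma\in K^c\rangle$ and $k(K)=k[x]/I_K$. Let $P=(\sigma_1,\dots,\sigma_s)$ be a simplicial complement of $K$, i.e. a finite sequence of non-empty subsets of $[m]$ (repetitions allowed) with $\langle x_{\sigma_1},\dots,x_{\sigma_s}\rangle=I_K$. Let $\bar\Lambda(P)$ be the $k$-vector space with basis the symbols $\sigma_{i_1}\bar\wedge\cdots\bar\wedge\sigma_{i_r}$, $i_1<\dots<i_r$ (degree $r\ge 0$; the empty symbol is $1$), extended to arbitrary index sequences antisymmetrically, the symbol being $0$ when an index repeats. The product of $\sigma_{i_1}\bar\wedge\cdots\bar\wedge\sigma_{i_r}$ and $\sigma_{j_1}\bar\wedge\cdots\bar\wedge\sigma_{j_t}$ is $\sigma_{i_1}\bar\wedge\cdots\bar\wedge\sigma_{i_r}\bar\wedge\sigma_{j_1}\bar\wedge\cdots\bar\wedge\sigma_{j_t}$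 if $\sigma_{i_u}\cap\sigma_{j_v}=\emptyset$ for all $u,v$, and $0$ otherwise. The differential is $$d(\sigma_{i_1}\bar\wedge\cdots\bar\wedge\sigma_{i_r})=\sum_u(-1)^u\,\sigma_{i_1}\bar\wedge\cdots\bar\wedge\widehat{\sigma_{i_u}}\bar\wedge\cdots\bar\wedge\sigma_{i_r},$$ summed over the $u$ for which omitting $\sigma_{i_u}$ does not change $\sigma_{i_1}\cup\cdots\cup\sigma_{i_r}$. For $\sigma\in K^c$ let $\bar\Lambda^{*,\sigma}(P)$ be the subcomplex spanned by the symbols with $\sigma_{i_1}\cup\cdots\cup\sigma_{i_r}=\sigma$. Then $(\bar\Lambda(P),d)$ is a differential graded algebra, and there is an isomorphism of graded $k$-algebras $$\varphi: H_*(\bar\Lambda(P),d)\;\cong\;\mathrm{Tor}^{k[x]}_*(k(K),k)$$ such that the following hold. 1. The inclusions of the subcomplexes, followed by $\varphi$, give a direct sum decomposition $$\mathrm{Tor}^{k[x]}_*(k(K),k)= k\oplus\bigoplus_{\sigma\in K^c}H_*(\bar\Lambda^{*,\sigma}(P),d),$$ where $k$ is the trivial complex spanned by $1$ in degree $0$;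 and $\mathrm{Tor}^{k[x]}_0(k(K),k)=k\cdot 1\cong k$. 2. For all $i>0$ and $\sigma\in K^c$, $\varphi$ identifies $H_i(\bar\Lambda^{*,\sigma}(P),d)$ with the part $\mathrm{Tor}^{k[x]}_{i,\sigma}(k(K),k)$ of multidegree $\sigma\in\{0,1\}^m\subset\mathbb N^m$, and there are isomorphisms of $k$-vector spaces $$\mathrm{Tor}^{k[x]}_{i,\sigma}(k(K),k)\cong H_i(\bar\Lambda^{*,\sigma}(P),d)\cong\widetilde H_{i-2}(\mathrm{link}_{K^*}\bar\sigma;k)\cong\widetilde H^{|\sigma|-i-1}(K\cap\sigma;k).$$ Here $\bar\sigma=[m]\setminus\sigma$, $K^*=\{\tau\subseteq[m] : [m]\setminus\tau\in K^c\}$ is the Alexander dual, $\mathrm{link}_{K^*}\bar\sigma=\{\tau\in K^* : \bar\sigma\cup\tau\in K^*,\ \bar\sigma\cap\tau=\emptyset\}$, $K\cap\sigma=\{\tau\in K:\tau\subseteq\sigma\}$, and $\widetilde H_*$, $\widetilde H^*$ are reduced simplicial homology and cohomology, computed with the empty simplex in dimension $-1$ (so that $\widetilde H_{-1}(\{\emptyset\};k)=k$).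 -/

import Mathlib

open CategoryTheory MonoidalCategory TensorProduct
universe u
namespace SimplicialComplement
noncomputable section
variable (R A B : Type u) [CommRing R] [CommRing A] [Algebra R A] [CommRing B] [Algebra R B]

/-- `Tor_n^R(A, B)`, derived in the first variable. -/
abbrev TorMod (n : ℕ) : ModuleCat.{u} R :=
  ((Tor' (ModuleCat.{u} R) n).obj (ModuleCat.of R A)).obj (ModuleCat.of R B)

/-- Projective resolutions of the `R`-module `A`. -/
abbrev Resolution := ProjectiveResolution (ModuleCat.of R A)

variable {R A}

/-- `d ⊗ 1 : Pᵢ ⊗ B → Pⱼ ⊗ B`. -/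
def tensorD (P : Resolution R A) (i j : ℕ) :
    (P.complex.X i) ⊗[R] B →ₗ[R] (P.complex.X j) ⊗[R] B :=
  (P.complex.d i j).hom.rTensor B

/-- The complex `P ⊗_R B`. -/
abbrev tensorComplex (P : Resolution R A) : ChainComplex (ModuleCat.{u} R) ℕ :=
  (((tensoringRight (ModuleCat.{u} R)).obj (ModuleCat.of R B)).mapHomologicalComplex _).obj P.complex

/-- The `n`-cycles of `P ⊗_R B`. -/
def torCycles (P : Resolution R A) (n : ℕ) : Submodule R ((P.complex.X n) ⊗[R] B) :=
  LinearMap.ker (tensorD B P n (n-1))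

theorem tensorComplex_d (P : Resolution R A) (i j : ℕ) :
    ((tensorComplex B P).d i j).hom = tensorD B P i j := rfl

theorem next_eq (n : ℕ) : (ComplexShape.down ℕ).next n = n - 1 := by cases n <;> simp

/-- `Tor_n` is the homology (cycles modulo boundaries) of `P ⊗_R B`. -/
def torIso (P : Resolution R A) (n : ℕ) : 
   TorMod R A B n ≅ ((tensorComplex B P).sc' (n+1) n (n-1)).moduleCatLeftHomologyData.H :=
  P.isoLeftDerivedObj ((tensoringRight (ModuleCat.{u} R)).obj (ModuleCat.of R B)) n ≪≫
   (tensorComplex B P).homologyIsoSc' (n+1) n (n-1) (by simp) (next_eq n) ≪≫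
   ShortComplex.moduleCatHomologyIso _

/-- The class in `Tor_n^R(A, B)` of an `n`-cycle of `P ⊗_R B`. -/
def torClass (P : Resolution R A) (n : ℕ) : torCycles B P n →ₗ[R] TorMod R A B n :=
  (torIso B P n).inv.hom ∘ₗ (LinearMap.range ((tensorComplex B P).sc' (n+1) n (n-1)).moduleCatToCycles).mkQ

theorem torClass_surjective (P : Resolution R A) (n : ℕ) : Function.Surjective (torClass B P n) := by
  intro t
  obtain ⟨z, hz⟩ := Submodule.mkQ_surjective _ ((torIso B P n).hom.hom t)
  refine ⟨z, ?_⟩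
  change (torIso B P n).inv.hom (Submodule.mkQ _ z) = t
  rw [hz]
  exact Iso.hom_inv_id_apply (torIso B P n) t

theorem torClass_eq_zero_iff (P : Resolution R A) (n : ℕ) (z : torCycles B P n) :
    torClass B P n z = 0 ↔ ∃ w, tensorD B P (n+1) n w = z.1 := by
  have hinj : Function.Injective (torIso B P n).inv.hom :=
    (ModuleCat.mono_iff_injective _).1 inferInstance
  refine (map_eq_zero_iff (torIso B P n).inv.hom hinj).trans ?_
  refine (Submodule.Quotient.mk_eq_zero _).trans ?_
  constructor
  · rintro ⟨w, hw⟩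
    exact ⟨w, congrArg Subtype.val hw⟩
  · rintro ⟨w, hw⟩
    exact ⟨w, Subtype.ext hw⟩

/-- The augmentation `P₀ → A`. -/
abbrev augmentation (P : Resolution R A) : P.complex.X 0 ⟶ ModuleCat.of R A :=
  (ChainComplex.toSingle₀Equiv _ _ P.π).1


/-- `(P ⊗ P)₀ → A ⊗ A → A`. -/
def tensorAug (P : Resolution R A) :
    (HomologicalComplex.tensorObj P.complex P.complex).X 0 ⟶ ModuleCat.of R A :=
  HomologicalComplex.mapBifunctorDesc (fun p q _ =>
    match p, q with
    | 0, 0 => (augmentation P ⊗ₘ augmentation P) ≫ ModuleCat.ofHom (LinearMap.mul' R A)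
    | _, _ => 0)

/-- A chain map `P ⊗_R P → P` lifting the multiplication `A ⊗_R A → A`. -/
structure ChainMul (P : Resolution R A) where
  hom : HomologicalComplex.tensorObj P.complex P.complex ⟶ P.complex
  lifts : HomologicalComplex.ιTensorObj P.complex P.complex 0 0 0 rfl ≫ hom.f 0 ≫ augmentation P
     = (augmentation P ⊗ₘ augmentation P) ≫ ModuleCat.ofHom (LinearMap.mul' R A)

instance projective_tensor (P : Resolution R A) (j : ℕ) :
    Projective ((HomologicalComplex.tensorObj P.complex P.complex).X j) := by
  have : ∀ p q, Projective (P.complex.X p ⊗ P.complex.X q) := by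
    intro p q
    have := (IsProjective.iff_projective (P.complex.X p)).2 (inferInstance : Projective (P.complex.X p))
    have := (IsProjective.iff_projective (P.complex.X q)).2 (inferInstance : Projective (P.complex.X q))
    exact (IsProjective.iff_projective (R := R) (P.complex.X p ⊗[R] P.complex.X q)).1 inferInstance
  refine ⟨fun {E X} f e he => ⟨HomologicalComplex.mapBifunctorDesc (fun p q h => by
    haveI := this p q; exact
      (Projective.factorThru (HomologicalComplex.ιTensorObj P.complex P.complex p q j h ≫ f :
        P.complex.X p ⊗ P.complex.X q ⟶ X) e : P.complex.X p ⊗ P.complex.X q ⟶ E)), ?_⟩⟩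
  apply HomologicalComplex.mapBifunctor.hom_ext
  intro p q h
  simp only [HomologicalComplex.ι_mapBifunctorDesc_assoc]
  exact @Projective.factorThru_comp _ _ _ _ _ (this p q) _ _ he


/-- The map `Cₚ ⊗ C_q → (C ⊗ C)_n`, zero unless `p + q = n`. -/
abbrev ιZ (C : ChainComplex (ModuleCat.{u} R) ℕ) (p q n : ℕ) :
    C.X p ⊗ C.X q ⟶ (HomologicalComplex.tensorObj C C).X n :=
  HomologicalComplex.ιMapBifunctorOrZero C C (curriedTensor (ModuleCat.{u} R))
    (ComplexShape.down ℕ) p q n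

theorem ιZ_eq (C : ChainComplex (ModuleCat.{u} R) ℕ) (p q n : ℕ) (h : p + q = n) :
    ιZ C p q n = HomologicalComplex.ιTensorObj C C p q n h :=
  HomologicalComplex.ιMapBifunctorOrZero_eq _ _ _ _ _ _ _ h

theorem ι_d (C : ChainComplex (ModuleCat.{u} R) ℕ) (p q n : ℕ) (h : p + q = n + 1) :
    ιZ C p q (n+1) ≫ (HomologicalComplex.tensorObj C C).d (n+1) n =
      (C.d p (p-1) ▷ C.X q) ≫ ιZ C (p-1) q n +
      ((-1 : ℤˣ) ^ p) • ((C.X p ◁ C.d q (q-1)) ≫ ιZ C p (q-1) n) := by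
  rw [ιZ_eq C p q (n+1) h, HomologicalComplex.mapBifunctor.d_eq,
    Preadditive.comp_add, HomologicalComplex.mapBifunctor.ι_D₁,
    HomologicalComplex.mapBifunctor.ι_D₂]
  congr 1
  · cases p with
    | zero =>
      rw [HomologicalComplex.mapBifunctor.d₁_eq_zero C C (curriedTensor (ModuleCat.{u} R))
        (ComplexShape.down ℕ) 0 q n (by simp)]
      simp
    | succ p =>
      rw [HomologicalComplex.mapBifunctor.d₁_eq' C C (curriedTensor (ModuleCat.{u} R))
        (ComplexShape.down ℕ) (i₁ := p+1) (i₁' := p) (by simp) q n]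
      have : ComplexShape.ε₁ (ComplexShape.down ℕ) (ComplexShape.down ℕ) (ComplexShape.down ℕ) (p+1, q) = 1 := rfl
      rw [this, one_smul]
      rfl
  · cases q with
    | zero =>
      rw [HomologicalComplex.mapBifunctor.d₂_eq_zero C C (curriedTensor (ModuleCat.{u} R))
        (ComplexShape.down ℕ) p 0 n (by simp)]
      simp
    | succ q =>
      rw [HomologicalComplex.mapBifunctor.d₂_eq' C C (curriedTensor (ModuleCat.{u} R))
        (ComplexShape.down ℕ) p (i₂ := q+1) (i₂' := q) (by simp) n]
      have : ComplexShape.ε₂ (ComplexShape.down ℕ) (ComplexShape.down ℕ) (ComplexShape.down ℕ) (p, q+1) = (-1)^p := by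
        simp
      rw [this]
      rfl

theorem ι_tensorAug (P : Resolution R A) :
    HomologicalComplex.ιTensorObj P.complex P.complex 0 0 0 rfl ≫ tensorAug P =
      (augmentation P ⊗ₘ augmentation P) ≫ ModuleCat.ofHom (LinearMap.mul' R A) := by
  rw [tensorAug, HomologicalComplex.ι_mapBifunctorDesc]
  rfl


theorem d_tensorAug (P : Resolution R A) :
   (HomologicalComplex.tensorObj P.complex P.complex).d 1 0 ≫ tensorAug P = 0 := by
  apply HomologicalComplex.mapBifunctor.hom_ext
  intro p q h
  have hpq : p + q = 0 + 1 := h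
  have hd : P.complex.d 1 0 ≫ augmentation P = 0 := (ChainComplex.toSingle₀Equiv _ _ P.π).2
  have h1 := ι_d P.complex p q 0 hpq
  rw [ιZ_eq _ _ _ _ h] at h1
  have h0 : ιZ P.complex 0 0 0 ≫ tensorAug P = 
      (augmentation P ⊗ₘ augmentation P) ≫ ModuleCat.ofHom (LinearMap.mul' R A) := by
    rw [ιZ_eq _ _ _ _ rfl]
    exact ι_tensorAug P
  rw [Limits.comp_zero]
  refine ((reassoc_of% h1) (tensorAug P)).trans ?_
  obtain ⟨rfl, rfl⟩ | ⟨rfl, rfl⟩ : (p = 1 ∧ q = 0) ∨ (p = 0 ∧ q = 1) := by omega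
  · have e1 : (P.complex.d 1 0 ▷ P.complex.X 0) ≫ (augmentation P ⊗ₘ augmentation P) = 0 := by
      rw [MonoidalCategory.whiskerRight_comp_tensorHom, hd, MonoidalCategory.tensorHom_def,
        MonoidalPreadditive.zero_whiskerRight, Limits.zero_comp]
    have e2 : P.complex.d 0 0 = 0 := P.complex.shape _ _ (by simp)
    simp only [Preadditive.add_comp, Category.assoc, h0, e2, reassoc_of% e1]
    simp
  · have e1 : (P.complex.X 0 ◁ P.complex.d 1 0) ≫ (augmentation P ⊗ₘ augmentation P) = 0 := by
      rw [MonoidalCategory.whiskerLeft_comp_tensorHom, hd, MonoidalCategory.tensorHom_def,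
        MonoidalPreadditive.whiskerLeft_zero, Limits.comp_zero]
    have e2 : P.complex.d 0 0 = 0 := P.complex.shape _ _ (by simp)
    simp only [Preadditive.add_comp, Category.assoc, h0, e2, pow_zero, one_smul, reassoc_of% e1]
    simp

theorem exact_augmentation (P : Resolution R A) :
    (ShortComplex.mk (P.complex.d 1 0) (augmentation P)
      (ChainComplex.toSingle₀Equiv _ _ P.π).2).Exact := P.exact₀

theorem epi_augmentation (P : Resolution R A) : Epi (augmentation P) :=
  inferInstanceAs (Epi (P.π.f 0))

instance nonempty_chainMul (P : Resolution R A) : Nonempty (ChainMul P) := by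
  have := epi_augmentation P
  let f0 := Projective.factorThru (tensorAug P) (augmentation P)
  have hf0 : f0 ≫ augmentation P = tensorAug P := Projective.factorThru_comp _ _
  let f1 := (exact_augmentation P).liftFromProjective
    ((HomologicalComplex.tensorObj P.complex P.complex).d 1 0 ≫ f0)
    (by dsimp only; rw [Category.assoc, hf0, d_tensorAug])
  have hf1 : f1 ≫ P.complex.d 1 0 = (HomologicalComplex.tensorObj P.complex P.complex).d 1 0 ≫ f0 :=
    (exact_augmentation P).liftFromProjective_comp _ _
  refine ⟨⟨ChainComplex.mkHom _ _ f0 f1 hf1 fun n ⟨g, g', w⟩ =>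
    ⟨(P.exact_succ n).liftFromProjective
      ((HomologicalComplex.tensorObj P.complex P.complex).d (n+2) (n+1) ≫ g') (by
        dsimp only
        rw [Category.assoc, w, HomologicalComplex.d_comp_d_assoc, Limits.zero_comp]),
      (P.exact_succ n).liftFromProjective_comp _ _⟩, ?_⟩⟩
  rw [ChainComplex.mkHom_f_0, hf0]
  exact ι_tensorAug P

/-- `(x ⊗ b, y ⊗ c) ↦ μ(x ⊗ y) ⊗ bc` on `P ⊗_R B`. -/
def chainPair {P : Resolution R A} (μ : ChainMul P) (p q n : ℕ) :
    (P.complex.X p) ⊗[R] B →ₗ[R] (P.complex.X q) ⊗[R] B →ₗ[R] (P.complex.X n) ⊗[R] B :=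
  TensorProduct.curry
    (TensorProduct.map (ιZ P.complex p q n ≫ μ.hom.f n).hom (LinearMap.mul' R B) ∘ₗ
      (TensorProduct.tensorTensorTensorComm R (P.complex.X p) B (P.complex.X q) B).toLinearMap)

/-- The components `Pₚ × P_q → P_n` of a multiplication on `P`. -/
def elMul {P : Resolution R A} (μ : ChainMul P) (p q n : ℕ) :
    P.complex.X p →ₗ[R] P.complex.X q →ₗ[R] P.complex.X n :=
  TensorProduct.curry (ιZ P.complex p q n ≫ μ.hom.f n).hom

theorem elMul_leibniz {P : Resolution R A} (μ : ChainMul P) (p q n : ℕ) (h : p + q = n + 1)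
    (x : P.complex.X p) (y : P.complex.X q) :
    (P.complex.d (n+1) n).hom (elMul μ p q (n+1) x y) =
      elMul μ (p-1) q n ((P.complex.d p (p-1)).hom x) y +
      (-1 : ℤ) ^ p • elMul μ p (q-1) n x ((P.complex.d q (q-1)).hom y) := by
  have h1 := ι_d P.complex p q n h
  have h2 : (ιZ P.complex p q (n+1) ≫ μ.hom.f (n+1)) ≫ P.complex.d (n+1) n =
     (P.complex.d p (p-1) ▷ P.complex.X q) ≫ (ιZ P.complex (p-1) q n ≫ μ.hom.f n) +
      ((-1 : ℤ) ^ p) • ((P.complex.X p ◁ P.complex.d q (q-1)) ≫ (ιZ P.complex p (q-1) n ≫ μ.hom.f n)) := by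
    rw [Category.assoc, μ.hom.comm, reassoc_of% h1]
    simp [Units.smul_def]
  exact congrArg (fun f => f.hom (x ⊗ₜ y)) h2

theorem chainPair_tmul {P : Resolution R A} (μ : ChainMul P) (p q n : ℕ)
    (x : P.complex.X p) (y : P.complex.X q) (b c : B) :
    chainPair B μ p q n (x ⊗ₜ b) (y ⊗ₜ c) = elMul μ p q n x y ⊗ₜ (b * c) := rfl

theorem chainPair_leibniz {P : Resolution R A} (μ : ChainMul P) (p q n : ℕ) (h : p + q = n + 1)
    (x : (P.complex.X p) ⊗[R] B) (y : (P.complex.X q) ⊗[R] B) :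
    tensorD B P (n+1) n (chainPair B μ p q (n+1) x y) =
      chainPair B μ (p-1) q n (tensorD B P p (p-1) x) y +
      (-1 : ℤ) ^ p • chainPair B μ p (q-1) n x (tensorD B P q (q-1) y) := by
  induction x with
  | zero => simp
  | add x x' hx hx' => simp only [map_add, LinearMap.add_apply, hx, hx', smul_add]; abel
  | tmul x b =>
    induction y with
    | zero => simp
    | add y y' hy hy' => simp only [map_add, hy, hy', smul_add]; abel
    | tmul y c =>
      simp only [chainPair_tmul, tensorD, LinearMap.rTensor_tmul, elMul_leibniz μ p q n h,
        TensorProduct.add_tmul, TensorProduct.smul_tmul']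

theorem chainPair_mem {P : Resolution R A} (μ : ChainMul P) (p q : ℕ)
    (x : torCycles B P p) (y : torCycles B P q) :
    chainPair B μ p q (p+q) x.1 y.1 ∈ torCycles B P (p+q) := by
  have hx : tensorD B P p (p-1) x.1 = 0 := x.2
  have hy : tensorD B P q (q-1) y.1 = 0 := y.2
  change tensorD B P (p+q) (p+q-1) _ = 0
  rcases hn : p + q with _ | n
  · simp [tensorD]
  · have := chainPair_leibniz B μ p q n hn x.1 y.1
    simpa [hx, hy] using this

/-- `chainPair` on cycles. -/
def cyclePair {P : Resolution R A} (μ : ChainMul P) (p q : ℕ) :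
    torCycles B P p →ₗ[R] torCycles B P q →ₗ[R] torCycles B P (p+q) :=
  LinearMap.mk₂ R (fun x y => ⟨chainPair B μ p q (p+q) x.1 y.1, chainPair_mem B μ p q x y⟩)
    (fun _ _ _ => Subtype.ext (by simp)) (fun _ _ _ => Subtype.ext (by simp))
    (fun _ _ _ => Subtype.ext (by simp)) (fun _ _ _ => Subtype.ext (by simp))

theorem torClass_cyclePair_left {P : Resolution R A} (μ : ChainMul P) (p q : ℕ)
    (x : torCycles B P p) (y : torCycles B P q) (hx : torClass B P p x = 0) :
    torClass B P (p+q) (cyclePair B μ p q x y) = 0 := by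
  rw [torClass_eq_zero_iff] at hx ⊢
  obtain ⟨w, hw⟩ := hx
  have hy : tensorD B P q (q-1) y.1 = 0 := y.2
  refine ⟨chainPair B μ (p+1) q (p+q+1) w y.1, ?_⟩
  have := chainPair_leibniz B μ (p+1) q (p+q) (by omega) w y.1
  rw [this, hy, Nat.add_sub_cancel, hw]
  simp [cyclePair]

theorem torClass_cyclePair_right {P : Resolution R A} (μ : ChainMul P) (p q : ℕ)
    (x : torCycles B P p) (y : torCycles B P q) (hy : torClass B P q y = 0) :
    torClass B P (p+q) (cyclePair B μ p q x y) = 0 := by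
  rw [torClass_eq_zero_iff] at hy ⊢
  obtain ⟨w, hw⟩ := hy
  have hx : tensorD B P p (p-1) x.1 = 0 := x.2
  refine ⟨(-1 : ℤ) ^ p • chainPair B μ p (q+1) (p+q+1) x.1 w, ?_⟩
  have := chainPair_leibniz B μ p (q+1) (p+q) (by omega) x.1 w
  rw [map_zsmul, this, hx, Nat.add_sub_cancel, hw, map_zero, LinearMap.zero_apply, zero_add,
    smul_smul, ← mul_pow]
  simp [cyclePair]

/-- Cycles modulo boundaries are `Tor_n`. -/
def torEquiv (P : Resolution R A) (n : ℕ) :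
    (torCycles B P n ⧸ LinearMap.ker (torClass B P n)) ≃ₗ[R] TorMod R A B n :=
  (torClass B P n).quotKerEquivOfSurjective (torClass_surjective B P n)

/-- The product on `Tor^R(A, B)` induced by a multiplication on a projective resolution of `A`. -/
def torMulOf {P : Resolution R A} (μ : ChainMul P) (p q : ℕ) :
    TorMod R A B p →ₗ[R] TorMod R A B q →ₗ[R] TorMod R A B (p+q) :=
  LinearMap.compl₁₂
    ((LinearMap.ker (torClass B P p)).liftQ
      (LinearMap.flip ((LinearMap.ker (torClass B P q)).liftQ
        (LinearMap.flip ((cyclePair B μ p q).compr₂ (torClass B P (p+q))))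
        (fun y hy => LinearMap.mem_ker.2 (LinearMap.ext fun x =>
          torClass_cyclePair_right B μ p q x y hy))))
      (fun x hx => LinearMap.mem_ker.2 (LinearMap.ext fun y => by
        induction y using Submodule.Quotient.induction_on with
        | H y => exact torClass_cyclePair_left B μ p q x y hx)))
    (torEquiv B P p).symm.toLinearMap (torEquiv B P q).symm.toLinearMap

theorem torMulOf_torClass {P : Resolution R A} (μ : ChainMul P) (p q : ℕ)
    (x : torCycles B P p) (y : torCycles B P q) :
    torMulOf B μ p q (torClass B P p x) (torClass B P q y) =
      torClass B P (p+q) (cyclePair B μ p q x y) := by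
  have hx : (torEquiv B P p).symm (torClass B P p x) = Submodule.Quotient.mk x :=
    (LinearEquiv.symm_apply_eq _).2 rfl
  have hy : (torEquiv B P q).symm (torClass B P q y) = Submodule.Quotient.mk y :=
    (LinearEquiv.symm_apply_eq _).2 rfl
  rw [torMulOf, LinearMap.compl₁₂_apply]
  simp only [LinearEquiv.coe_coe, hx, hy]
  rfl

variable (R A)

/-- The product of the graded algebra `Tor^R(A, B)`. It is computed from a projective resolution
`P` of `A` and a chain map `P ⊗ P → P` over the multiplication of `A`; the latter exists and is
unique up to homotopy. -/
def torMul (p q : ℕ) : TorMod R A B p →ₗ[R] TorMod R A B q →ₗ[R] TorMod R A B (p+q) :=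
  torMulOf B (Classical.choice (nonempty_chainMul (projectiveResolution (ModuleCat.of R A)))) p q

/-- The unit `1 ⊗ 1 ∈ A ⊗_R B = Tor_0^R(A, B)`. -/
def torOne : TorMod R A B 0 :=
  (((tensoringRight (ModuleCat.{u} R)).obj (ModuleCat.of R B)).leftDerivedZeroIsoSelf.inv.app
    (ModuleCat.of R A)).hom ((1 : A) ⊗ₜ[R] (1 : B))

/-! ### Simplicial complexes, face rings, multigraded Tor -/

section FaceRing

open MvPolynomial

variable (k : Type u) [Field k] {m : ℕ}

/-- `x_σ = ∏_{i ∈ σ} x_i`. -/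
def sqfreeMonomial (σ : Finset (Fin m)) : MvPolynomial (Fin m) k := ∏ i ∈ σ, X i

/-- `I_P`, the ideal generated by the `x_{σ_i}`. -/
def generatedIdeal {s : ℕ} (P : Fin s → Finset (Fin m)) : Ideal (MvPolynomial (Fin m) k) :=
  Ideal.span (Set.range fun i => sqfreeMonomial k (P i))

/-- The Stanley-Reisner ideal of `K`. An abstract simplicial complex on `[m]` (ghost vertices
allowed) is a set of subsets of `[m]` closed under passing to subsets. -/
def stanleyReisnerIdeal (K : LowerSet (Finset (Fin m))) : Ideal (MvPolynomial (Fin m) k) :=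
  Ideal.span (sqfreeMonomial k '' {σ | σ ∉ K})

/-- The Stanley-Reisner face ring `k(K)`. -/
abbrev FaceRing (K : LowerSet (Finset (Fin m))) : Type u :=
  MvPolynomial (Fin m) k ⧸ stanleyReisnerIdeal k K

/-- `P` is a simplicial complement of `K`: a finite sequence (repetitions allowed) of non-empty
subsets of `[m]` with `I_P = I_K`. -/
structure IsSimplicialComplement {s : ℕ} (P : Fin s → Finset (Fin m))
    (K : LowerSet (Finset (Fin m))) : Prop where
  nonempty : ∀ i, (P i).Nonempty
  ideal_eq : generatedIdeal k P = stanleyReisnerIdeal k K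

/-- The field `k` as a `k[x]`-algebra on which every `x_i` acts as zero. -/
def TrivialAlgebra (_m : ℕ) : Type u := k

instance (m : ℕ) : CommRing (TrivialAlgebra k m) := inferInstanceAs (CommRing k)

instance (m : ℕ) : Algebra (MvPolynomial (Fin m) k) (TrivialAlgebra k m) :=
  (constantCoeff : MvPolynomial (Fin m) k →+* k).toAlgebra

variable (K : LowerSet (Finset (Fin m)))

/-- `Tor_n^{k[x]}(k(K), k)`. -/
def FaceTor (n : ℕ) : Type u :=
  TorMod (MvPolynomial (Fin m) k) (FaceRing k K) (TrivialAlgebra k m) n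

instance (n : ℕ) : AddCommGroup (FaceTor k K n) :=
  inferInstanceAs (AddCommGroup
    (TorMod (MvPolynomial (Fin m) k) (FaceRing k K) (TrivialAlgebra k m) n))

instance (n : ℕ) : Module (MvPolynomial (Fin m) k) (FaceTor k K n) :=
  inferInstanceAs (Module (MvPolynomial (Fin m) k)
    (TorMod (MvPolynomial (Fin m) k) (FaceRing k K) (TrivialAlgebra k m) n))

instance (n : ℕ) : Module k (FaceTor k K n) :=
  Module.compHom _ (C : k →+* MvPolynomial (Fin m) k)

/-- The product of the algebra `Tor^{k[x]}(k(K), k)`. -/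
def faceTorMul {p q : ℕ} (x : FaceTor k K p) (y : FaceTor k K q) : FaceTor k K (p + q) :=
  torMul (MvPolynomial (Fin m) k) (FaceRing k K) (TrivialAlgebra k m) p q x y

/-- The unit of the algebra `Tor^{k[x]}(k(K), k)`. -/
def faceTorOne : FaceTor k K 0 :=
  torOne (MvPolynomial (Fin m) k) (FaceRing k K) (TrivialAlgebra k m)

/-- A projective resolution of `k(K)` by `ℕ^m`-graded `k[x]`-modules, with differentials and
augmentation homogeneous of degree zero. -/
structure MultigradedResolution where
  res : Resolution (MvPolynomial (Fin m) k) (FaceRing k K)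
  deg : ∀ n, (Fin m →₀ ℕ) → AddSubgroup (res.complex.X n)
  isInternal : ∀ n, DirectSum.IsInternal (deg n)
  smul_mem : ∀ n (a b : Fin m →₀ ℕ) (c : k) (x : res.complex.X n), x ∈ deg n b →
    (monomial a c : MvPolynomial (Fin m) k) • x ∈ deg n (a + b)
  d_mem : ∀ i j (a : Fin m →₀ ℕ) (x : res.complex.X i), x ∈ deg i a →
    (res.complex.d i j).hom x ∈ deg j a
  augmentation_mem : ∀ (a : Fin m →₀ ℕ) (x : res.complex.X 0), x ∈ deg 0 a →
    ∃ c : k, (augmentation res).hom x = Ideal.Quotient.mk _ (monomial a c)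

/-- The degree `a` part of `P_n ⊗_{k[x]} k` (with `k` in degree `0`). -/
def MultigradedResolution.tensorDeg {K : LowerSet (Finset (Fin m))}
    (G : MultigradedResolution k K) (n : ℕ) (a : Fin m →₀ ℕ) :
    AddSubgroup ((G.res.complex.X n) ⊗[MvPolynomial (Fin m) k] (TrivialAlgebra k m)) :=
  AddSubgroup.closure
    {t | ∃ x ∈ G.deg n a, ∃ b : TrivialAlgebra k m, t = x ⊗ₜ[MvPolynomial (Fin m) k] b}

/-- The multidegree `a` part `Tor_{n,a}^{k[x]}(k(K), k)`: all classes of cycles of degree `a` in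
`P ⊗_{k[x]} k`, for `P` a multigraded projective resolution of `k(K)`. (Every `P` gives the same
classes.) -/
def multidegreeTor (n : ℕ) (a : Fin m →₀ ℕ) : Submodule k (FaceTor k K n) :=
  Submodule.span k {t | ∃ (G : MultigradedResolution k K)
    (z : torCycles (TrivialAlgebra k m) G.res n), z.1 ∈ G.tensorDeg k n a ∧
      t = torClass (TrivialAlgebra k m) G.res n z}

/-- A subset of `[m]` as a vector in `{0,1}^m`. -/
def indicatorVector (σ : Finset (Fin m)) : Fin m →₀ ℕ := ∑ i ∈ σ, Finsupp.single i 1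

end FaceRing

/-! ### Homology of a graded piece -/

section Homology

variable {k : Type u} [Field k] {V : Type*} [AddCommGroup V] [Module k V]

/-- The homology `ker(d : C → V) / d(C')` at the term `C` of a complex `C' → C → ⋯` whose terms are
subspaces of `V` and whose differential is the restriction of `d : V → V`. -/
abbrev HomologyAt (d : V →ₗ[k] V) (C C' : Submodule k V) : Type _ :=
  ↥(LinearMap.ker d ⊓ C) ⧸ (C'.map d).submoduleOf (LinearMap.ker d ⊓ C)

/-- The map on homology induced by the inclusion of a subcomplex. -/
def HomologyAt.incl (d : V →ₗ[k] V) {C C' D D' : Submodule k V} (h : C ≤ D) (h' : C' ≤ D') :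
    HomologyAt d C C' →ₗ[k] HomologyAt d D D' :=
  Submodule.mapQ _ _ (Submodule.inclusion (inf_le_inf_left _ h)) fun _ hx =>
    Submodule.map_mono h' hx

end Homology

/-! ### The algebra of a simplicial complement -/

section Bar

variable (k : Type u) [Field k] {m s : ℕ} (P : Fin s → Finset (Fin m))

/-- The vector space with basis the `e_S`, where for `S = {i₁ < ⋯ < i_r}` the vector `e_S` is
the symbol `σ_{i₁} ∧ ⋯ ∧ σ_{i_r}`. Symbols with arbitrarily ordered indices are `0` or `± e_S`
by antisymmetry. -/
abbrev Bar (s : ℕ) : Type u := Finset (Fin s) →₀ k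

/-- The differential `e_S ↦ ∑_u (-1)^u e_{S ∖ i_u}`, over the positions `u = 1, …, r` such that
omitting `σ_{i_u}` does not change the union. -/
def barD : Bar k s →ₗ[k] Bar k s :=
  Finsupp.linearCombination k fun S : Finset (Fin s) =>
    ∑ i ∈ S with (S.erase i).biUnion P = S.biUnion P,
      Finsupp.single (S.erase i) ((-1 : k) ^ (S.filter (· ≤ i)).card)

/-- The product: `e_S e_T` is the concatenation of the two symbols if every `σ_i`, `i ∈ S`, is
disjoint from every `σ_j`, `j ∈ T`, and `0` otherwise. -/
def barMul : Bar k s →ₗ[k] Bar k s →ₗ[k] Bar k s :=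
  Finsupp.linearCombination k fun S : Finset (Fin s) =>
    Finsupp.linearCombination k fun T : Finset (Fin s) =>
      if Disjoint S T ∧ ∀ i ∈ S, ∀ j ∈ T, Disjoint (P i) (P j) then
        Finsupp.single (S ∪ T) ((-1 : k) ^ ((S ×ˢ T).filter fun p => p.2 < p.1).card)
      else 0

/-- The part of homological degree `n`. -/
def barPiece (s n : ℕ) : Submodule k (Bar k s) := Finsupp.supported k k {S | S.card = n}

/-- The part of homological degree `n` and support `σ`, spanned by the symbols with union `σ`. -/
def barPieceAt (σ : Finset (Fin m)) (n : ℕ) : Submodule k (Bar k s) :=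
  Finsupp.supported k k {S | S.card = n ∧ S.biUnion P = σ}

/-- The trivial complex `k`, spanned by the empty symbol `1` in degree `0`. -/
def barUnitPiece (s n : ℕ) : Submodule k (Bar k s) :=
  Finsupp.supported k k {S | S.card = n ∧ S = ∅}

theorem barPieceAt_le (σ : Finset (Fin m)) (n : ℕ) : barPieceAt k P σ n ≤ barPiece k s n :=
  Finsupp.supported_mono fun _ h => h.1

theorem barUnitPiece_le (n : ℕ) : barUnitPiece k s n ≤ barPiece k s n :=
  Finsupp.supported_mono fun _ h => h.1

/-- The cycles of degree `n`. -/
abbrev barCycles (n : ℕ) : Submodule k (Bar k s) := LinearMap.ker (barD k P) ⊓ barPiece k s n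

/-- The homology of degree `n`. -/
abbrev BarHomology (n : ℕ) : Type u :=
  HomologyAt (barD k P) (barPiece k s n) (barPiece k s (n + 1))

/-- The homology of degree `n` of the subcomplex with support `σ`. -/
abbrev BarHomologyAt (σ : Finset (Fin m)) (n : ℕ) : Type u :=
  HomologyAt (barD k P) (barPieceAt k P σ n) (barPieceAt k P σ (n + 1))

/-- The homology of degree `n` of the trivial complex `k`. -/
abbrev BarHomologyUnit (n : ℕ) : Type u :=
  HomologyAt (barD k P) (barUnitPiece k s n) (barUnitPiece k s (n + 1))

/-- The homology class of a cycle. -/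
abbrev barClass (n : ℕ) : barCycles k P n →ₗ[k] BarHomology k P n := Submodule.mkQ _

/-- The map induced by the inclusion of the subcomplex with support `σ`. -/
def barHomologyAtIncl (σ : Finset (Fin m)) (n : ℕ) :
    BarHomologyAt k P σ n →ₗ[k] BarHomology k P n :=
  HomologyAt.incl _ (barPieceAt_le k P σ n) (barPieceAt_le k P σ (n + 1))

/-- The map induced by the inclusion of the trivial complex `k`. -/
def barHomologyUnitIncl (n : ℕ) : BarHomologyUnit k P n →ₗ[k] BarHomology k P n :=
  HomologyAt.incl _ (barUnitPiece_le k n) (barUnitPiece_le k (n + 1))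

/-- The map `H_n(k) ⊕ ⨁_{σ ∈ Kᶜ} H_n(Λ^{*,σ}) → H_n(Λ)` induced by the inclusions. -/
def barDecomposition (K : LowerSet (Finset (Fin m))) (n : ℕ) :
    (BarHomologyUnit k P n × DirectSum {σ // σ ∉ K} fun σ => BarHomologyAt k P σ.1 n) →ₗ[k]
      BarHomology k P n :=
  LinearMap.coprod (barHomologyUnitIncl k P n)
    (DirectSum.toModule k _ _ fun σ => barHomologyAtIncl k P σ.1 n)

/-- The unit `1`, i.e. the empty symbol. -/
def barOne (s : ℕ) : Bar k s := Finsupp.single ∅ 1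

/-- The product, unit, differential and grading make `Bar k s` a differential graded algebra. -/
structure BarIsDGA : Prop where
  one_mul : ∀ x, barMul k P (barOne k s) x = x
  mul_one : ∀ x, barMul k P x (barOne k s) = x
  mul_assoc : ∀ x y z, barMul k P (barMul k P x y) z = barMul k P x (barMul k P y z)
  mul_mem : ∀ p q x y, x ∈ barPiece k s p → y ∈ barPiece k s q →
    barMul k P x y ∈ barPiece k s (p + q)
  d_mem : ∀ n x, x ∈ barPiece k s (n + 1) → barD k P x ∈ barPiece k s n
  d_d : ∀ x, barD k P (barD k P x) = 0
  leibniz : ∀ p x y, x ∈ barPiece k s p →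
    barD k P (barMul k P x y) = barMul k P (barD k P x) y + (-1 : k) ^ p • barMul k P x (barD k P y)

/-- `1` is a cycle of degree `0`. -/
theorem barOne_mem : barOne k s ∈ barCycles k P 0 := by
  refine ⟨?_, ?_⟩
  · simp [barOne, barD]
  · exact Finsupp.single_mem_supported k 1 (by simp)

end Bar

/-! ### Reduced simplicial homology and cohomology -/

section Simplicial

variable {m : ℕ}

/-- The Alexander dual `K^* = {τ ∣ [m] ∖ τ ∉ K}`. -/
def alexanderDual (K : LowerSet (Finset (Fin m))) : LowerSet (Finset (Fin m)) where
  carrier := {τ | τᶜ ∉ K}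
  lower' := fun _ _ hba ha hb => ha (K.lower (Finset.compl_subset_compl.2 hba) hb)

/-- The link `{τ ∈ K ∣ ω ∪ τ ∈ K, ω ∩ τ = ∅}`. -/
def link (K : LowerSet (Finset (Fin m))) (ω : Finset (Fin m)) : LowerSet (Finset (Fin m)) where
  carrier := {τ | τ ∈ K ∧ ω ∪ τ ∈ K ∧ Disjoint ω τ}
  lower' := fun _ _ hba ha => ⟨K.lower hba ha.1,
    K.lower (Finset.union_subset_union_right hba) ha.2.1, ha.2.2.mono_right hba⟩

/-- The full subcomplex `K ∩ σ = {τ ∈ K ∣ τ ⊆ σ}`. -/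
def restrict (K : LowerSet (Finset (Fin m))) (σ : Finset (Fin m)) : LowerSet (Finset (Fin m)) where
  carrier := {τ | τ ∈ K ∧ τ ⊆ σ}
  lower' := fun _ _ hba ha => ⟨K.lower hba ha.1, hba.trans ha.2⟩

variable (k : Type u) [Field k]

/-- The boundary `∂τ = ∑_{v ∈ τ} (-1)^{#{w ∈ τ, w < v}} (τ ∖ v)` of oriented simplices. The
boundary of a vertex is the empty simplex. -/
def boundary (m : ℕ) : (Finset (Fin m) →₀ k) →ₗ[k] (Finset (Fin m) →₀ k) :=
  Finsupp.linearCombination k fun τ : Finset (Fin m) =>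
    ∑ v ∈ τ, Finsupp.single (τ.erase v) ((-1 : k) ^ (τ.filter (· < v)).card)

/-- The augmented `n`-chains of `K`, spanned by the faces of dimension `n ≥ -1`. -/
def chains (K : LowerSet (Finset (Fin m))) (n : ℤ) : Submodule k (Finset (Fin m) →₀ k) :=
  Finsupp.supported k k {τ | τ ∈ K ∧ (τ.card : ℤ) = n + 1}

/-- The reduced homology of `K` with coefficients in `k`; in degree `-1` it is `k` if `K = {∅}`. -/
abbrev ReducedHomology (K : LowerSet (Finset (Fin m))) (n : ℤ) : Type u :=
  HomologyAt (boundary k m) (chains k K n) (chains k K (n + 1))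

/-- The augmented `n`-cochains of `K`: functions on the faces of dimension `n`, extended by `0`. -/
def cochains (K : LowerSet (Finset (Fin m))) (n : ℤ) : Submodule k (Finset (Fin m) → k) where
  carrier := {f | ∀ τ, ¬(τ ∈ K ∧ (τ.card : ℤ) = n + 1) → f τ = 0}
  zero_mem' := fun _ _ => rfl
  add_mem' := fun hf hg τ hτ => by simp [hf τ hτ, hg τ hτ]
  smul_mem' := fun c f hf τ hτ => by simp [hf τ hτ]

open Classical in
/-- The coboundary of `K`: `(δf)(τ) = f(∂τ)` for `τ ∈ K`. -/
def coboundary (K : LowerSet (Finset (Fin m))) : (Finset (Fin m) → k) →ₗ[k] (Finset (Fin m) → k) :=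
  LinearMap.pi fun τ => if τ ∈ K then
    ∑ v ∈ τ, (-1 : k) ^ (τ.filter (· < v)).card • LinearMap.proj (τ.erase v) else 0

/-- The reduced cohomology of `K` with coefficients in `k`. -/
abbrev ReducedCohomology (K : LowerSet (Finset (Fin m))) (n : ℤ) : Type u :=
  HomologyAt (coboundary k K) (cochains k K n) (cochains k K (n - 1))

end Simplicial

end

end SimplicialComplement

open SimplicialComplement

/-!
The algebra `Λ(P)` of a simplicial complement is the Taylor resolution of the face ring, with its
classical product, reduced modulo the variables. Both are instances of one construction: for weights
`t : α → R` on the points, `taylorD t P` and `taylorMul t P` define a differential graded algebra on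
the free module with basis the sets of indices (`taylorD_taylorD`, `taylor_leibniz`,
`taylorMul_assoc`). The weights `t = x` give the Taylor complex of the monomials `x_{P i}`, and
`t = 0` gives `Λ(P)` (`barD_eq_taylorD`, `barMul_eq_taylorMul`), because a monomial coefficient
vanishes modulo the variables unless it is `1`.

The Taylor complex is exact: in each multidegree one inserts an index `i` such that `P i` is contained
in the support of the multidegree (`taylorHomotopy_contracts`). It is thus a free resolution of `k(K)`
(`taylorResolution`) with a multiplication (`taylorChainMul`). Comparison maps between resolutions
preserve classes in `Tor` and are multiplicative up to homotopy (`torClass_tensorMap`,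
`tensorMap_chainPair`), so `Tor` with its product can be computed from any resolution with a
multiplication (`torMul_torClass`); this gives the isomorphism of algebras `barTorEquiv`.

The differential of `Λ(P)` preserves the union of a symbol, so `Λ(P)` is the direct sum of its
subcomplexes `Λ^σ`, and `Λ^σ = 0` for a nonempty face `σ` (`barDecomposition_bijective`). The Taylor
resolution is multigraded and `Λ^σ` is its reduction in multidegree `σ`. A multigraded resolution is
compared with it through the part of multidegree zero of a comparison map (`degreeZeroMap`), so any
two multigraded resolutions define the same part of `Tor` (`range_barHomologyAtIncl`).

For the summands, let `D` be the simplicial complex of all `S ⊔ τ`, where `τ ⊆ σ` and `S` is a set of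
indices with `⋃_{i ∈ S} P i ⊆ σ ∖ τ` (`jointComplex`). It has two acyclic subcomplexes. The faces with
`⋃_{i ∈ S} P i ≠ σ` are contracted by adding to `τ` a point of `σ ∖ ⋃_{i ∈ S} P i`, and the faces with
`σ ∖ τ ∉ K` by adding to `S` an index `i` with `P i ⊆ σ ∖ τ`. Neither choice is compatible with all of
the boundary, but the error has fewer vertices of the other kind, and induction on their number shows
the acyclicity (`IsConing.exists_relD_eq`). The quotients of `D` by the two subcomplexes are `Λ^σ` and
the span `Q` of the `τ ⊆ σ` with `σ ∖ τ ∈ K`, so these have the same homology. Finally, `Q` is the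
quotient of the full simplex on `σ` by the link of the complement of `σ` in `K^*`, and the map
`τ ↦ ± (σ ∖ τ)` identifies `Q` with the cochain complex of `K ∩ σ` (`complementMap_relD`).
-/

namespace SimplicialComplement

noncomputable section

/-! ### Comparison of resolutions and the product on Tor -/

section TorComparison

variable {R A B : Type u} [CommRing R] [CommRing A] [Algebra R A] [CommRing B] [Algebra R B]

/-- `torClass` through Mathlib's cycles of `P ⊗ B`: naturality is available for
`HomologicalComplex.homologyπ`, not for the explicit quotient of submodules. -/
theorem torIso_inv_mk (P : Resolution R A) (n : ℕ) (c : (tensorComplex B P).cycles n)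
    (z : torCycles B P n) (hc : ((tensorComplex B P).iCycles n).hom c = z.1) :
    torClass B P n z =
      (P.isoLeftDerivedObj ((tensoringRight (ModuleCat.{u} R)).obj (ModuleCat.of R B)) n).inv.hom
        (((tensorComplex B P).homologyπ n).hom c) := by
  have hprev : (ComplexShape.down ℕ).prev n = n + 1 := by simp
  have e1 := (tensorComplex B P).π_homologyIsoSc'_hom (n+1) n (n-1) hprev (next_eq n)
  have e2 := ((tensorComplex B P).sc' (n+1) n (n-1)).π_moduleCatCyclesIso_hom
  have e3 : (tensorComplex B P).homologyπ n ≫ ((tensorComplex B P).homologyIsoSc' (n+1) n (n-1) hprev (next_eq n)).hom ≫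
      ((tensorComplex B P).sc' (n+1) n (n-1)).moduleCatHomologyIso.hom =
      ((tensorComplex B P).cyclesIsoSc' (n+1) n (n-1) hprev (next_eq n)).hom ≫
       ((tensorComplex B P).sc' (n+1) n (n-1)).moduleCatCyclesIso.hom ≫
       ((tensorComplex B P).sc' (n+1) n (n-1)).moduleCatLeftHomologyData.π := by
    rw [reassoc_of% e1, e2]
  have e4 : ((tensorComplex B P).cyclesIsoSc' (n+1) n (n-1) hprev (next_eq n)).hom ≫
       ((tensorComplex B P).sc' (n+1) n (n-1)).moduleCatCyclesIso.hom ≫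
       ((tensorComplex B P).sc' (n+1) n (n-1)).moduleCatLeftHomologyData.i = (tensorComplex B P).iCycles n := by
    rw [ShortComplex.moduleCatCyclesIso_hom_i, HomologicalComplex.cyclesIsoSc'_hom_iCycles]
  have hinj : Function.Injective (torIso B P n).hom.hom :=
    (ModuleCat.mono_iff_injective _).1 inferInstance
  apply hinj
  have l1 : (torIso B P n).hom.hom (torClass B P n z) = Submodule.mkQ _ z :=
    Iso.inv_hom_id_apply (torIso B P n) _
  rw [l1]
  set w := (((tensorComplex B P).cyclesIsoSc' (n+1) n (n-1) hprev (next_eq n)).hom ≫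
       ((tensorComplex B P).sc' (n+1) n (n-1)).moduleCatCyclesIso.hom).hom c with hw
  have hwz : w = z := by
    apply Subtype.ext
    rw [← hc]
    exact congrArg (fun f => f.hom c) e4
  have l2 := congrArg (fun f => f.hom c) e3
  refine Eq.trans ?_ (Eq.trans l2.symm ?_)
  · rw [← hwz]; rfl
  · exact congrArg (((tensorComplex B P).homologyIsoSc' (n+1) n (n-1) hprev (next_eq n)).hom ≫
      ((tensorComplex B P).sc' (n+1) n (n-1)).moduleCatHomologyIso.hom).hom
      (Iso.inv_hom_id_apply (P.isoLeftDerivedObj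
        ((tensoringRight (ModuleCat.{u} R)).obj (ModuleCat.of R B)) n)
        (((tensorComplex B P).homologyπ n).hom c)).symm

theorem exists_cycles (P : Resolution R A) (n : ℕ) (z : torCycles B P n) :
    ∃ c : (tensorComplex B P).cycles n, ((tensorComplex B P).iCycles n).hom c = z.1 := by
  have hprev : (ComplexShape.down ℕ).prev n = n + 1 := by simp
  have e4 : ((tensorComplex B P).cyclesIsoSc' (n+1) n (n-1) hprev (next_eq n)).hom ≫
       ((tensorComplex B P).sc' (n+1) n (n-1)).moduleCatCyclesIso.hom ≫
       ((tensorComplex B P).sc' (n+1) n (n-1)).moduleCatLeftHomologyData.i = (tensorComplex B P).iCycles n := by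
    rw [ShortComplex.moduleCatCyclesIso_hom_i, HomologicalComplex.cyclesIsoSc'_hom_iCycles]
  obtain ⟨c, hc⟩ := (ModuleCat.epi_iff_surjective
    (((tensorComplex B P).cyclesIsoSc' (n+1) n (n-1) hprev (next_eq n)).hom ≫
      ((tensorComplex B P).sc' (n+1) n (n-1)).moduleCatCyclesIso.hom)).1 inferInstance z
  exact ⟨c, (congrArg (fun f => f.hom c) e4).symm.trans (congrArg Subtype.val hc)⟩

/-- `f ⊗ 1 : P ⊗ B → Q ⊗ B` in degree `n`. -/
def tensorMap {P Q : Resolution R A} (f : P.complex ⟶ Q.complex) (n : ℕ) :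
    (P.complex.X n) ⊗[R] B →ₗ[R] (Q.complex.X n) ⊗[R] B :=
  (f.f n).hom.rTensor B

theorem tensorD_tensorMap {P Q : Resolution R A} (f : P.complex ⟶ Q.complex) (i j : ℕ)
    (x : (P.complex.X i) ⊗[R] B) :
    tensorD B Q i j (tensorMap f i x) = tensorMap f j (tensorD B P i j x) := by
  have := f.comm i j
  simp only [tensorD, tensorMap, ← LinearMap.comp_apply, ← LinearMap.rTensor_comp]
  rw [← ModuleCat.hom_comp, this, ModuleCat.hom_comp]

theorem tensorMap_mem {P Q : Resolution R A} (f : P.complex ⟶ Q.complex) (n : ℕ)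
    (z : torCycles B P n) : tensorMap f n z.1 ∈ torCycles B Q n := by
  have hz : tensorD B P n (n-1) z.1 = 0 := z.2
  change tensorD B Q n (n-1) _ = 0
  rw [tensorD_tensorMap, hz, map_zero]

/-- A comparison map of resolutions of `A` preserves the classes in `Tor`. -/
theorem torClass_tensorMap {P Q : Resolution R A} (f : P.complex ⟶ Q.complex)
    (hf : f.f 0 ≫ augmentation Q = augmentation P) (n : ℕ) (z : torCycles B P n) :
    torClass B Q n ⟨tensorMap f n z.1, tensorMap_mem f n z⟩ = torClass B P n z := by
  obtain ⟨c, hc⟩ := exists_cycles P n z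
  let F := (tensoringRight (ModuleCat.{u} R)).obj (ModuleCat.of R B)
  have comm : f.f 0 ≫ Q.π.f 0 = P.π.f 0 ≫ 𝟙 _ := by
    rw [Category.comp_id]; exact hf
  have nat := ProjectiveResolution.isoLeftDerivedObj_inv_naturality (𝟙 _) P Q f comm F n
  rw [CategoryTheory.Functor.map_id, Category.comp_id] at nat
  have h1 := HomologicalComplex.cyclesMap_i ((F.mapHomologicalComplex _).map f) n
  have h2 := HomologicalComplex.homologyπ_naturality ((F.mapHomologicalComplex (ComplexShape.down ℕ)).map f) n
  rw [torIso_inv_mk P n c z hc, torIso_inv_mk Q n ((HomologicalComplex.cyclesMap ((F.mapHomologicalComplex _).map f) n).hom c)]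
  · have h3 := congrArg (fun g => g.hom c) h2
    have h4 := congrArg (fun g => g.hom (((tensorComplex B P).homologyπ n).hom c)) nat
    refine Eq.trans ?_ h4.symm
    exact congrArg (ModuleCat.Hom.hom _) h3.symm
  · exact (congrArg (fun g => g.hom c) h1).trans (congrArg (tensorMap f n) hc)

theorem exists_comparison (P Q : Resolution R A) :
    ∃ f : P.complex ⟶ Q.complex, f.f 0 ≫ augmentation Q = augmentation P :=
  ⟨ProjectiveResolution.lift (𝟙 _) P Q,
    (ProjectiveResolution.lift_commutes_zero (𝟙 _) P Q).trans (Category.comp_id _)⟩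

/-- The unit of `Tor` is the class of `x ⊗ 1` for any `x ∈ P₀` over `1 ∈ A`. -/
theorem torClass_eq_torOne (P : Resolution R A) (x : P.complex.X 0)
    (hx : (augmentation P).hom x = 1) (z : torCycles B P 0) (hz : z.1 = x ⊗ₜ (1 : B)) :
    torClass B P 0 z = torOne R A B := by
  obtain ⟨c, hc⟩ := exists_cycles P 0 z
  let F := (tensoringRight (ModuleCat.{u} R)).obj (ModuleCat.of R B)
  have h1 := P.fromLeftDerivedZero_eq F
  have hiso : IsIso (F.fromLeftDerivedZero.app (ModuleCat.of R A)) :=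
    inferInstanceAs (IsIso (F.leftDerivedZeroIsoSelf.hom.app (ModuleCat.of R A)))
  have hinj : Function.Injective (F.fromLeftDerivedZero.app (ModuleCat.of R A)).hom :=
    (ModuleCat.mono_iff_injective (F.fromLeftDerivedZero.app (ModuleCat.of R A))).1
      (IsIso.mono_of_iso _)
  apply hinj
  have h2 : (F.fromLeftDerivedZero.app (ModuleCat.of R A)).hom (torOne R A B) = (1 : A) ⊗ₜ[R] (1 : B) :=
    congrArg (fun g => g.hom ((1 : A) ⊗ₜ[R] (1 : B))) (F.leftDerivedZeroIsoSelf_inv_hom_id_app (ModuleCat.of R A))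
  rw [h2, torIso_inv_mk P 0 c z hc]
  have h5 : (P.isoLeftDerivedObj F 0).inv ≫ F.fromLeftDerivedZero.app (ModuleCat.of R A) =
      (ChainComplex.isoHomologyι₀ _).hom ≫ P.fromLeftDerivedZero' F :=
    (Iso.inv_comp_eq _).2 h1
  have h6 := P.pOpcycles_comp_fromLeftDerivedZero' F
  have h7 := (tensorComplex B P).homology_π_ι 0
  have h3 : (tensorComplex B P).homologyπ 0 ≫
      (P.isoLeftDerivedObj F 0).inv ≫ F.fromLeftDerivedZero.app (ModuleCat.of R A)
      = (tensorComplex B P).iCycles 0 ≫ F.map (P.π.f 0) :=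
    (congrArg (fun g => (tensorComplex B P).homologyπ 0 ≫ g) h5).trans
      ((congrArg (fun g => g ≫ P.fromLeftDerivedZero' F) h7).trans
        (congrArg (fun g => (tensorComplex B P).iCycles 0 ≫ g) h6))
  have h4 := congrArg (fun g => g.hom c) h3
  refine h4.trans ?_
  change (F.map (P.π.f 0)).hom (((tensorComplex B P).iCycles 0).hom c) = _
  rw [hc, hz]
  change (augmentation P).hom x ⊗ₜ[R] (1 : B) = _
  rw [hx]

/-- A chain map from a complex of projectives to a resolution that vanishes after augmentation is
null-homotopic. -/
theorem exists_nullHomotopy (C : ChainComplex (ModuleCat.{u} R) ℕ) [∀ n, Projective (C.X n)]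
    (Q : Resolution R A) (g : C ⟶ Q.complex) (hg : g.f 0 ≫ augmentation Q = 0) :
    ∃ h : ∀ i j, C.X i ⟶ Q.complex.X j, ∀ n,
      g.f n = C.d n (n-1) ≫ h (n-1) n + h n (n+1) ≫ Q.complex.d (n+1) n := by
  let h0 : C.X 0 ⟶ Q.complex.X 1 := (exact_augmentation Q).liftFromProjective (g.f 0) hg
  have hh0 : h0 ≫ Q.complex.d 1 0 = g.f 0 := (exact_augmentation Q).liftFromProjective_comp _ _
  let h1 : C.X 1 ⟶ Q.complex.X 2 := (Q.exact_succ 0).liftFromProjective (g.f 1 - C.d 1 0 ≫ h0)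
    (by dsimp only; rw [Preadditive.sub_comp, Category.assoc, hh0, g.comm, sub_self])
  have hh1 : h1 ≫ Q.complex.d 2 1 = g.f 1 - C.d 1 0 ≫ h0 :=
    (Q.exact_succ 0).liftFromProjective_comp _ _
  let H : Homotopy g 0 := Homotopy.mkInductive _ h0 hh0.symm h1 (by rw [hh1]; abel)
    fun n ⟨k, k', w⟩ => ⟨(Q.exact_succ (n+1)).liftFromProjective (g.f (n+2) - C.d _ _ ≫ k')
      (by simp [w]), by
        rw [(Q.exact_succ (n+1)).liftFromProjective_comp]
        abel⟩
  refine ⟨H.hom, fun n => ?_⟩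
  have := H.comm n
  rw [HomologicalComplex.zero_f, add_zero] at this
  rw [this, prevD_eq H.hom (show (ComplexShape.down ℕ).Rel (n+1) n by simp)]
  congr 1
  cases n with
  | zero => simp
  | succ n => rw [dNext_eq H.hom (show (ComplexShape.down ℕ).Rel (n+1) n by simp)]; rfl

/-- The pairing `(x ⊗ b, y ⊗ c) ↦ g(x ⊗ y) ⊗ bc` induced by `g : X ⊗ Y → Z`. -/
def pairing (B : Type u) [CommRing B] [Algebra R B] {X Y Z : ModuleCat.{u} R} (g : X ⊗ Y ⟶ Z) :
    X ⊗[R] B →ₗ[R] Y ⊗[R] B →ₗ[R] Z ⊗[R] B :=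
  TensorProduct.curry (TensorProduct.map g.hom (LinearMap.mul' R B) ∘ₗ
    (TensorProduct.tensorTensorTensorComm R X B Y B).toLinearMap)

theorem pairing_add {X Y Z : ModuleCat.{u} R} (g g' : X ⊗ Y ⟶ Z) (x : X ⊗[R] B) (y : Y ⊗[R] B) :
    pairing B (g + g') x y = pairing B g x y + pairing B g' x y := by
  simp [pairing, TensorProduct.map_add_left]

theorem pairing_units_smul {X Y Z : ModuleCat.{u} R} (e : ℤˣ) (g : X ⊗ Y ⟶ Z) (x : X ⊗[R] B)
    (y : Y ⊗[R] B) : pairing B (e • g) x y = e • pairing B g x y := by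
  obtain rfl | rfl := Int.units_eq_one_or e
  · simp
  · have h := pairing_add g (-g) x y
    have h0 : pairing B (0 : X ⊗ Y ⟶ Z) x y = 0 := by simp [pairing]
    rw [add_neg_cancel, h0] at h
    rw [Units.neg_smul, one_smul, Units.neg_smul, one_smul]
    exact eq_neg_of_add_eq_zero_right h.symm

theorem pairing_comp {X Y Z W : ModuleCat.{u} R} (g : X ⊗ Y ⟶ Z) (u : Z ⟶ W) (x : X ⊗[R] B)
    (y : Y ⊗[R] B) : pairing B (g ≫ u) x y = u.hom.rTensor B (pairing B g x y) := by
  induction x with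
  | zero => simp
  | add x x' hx hx' => simp only [map_add, LinearMap.add_apply, hx, hx']
  | tmul x b =>
    induction y with
    | zero => simp
    | add y y' hy hy' => simp only [map_add, hy, hy']
    | tmul y c => rfl

theorem pairing_tensorHom_comp {X Y X' Y' Z : ModuleCat.{u} R} (u : X ⟶ X') (v : Y ⟶ Y')
    (g : X' ⊗ Y' ⟶ Z) (x : X ⊗[R] B) (y : Y ⊗[R] B) :
    pairing B ((u ⊗ₘ v) ≫ g) x y = pairing B g (u.hom.rTensor B x) (v.hom.rTensor B y) := by
  induction x with
  | zero => simp
  | add x x' hx hx' => simp only [map_add, LinearMap.add_apply, hx, hx']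
  | tmul x b =>
    induction y with
    | zero => simp
    | add y y' hy hy' => simp only [map_add, hy, hy']
    | tmul y c => rfl

theorem pairing_whiskerRight_comp {X Y X' Z : ModuleCat.{u} R} (u : X ⟶ X')
    (g : X' ⊗ Y ⟶ Z) (x : X ⊗[R] B) (y : Y ⊗[R] B) :
    pairing B ((u ▷ Y) ≫ g) x y = pairing B g (u.hom.rTensor B x) y := by
  rw [← tensorHom_id, pairing_tensorHom_comp]
  simp

theorem pairing_whiskerLeft_comp {X Y Y' Z : ModuleCat.{u} R} (v : Y ⟶ Y')
    (g : X ⊗ Y' ⟶ Z) (x : X ⊗[R] B) (y : Y ⊗[R] B) :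
    pairing B ((X ◁ v) ≫ g) x y = pairing B g x (v.hom.rTensor B y) := by
  rw [← id_tensorHom, pairing_tensorHom_comp]
  simp

theorem ιZ_tensorHom {C D : ChainComplex (ModuleCat.{u} R) ℕ} (f : C ⟶ D) (p q n : ℕ)
    (h : p + q = n) : ιZ C p q n ≫ (HomologicalComplex.tensorHom f f).f n =
      (f.f p ⊗ₘ f.f q) ≫ ιZ D p q n := by
  rw [ιZ_eq C p q n h, ιZ_eq D p q n h]
  refine (HomologicalComplex.ι_mapBifunctorMap ..).trans ?_
  rw [MonoidalCategory.tensorHom_def, Category.assoc]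
  rfl

/-- A comparison map of resolutions is multiplicative up to homotopy. -/
theorem tensorMap_chainPair {P Q : Resolution R A} (f : P.complex ⟶ Q.complex)
    (hf : f.f 0 ≫ augmentation Q = augmentation P) (μ : ChainMul P) (ν : ChainMul Q) (p q : ℕ)
    (x : torCycles B P p) (y : torCycles B P q) :
    ∃ w, tensorD B Q (p+q+1) (p+q) w = tensorMap f (p+q) (chainPair B μ p q (p+q) x.1 y.1) -
      chainPair B ν p q (p+q) (tensorMap f p x.1) (tensorMap f q y.1) := by
  -- the two composites around the square lift the same map `A ⊗ A → A`
  let g : HomologicalComplex.tensorObj P.complex P.complex ⟶ Q.complex :=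
    μ.hom ≫ f - HomologicalComplex.tensorHom f f ≫ ν.hom
  have hg : g.f 0 ≫ augmentation Q = 0 := by
    apply HomologicalComplex.mapBifunctor.hom_ext
    intro p q h
    obtain ⟨rfl, rfl⟩ : p = 0 ∧ q = 0 := by
      have : p + q = 0 := h
      omega
    have e1 := ιZ_tensorHom f 0 0 0 rfl
    rw [ιZ_eq _ 0 0 0 rfl, ιZ_eq _ 0 0 0 rfl] at e1
    have e2 := μ.lifts
    have e3 := ν.lifts
    change HomologicalComplex.ιTensorObj P.complex P.complex 0 0 0 rfl ≫ (μ.hom.f 0 ≫ f.f 0 -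
      (HomologicalComplex.tensorHom f f).f 0 ≫ ν.hom.f 0) ≫ augmentation Q = _
    rw [Preadditive.sub_comp, Preadditive.comp_sub, Category.assoc, hf, e2, Category.assoc,
      reassoc_of% e1, e3, MonoidalCategory.tensorHom_comp_tensorHom_assoc, hf, sub_self]
    exact Limits.comp_zero.symm
  obtain ⟨h, hh⟩ := exists_nullHomotopy _ Q g hg
  have key : (ιZ P.complex p q (p+q) ≫ μ.hom.f (p+q)) ≫ f.f (p+q) =
      ιZ P.complex p q (p+q) ≫ (HomologicalComplex.tensorObj P.complex P.complex).d (p+q) (p+q-1) ≫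
        h (p+q-1) (p+q) + (ιZ P.complex p q (p+q) ≫ h (p+q) (p+q+1)) ≫ Q.complex.d (p+q+1) (p+q) +
      (f.f p ⊗ₘ f.f q) ≫ ιZ Q.complex p q (p+q) ≫ ν.hom.f (p+q) := by
    have e1 := ιZ_tensorHom f p q (p+q) rfl
    rw [← reassoc_of% e1, Category.assoc, Category.assoc, ← Preadditive.comp_add,
      ← Preadditive.comp_add, ← hh (p+q)]
    congr 1
    change _ = (μ.hom.f _ ≫ f.f _ - (HomologicalComplex.tensorHom f f).f _ ≫ ν.hom.f _) + _
    rw [sub_add_cancel]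
  refine ⟨pairing B (ιZ P.complex p q (p+q) ≫ h (p+q) (p+q+1)) x.1 y.1, ?_⟩
  have key2 := congrArg (fun t => pairing B t x.1 y.1) key
  simp only [pairing_add, pairing_comp _ (f.f _), pairing_tensorHom_comp,
    pairing_comp _ (Q.complex.d _ _)] at key2
  have hx : (P.complex.d p (p-1)).hom.rTensor B x.1 = 0 := x.2
  have hy : (P.complex.d q (q-1)).hom.rTensor B y.1 = 0 := y.2
  have hz : pairing B (ιZ P.complex p q (p+q) ≫
      (HomologicalComplex.tensorObj P.complex P.complex).d (p+q) (p+q-1) ≫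
        h (p+q-1) (p+q)) x.1 y.1 = 0 := by
    rcases hn : p + q with _ | n
    · rw [HomologicalComplex.shape _ _ _ (by simp)]
      simp [pairing]
    · have e1 := ι_d P.complex p q n hn
      rw [Nat.add_sub_cancel, reassoc_of% e1, Preadditive.add_comp, pairing_add,
        Linear.units_smul_comp, pairing_units_smul, Category.assoc, Category.assoc,
        pairing_whiskerRight_comp, pairing_whiskerLeft_comp, hx, hy]
      simp
  rw [hz, zero_add] at key2
  exact eq_sub_of_add_eq key2.symm

/-- The product on `Tor` can be computed from any resolution with a multiplication. -/
theorem torMul_torClass {P : Resolution R A} (μ : ChainMul P) (p q : ℕ)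
    (x : torCycles B P p) (y : torCycles B P q) :
    torMul R A B p q (torClass B P p x) (torClass B P q y) =
      torClass B P (p+q) (cyclePair B μ p q x y) := by
  let Q : Resolution R A := projectiveResolution (ModuleCat.of R A)
  let ν : ChainMul Q := Classical.choice (nonempty_chainMul Q)
  obtain ⟨f, hf⟩ := exists_comparison P Q
  rw [← torClass_tensorMap f hf p x, ← torClass_tensorMap f hf q y,
    ← torClass_tensorMap f hf (p+q)]
  refine (torMulOf_torClass B ν p q _ _).trans ?_
  rw [← sub_eq_zero, ← map_sub, torClass_eq_zero_iff]
  obtain ⟨w, hw⟩ := tensorMap_chainPair f hf μ ν p q x y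
  refine ⟨-w, ?_⟩
  rw [map_neg, hw, neg_sub]
  rfl

end TorComparison

/-! ### Signs and the weighted Taylor algebra -/

section Signs

variable {ι : Type*} [LinearOrder ι] (R : Type*) [CommRing R]

/-- The sign `(-1)^u`, where `u` is the (1-based) position of `i` in `S`. -/
def posSign (i : ι) (S : Finset ι) : R := ∏ j ∈ S, if j ≤ i then -1 else 1

/-- The sign of the permutation that sorts the concatenation of `S` and `T`. -/
def shuffleSign (S T : Finset ι) : R := ∏ i ∈ S, ∏ j ∈ T, if j < i then -1 else 1

variable {R}

theorem neg_one_pow_card_filter {α : Type*} (S : Finset α) (p : α → Prop) [DecidablePred p] :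
    (-1 : R) ^ (S.filter p).card = ∏ j ∈ S, if p j then -1 else 1 := by
  rw [Finset.prod_ite]; simp

theorem posSign_insert {i j : ι} {S : Finset ι} (h : j ∉ S) :
    posSign R i (insert j S) = (if j ≤ i then -1 else 1) * posSign R i S :=
  Finset.prod_insert h

theorem posSign_union {i : ι} {S T : Finset ι} (h : Disjoint S T) :
    posSign R i (S ∪ T) = posSign R i S * posSign R i T :=
  Finset.prod_union h

theorem posSign_mul_self (i : ι) (S : Finset ι) : posSign R i S * posSign R i S = 1 := by
  rw [posSign, ← Finset.prod_mul_distrib]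
  exact Finset.prod_eq_one fun j _ => by split_ifs <;> simp

theorem shuffleSign_insert_left {i : ι} {S T : Finset ι} (h : i ∉ S) :
    shuffleSign R (insert i S) T = (∏ j ∈ T, if j < i then -1 else 1) * shuffleSign R S T :=
  Finset.prod_insert h

theorem shuffleSign_insert_right {i : ι} {S T : Finset ι} (h : i ∉ T) :
    shuffleSign R S (insert i T) = (∏ j ∈ S, if i < j then -1 else 1) * shuffleSign R S T := by
  simp only [shuffleSign, Finset.prod_insert h, Finset.prod_mul_distrib]

theorem shuffleSign_union_left {S T U : Finset ι} (h : Disjoint S T) :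
    shuffleSign R (S ∪ T) U = shuffleSign R S U * shuffleSign R T U :=
  Finset.prod_union h

theorem shuffleSign_union_right {S T U : Finset ι} (h : Disjoint T U) :
    shuffleSign R S (T ∪ U) = shuffleSign R S T * shuffleSign R S U := by
  simp only [shuffleSign, Finset.prod_union h, Finset.prod_mul_distrib]

theorem prod_lt_sign_eq_posSign {i : ι} {S : Finset ι} (h : i ∉ S) :
    (∏ j ∈ S, if j < i then (-1 : R) else 1) = posSign R i S :=
  Finset.prod_congr rfl fun j hj => by
    have : j ≠ i := fun e => h (e ▸ hj)
    simp [lt_iff_le_and_ne, this]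

theorem prod_gt_sign_eq_posSign (i : ι) (S : Finset ι) :
    (∏ j ∈ S, if i < j then (-1 : R) else 1) = (-1) ^ S.card * posSign R i S := by
  rw [posSign, ← Finset.prod_const, ← Finset.prod_mul_distrib]
  refine Finset.prod_congr rfl fun j hj => ?_
  by_cases h : i < j
  · simp [h]
  · simp [h, not_lt.1 h]

/-- Removing `i` and `j` in the two possible orders gives opposite signs. -/
theorem posSign_erase_mul {i j : ι} {S : Finset ι} (hi : i ∈ S) (hj : j ∈ S) (hij : i ≠ j) :
    posSign R i S * posSign R j (S.erase i) = -(posSign R j S * posSign R i (S.erase j)) := by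
  obtain ⟨U, hiU, hjU, rfl⟩ : ∃ U : Finset ι, i ∉ U ∧ j ∉ U ∧ S = insert i (insert j U) := by
    refine ⟨(S.erase i).erase j, by simp, by simp, ?_⟩
    rw [Finset.insert_erase (Finset.mem_erase.2 ⟨hij.symm, hj⟩), Finset.insert_erase hi]
  have h1 : i ∉ insert j U := by simp [hij, hiU]
  have h2 : (insert i (insert j U)).erase j = insert i U := by
    rw [Finset.insert_comm, Finset.erase_insert (by simp [hij.symm, hjU])]
  rw [h2, Finset.erase_insert h1]
  simp only [posSign_insert h1, posSign_insert hiU, posSign_insert hjU, le_refl, if_true]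
  rcases lt_or_gt_of_ne hij with h | h
  · simp only [h.le, not_le.2 h, if_true, if_false]; ring
  · simp only [h.le, not_le.2 h, if_true, if_false]; ring

end Signs

section WeightedTaylor

variable {ι α R : Type*} [LinearOrder ι] [DecidableEq α] [CommRing R] (t : α → R)
  (P : ι → Finset α)

/-- The differential `e_S ↦ ∑_{i ∈ S} ± t^{σ_S ∖ σ_{S ∖ i}} e_{S ∖ i}`, where `σ_S = ⋃_{i ∈ S} P i`
and `t^A = ∏_{a ∈ A} t_a`. It specializes to the Taylor complex of the monomials `x_{P i}` for `t = x`
and to the algebra of a simplicial complement for `t = 0`. -/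
def taylorD : (Finset ι →₀ R) →ₗ[R] (Finset ι →₀ R) :=
  Finsupp.linearCombination R fun S => ∑ i ∈ S, Finsupp.single (S.erase i)
    (posSign R i S * ∏ a ∈ S.biUnion P \ (S.erase i).biUnion P, t a)

/-- The product with `e_S e_T = ± t^{σ_S ∩ σ_T} e_{S ∪ T}` if `S ∩ T = ∅` and `e_S e_T = 0`
otherwise. -/
def taylorMul : (Finset ι →₀ R) →ₗ[R] (Finset ι →₀ R) →ₗ[R] (Finset ι →₀ R) :=
  Finsupp.linearCombination R fun S => Finsupp.linearCombination R fun T =>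
    if Disjoint S T then Finsupp.single (S ∪ T)
      (shuffleSign R S T * ∏ a ∈ S.biUnion P ∩ T.biUnion P, t a) else 0

theorem taylorD_single (S : Finset ι) (r : R) :
    taylorD t P (Finsupp.single S r) = ∑ i ∈ S, Finsupp.single (S.erase i)
      (r * (posSign R i S * ∏ a ∈ S.biUnion P \ (S.erase i).biUnion P, t a)) := by
  simp only [taylorD, Finsupp.linearCombination_single, Finset.smul_sum, Finsupp.smul_single,
    smul_eq_mul]

theorem taylorMul_single (S T : Finset ι) (r r' : R) :
    taylorMul t P (Finsupp.single S r) (Finsupp.single T r') =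
      if Disjoint S T then Finsupp.single (S ∪ T)
        (r * r' * (shuffleSign R S T * ∏ a ∈ S.biUnion P ∩ T.biUnion P, t a)) else 0 := by
  simp only [taylorMul, Finsupp.linearCombination_single,
    LinearMap.smul_apply]
  split_ifs with h
  · simp only [Finsupp.smul_single, smul_eq_mul, mul_assoc]
  · simp

/-- An identity of products of weights `t^A t^B = t^C t^D` can be checked on the factors of each
point. -/
theorem taylor_weight_mul_eq {A B C D : Finset α}
    (h : ∀ a, ((if a ∈ A then t a else 1) * (if a ∈ B then t a else 1) : R) =
      (if a ∈ C then t a else 1) * (if a ∈ D then t a else 1)) :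
    (∏ a ∈ A, t a) * (∏ a ∈ B, t a) = (∏ a ∈ C, t a) * ∏ a ∈ D, t a := by
  have key : ∀ E ⊆ A ∪ B ∪ C ∪ D, ∏ a ∈ E, t a = ∏ a ∈ A ∪ B ∪ C ∪ D, if a ∈ E then t a else 1 := by
    intro E hE
    rw [Finset.prod_ite_mem, Finset.inter_eq_right.2 hE]
  rw [key A (by grind), key B (by grind), key C (by grind), key D (by grind),
    ← Finset.prod_mul_distrib, ← Finset.prod_mul_distrib]
  exact Finset.prod_congr rfl fun a _ => h a

theorem taylorD_taylorD (x : Finset ι →₀ R) : taylorD t P (taylorD t P x) = 0 := by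
  induction x using Finsupp.induction_linear with
  | zero => simp
  | add x y hx hy => simp [hx, hy]
  | single S r =>
    simp only [taylorD_single, map_sum]
    rw [Finset.sum_sigma']
    refine Finset.sum_involution (fun p _ => ⟨p.2, p.1⟩) ?_ ?_ ?_ ?_
    · rintro ⟨i, j⟩ h
      simp only [Finset.mem_sigma, Finset.mem_erase] at h
      obtain ⟨hi, hji, hj⟩ := h
      dsimp only
      rw [Finset.erase_right_comm, ← Finsupp.single_add, mul_assoc r, mul_assoc r, ← mul_add]
      refine (congrArg _ ?_).trans (Finsupp.single_zero _)
      have hs := posSign_erase_mul (R := R) hi hj hji.symm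
      have hE : (S.erase j).erase i = (S.erase i).erase j := Finset.erase_right_comm
      have hw := taylor_weight_mul_eq t (A := S.biUnion P \ (S.erase i).biUnion P)
        (B := (S.erase i).biUnion P \ ((S.erase i).erase j).biUnion P)
        (C := S.biUnion P \ (S.erase j).biUnion P)
        (D := (S.erase j).biUnion P \ ((S.erase i).erase j).biUnion P) (fun a => by
          have h1 : a ∈ ((S.erase i).erase j).biUnion P → a ∈ (S.erase i).biUnion P :=
            fun h => Finset.biUnion_subset_biUnion_of_subset_left _ (Finset.erase_subset _ _) h
          have h2 : a ∈ ((S.erase i).erase j).biUnion P → a ∈ (S.erase j).biUnion P :=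
            fun h => Finset.biUnion_subset_biUnion_of_subset_left _
              (Finset.erase_subset_erase _ (Finset.erase_subset _ _)) h
          have h3 : a ∈ (S.erase i).biUnion P → a ∈ S.biUnion P :=
            fun h => Finset.biUnion_subset_biUnion_of_subset_left _ (Finset.erase_subset _ _) h
          have h4 : a ∈ (S.erase j).biUnion P → a ∈ S.biUnion P :=
            fun h => Finset.biUnion_subset_biUnion_of_subset_left _ (Finset.erase_subset _ _) h
          simp only [Finset.mem_sdiff]
          by_cases c1 : a ∈ S.biUnion P <;> by_cases c2 : a ∈ (S.erase i).biUnion P <;>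
            by_cases c3 : a ∈ (S.erase j).biUnion P <;>
            by_cases c4 : a ∈ ((S.erase i).erase j).biUnion P <;>
            first
            | exact absurd (h1 c4) c2
            | exact absurd (h2 c4) c3
            | exact absurd (h3 c2) c1
            | exact absurd (h4 c3) c1
            | simp [-Finset.mem_biUnion, c1, c2, c3, c4])
      rw [hE]
      linear_combination r * (∏ a ∈ S.biUnion P \ (S.erase i).biUnion P, t a) *
        (∏ a ∈ (S.erase i).biUnion P \ ((S.erase i).erase j).biUnion P, t a) * hs -
        r * posSign R j S * posSign R i (S.erase j) * hw
    · rintro ⟨i, j⟩ h _ e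
      simp only [Finset.mem_sigma, Finset.mem_erase] at h
      simp only [Sigma.mk.injEq, heq_eq_eq] at e
      exact h.2.1 e.1
    · rintro ⟨i, j⟩ h
      simp only [Finset.mem_sigma, Finset.mem_erase] at h ⊢
      exact ⟨h.2.2, h.2.1.symm, h.1⟩
    · rintro ⟨i, j⟩ h
      rfl

theorem taylor_leibniz_single (S T : Finset ι) :
    taylorD t P (taylorMul t P (Finsupp.single S 1) (Finsupp.single T 1)) =
      taylorMul t P (taylorD t P (Finsupp.single S 1)) (Finsupp.single T 1) +
      (-1 : R) ^ S.card • taylorMul t P (Finsupp.single S 1) (taylorD t P (Finsupp.single T 1)) := by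
  rw [taylorMul_single, taylorD_single, taylorD_single]
  simp only [map_sum, LinearMap.sum_apply, taylorMul_single, one_mul, mul_one, Finset.smul_sum]
  by_cases hST : Disjoint S T
  · rw [if_pos hST, taylorD_single, Finset.sum_union hST]
    congr 1
    · refine Finset.sum_congr rfl fun i hi => ?_
      obtain ⟨U, hiU, rfl⟩ : ∃ U, i ∉ U ∧ S = insert i U :=
        ⟨S.erase i, by simp, (Finset.insert_erase hi).symm⟩
      have hiT : i ∉ T := Finset.disjoint_left.1 hST hi
      have hUT : Disjoint U T := hST.mono_left (Finset.subset_insert _ _)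
      have hiUT : i ∉ U ∪ T := by simp [hiU, hiT]
      rw [Finset.insert_union, Finset.erase_insert hiU, Finset.erase_insert hiUT, if_pos hUT]
      congr 1
      have hw := taylor_weight_mul_eq t (A := (insert i U).biUnion P ∩ T.biUnion P)
        (B := (insert i (U ∪ T)).biUnion P \ (U ∪ T).biUnion P)
        (C := (insert i U).biUnion P \ U.biUnion P)
        (D := U.biUnion P ∩ T.biUnion P) (fun a => by
          simp only [Finset.biUnion_insert, Finset.union_biUnion, Finset.mem_sdiff,
            Finset.mem_inter, Finset.mem_union]
          by_cases c1 : a ∈ P i <;> by_cases c2 : a ∈ U.biUnion P <;>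
            by_cases c3 : a ∈ T.biUnion P <;> simp [-Finset.mem_biUnion, c1, c2, c3])
      rw [shuffleSign_insert_left hiU, prod_lt_sign_eq_posSign hiT, posSign_insert hiU,
        posSign_insert hiUT, posSign_union hUT]
      have hs := posSign_mul_self (R := R) i T
      simp only [le_refl, if_true]
      linear_combination -(shuffleSign R U T * posSign R i U * posSign R i T ^ 2) * hw -
        shuffleSign R U T * posSign R i U * (∏ a ∈ (insert i U).biUnion P \ U.biUnion P, t a) *
        (∏ a ∈ U.biUnion P ∩ T.biUnion P, t a) * hs
    · refine Finset.sum_congr rfl fun i hi => ?_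
      obtain ⟨U, hiU, rfl⟩ : ∃ U, i ∉ U ∧ T = insert i U :=
        ⟨T.erase i, by simp, (Finset.insert_erase hi).symm⟩
      have hiS : i ∉ S := Finset.disjoint_right.1 hST hi
      have hSU : Disjoint S U := hST.mono_right (Finset.subset_insert _ _)
      have hiSU : i ∉ S ∪ U := by simp [hiU, hiS]
      rw [Finset.union_insert, Finset.erase_insert hiU, Finset.erase_insert hiSU, if_pos hSU,
        Finsupp.smul_single]
      congr 1
      have hw := taylor_weight_mul_eq t (A := S.biUnion P ∩ (insert i U).biUnion P)
        (B := (insert i (S ∪ U)).biUnion P \ (S ∪ U).biUnion P)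
        (C := (insert i U).biUnion P \ U.biUnion P)
        (D := S.biUnion P ∩ U.biUnion P) (fun a => by
          simp only [Finset.biUnion_insert, Finset.union_biUnion, Finset.mem_sdiff,
            Finset.mem_inter, Finset.mem_union]
          by_cases c1 : a ∈ P i <;> by_cases c2 : a ∈ U.biUnion P <;>
            by_cases c3 : a ∈ S.biUnion P <;> simp [-Finset.mem_biUnion, c1, c2, c3])
      rw [shuffleSign_insert_right hiU, prod_gt_sign_eq_posSign, posSign_insert hiU,
        posSign_insert hiSU, posSign_union hSU]
      have hs := posSign_mul_self (R := R) i S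
      simp only [smul_eq_mul, le_refl, if_true]
      linear_combination -((-1) ^ S.card * shuffleSign R S U * posSign R i U *
          posSign R i S ^ 2) * hw - (-1) ^ S.card * shuffleSign R S U * posSign R i U *
        (∏ a ∈ (insert i U).biUnion P \ U.biUnion P, t a) *
        (∏ a ∈ S.biUnion P ∩ U.biUnion P, t a) * hs
  · rw [if_neg hST, map_zero]
    obtain ⟨i, hiS, hiT⟩ := Finset.not_disjoint_iff.1 hST
    rw [Finset.sum_eq_single i, Finset.sum_eq_single i]
    · obtain ⟨U, hiU, rfl⟩ : ∃ U, i ∉ U ∧ S = insert i U :=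
        ⟨S.erase i, by simp, (Finset.insert_erase hiS).symm⟩
      obtain ⟨V, hiV, rfl⟩ : ∃ U, i ∉ U ∧ T = insert i U :=
        ⟨T.erase i, by simp, (Finset.insert_erase hiT).symm⟩
      have hU : Disjoint U (insert i V) ↔ Disjoint U V := by simp [hiU]
      have hV : Disjoint (insert i U) V ↔ Disjoint U V := by simp [hiV]
      rw [Finset.erase_insert hiU, Finset.erase_insert hiV]
      by_cases hUV : Disjoint U V
      · rw [if_pos (hU.2 hUV), if_pos (hV.2 hUV), Finset.union_insert, Finset.insert_union,
          Finsupp.smul_single, ← Finsupp.single_add, eq_comm]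
        refine (congrArg _ ?_).trans (Finsupp.single_zero _)
        have hw := taylor_weight_mul_eq t (A := (insert i U).biUnion P \ U.biUnion P)
          (B := U.biUnion P ∩ (insert i V).biUnion P)
          (C := (insert i V).biUnion P \ V.biUnion P)
          (D := (insert i U).biUnion P ∩ V.biUnion P) (fun a => by
            simp only [Finset.biUnion_insert, Finset.mem_sdiff,
              Finset.mem_inter, Finset.mem_union]
            by_cases c1 : a ∈ P i <;> by_cases c2 : a ∈ U.biUnion P <;>
              by_cases c3 : a ∈ V.biUnion P <;> simp [-Finset.mem_biUnion, c1, c2, c3])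
        rw [shuffleSign_insert_left hiU, shuffleSign_insert_right hiV,
          prod_lt_sign_eq_posSign hiV, prod_gt_sign_eq_posSign, posSign_insert hiU,
          posSign_insert hiV, Finset.card_insert_of_notMem hiU]
        have hsU := posSign_mul_self (R := R) i U
        have hsV := posSign_mul_self (R := R) i V
        simp only [smul_eq_mul, le_refl, if_true]
        linear_combination -((-1) ^ U.card * shuffleSign R U V *
            (∏ a ∈ (insert i U).biUnion P \ U.biUnion P, t a) *
            (∏ a ∈ U.biUnion P ∩ (insert i V).biUnion P, t a)) * hsU + (-1) ^ U.card *
            shuffleSign R U V * (∏ a ∈ (insert i V).biUnion P \ V.biUnion P, t a) *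
            (∏ a ∈ (insert i U).biUnion P ∩ V.biUnion P, t a) * hsV -
            (-1) ^ U.card * shuffleSign R U V * hw
      · rw [if_neg (hU.not.2 hUV), if_neg (hV.not.2 hUV), smul_zero, add_zero]
    · intro j hj hji
      rw [if_neg, smul_zero]
      exact Finset.not_disjoint_iff.2 ⟨i, hiS, Finset.mem_erase.2 ⟨hji.symm, hiT⟩⟩
    · exact fun h => absurd hiT h
    · intro j hj hji
      rw [if_neg]
      exact Finset.not_disjoint_iff.2 ⟨i, Finset.mem_erase.2 ⟨hji.symm, hiS⟩, hiT⟩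
    · exact fun h => absurd hiS h

theorem taylorMul_assoc (x y z : Finset ι →₀ R) :
    taylorMul t P (taylorMul t P x y) z = taylorMul t P x (taylorMul t P y z) := by
  induction x using Finsupp.induction_linear with
  | zero => simp
  | add x x' hx hx' => simp [hx, hx']
  | single S r =>
  induction y using Finsupp.induction_linear with
  | zero => simp
  | add y y' hy hy' => simp [hy, hy']
  | single T r' =>
  induction z using Finsupp.induction_linear with
  | zero => simp
  | add z z' hz hz' => simp [hz, hz']
  | single U r'' =>
  rw [taylorMul_single, taylorMul_single]
  by_cases hST : Disjoint S T
  · by_cases hTU : Disjoint T U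
    · rw [if_pos hST, if_pos hTU, taylorMul_single, taylorMul_single]
      by_cases hSU : Disjoint S U
      · rw [if_pos (Finset.disjoint_union_left.2 ⟨hSU, hTU⟩),
          if_pos (Finset.disjoint_union_right.2 ⟨hST, hSU⟩), Finset.union_assoc,
          shuffleSign_union_left hST, shuffleSign_union_right hTU]
        congr 1
        have hw := taylor_weight_mul_eq t (A := S.biUnion P ∩ T.biUnion P)
          (B := (S ∪ T).biUnion P ∩ U.biUnion P) (C := T.biUnion P ∩ U.biUnion P)
          (D := S.biUnion P ∩ (T ∪ U).biUnion P) (fun a => by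
            simp only [Finset.union_biUnion, Finset.mem_inter, Finset.mem_union]
            by_cases c1 : a ∈ S.biUnion P <;> by_cases c2 : a ∈ T.biUnion P <;>
              by_cases c3 : a ∈ U.biUnion P <;> simp [-Finset.mem_biUnion, c1, c2, c3])
        linear_combination r * r' * r'' * shuffleSign R S T * shuffleSign R S U *
          shuffleSign R T U * hw
      · rw [if_neg fun h => hSU (Finset.disjoint_union_left.1 h).1,
          if_neg fun h => hSU (Finset.disjoint_union_right.1 h).2]
    · rw [if_pos hST, if_neg hTU, taylorMul_single, map_zero,
        if_neg fun h => hTU (Finset.disjoint_union_left.1 h).2]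
  · rw [if_neg hST, map_zero, LinearMap.zero_apply]
    split_ifs with hTU
    · rw [taylorMul_single, if_neg fun h => hST (Finset.disjoint_union_right.1 h).1]
    · rw [map_zero]

theorem taylor_one_mul (x : Finset ι →₀ R) : taylorMul t P (Finsupp.single ∅ 1) x = x := by
  induction x using Finsupp.induction_linear with
  | zero => simp
  | add x x' hx hx' => simp [hx, hx']
  | single S r => simp [taylorMul_single, shuffleSign]

theorem taylor_mul_one (x : Finset ι →₀ R) : taylorMul t P x (Finsupp.single ∅ 1) = x := by
  induction x using Finsupp.induction_linear with
  | zero => simp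
  | add x x' hx hx' => simp [hx, hx']
  | single S r => simp [taylorMul_single, shuffleSign]

variable (R ι) in
/-- The part of homological degree `n`: the span of the `e_S` with `|S| = n`. -/
def taylorPiece (n : ℕ) : Submodule R (Finset ι →₀ R) := Finsupp.supported R R {S | S.card = n}

omit [LinearOrder ι] in
theorem single_mem_taylorPiece {S : Finset ι} {n : ℕ} (hS : S.card = n) (r : R) :
    Finsupp.single S r ∈ taylorPiece ι R n :=
  Finsupp.single_mem_supported R r hS

/-- To prove a closed condition on a span of basis vectors, check it on multiples of these. -/
theorem supported_induction {I : Type*} {s : Set I} {C : (I →₀ R) → Prop} (zero : C 0)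
    (add : ∀ x y, C x → C y → C (x + y)) (single : ∀ i ∈ s, ∀ r, C (Finsupp.single i r))
    (x : I →₀ R) (hx : x ∈ Finsupp.supported R R s) : C x := by
  classical
  rw [← Finsupp.sum_single x]
  refine Finset.sum_induction _ C add zero fun i hi => single i (hx hi) _

theorem taylorD_mem (n : ℕ) (x : Finset ι →₀ R) (hx : x ∈ taylorPiece ι R (n + 1)) :
    taylorD t P x ∈ taylorPiece ι R n := by
  refine supported_induction (C := fun x => taylorD t P x ∈ taylorPiece ι R n) (by simp)
    (fun x y hx hy => by rw [map_add]; exact add_mem hx hy) (fun S hS r => ?_) x hx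
  rw [taylorD_single]
  refine sum_mem fun i hi => Finsupp.single_mem_supported R _ ?_
  change (S.erase i).card = n
  rw [Finset.card_erase_of_mem hi, show S.card = n + 1 from hS, Nat.add_sub_cancel]

theorem taylorD_zero (x : Finset ι →₀ R) (hx : x ∈ taylorPiece ι R 0) : taylorD t P x = 0 := by
  refine supported_induction (C := fun x => taylorD t P x = 0) (by simp)
    (fun x y hx hy => by rw [map_add, hx, hy, add_zero]) (fun S hS r => ?_) x hx
  obtain rfl := Finset.card_eq_zero.1 hS
  simp [taylorD_single]

theorem taylorMul_mem (p q : ℕ) (x y : Finset ι →₀ R) (hx : x ∈ taylorPiece ι R p)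
    (hy : y ∈ taylorPiece ι R q) : taylorMul t P x y ∈ taylorPiece ι R (p + q) := by
  refine supported_induction (C := fun x => taylorMul t P x y ∈ taylorPiece ι R (p + q)) (by simp)
    (fun x y hx hy => by rw [map_add]; exact add_mem hx hy) (fun S hS r => ?_) x hx
  refine supported_induction
    (C := fun y => taylorMul t P (Finsupp.single S r) y ∈ taylorPiece ι R (p + q)) (by simp)
    (fun x y hx hy => by rw [map_add]; exact add_mem hx hy) (fun T hT r' => ?_) y hy
  rw [taylorMul_single]
  split_ifs with h
  · refine Finsupp.single_mem_supported R _ ?_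
    change (S ∪ T).card = _
    rw [Finset.card_union_of_disjoint h, show S.card = p from hS, show T.card = q from hT]
  · exact zero_mem _

theorem taylor_leibniz (p : ℕ) (x y : Finset ι →₀ R) (hx : x ∈ taylorPiece ι R p) :
    taylorD t P (taylorMul t P x y) = taylorMul t P (taylorD t P x) y +
      (-1 : R) ^ p • taylorMul t P x (taylorD t P y) := by
  refine supported_induction (C := fun x => taylorD t P (taylorMul t P x y) =
    taylorMul t P (taylorD t P x) y + (-1 : R) ^ p • taylorMul t P x (taylorD t P y)) (by simp)
    (fun x x' hx hx' => by
      simp only [map_add, LinearMap.add_apply, hx, hx', smul_add]; abel) (fun S hS r => ?_) x hx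
  obtain rfl : S.card = p := hS
  induction y using Finsupp.induction_linear with
  | zero => simp
  | add y y' hy hy' => simp only [map_add, hy, hy', smul_add]; abel
  | single T r' =>
    have h := taylor_leibniz_single t P S T
    have hr : Finsupp.single S r = r • Finsupp.single S (1 : R) := by simp
    have hr' : Finsupp.single T r' = r' • Finsupp.single T (1 : R) := by simp
    rw [hr, hr']
    simp only [map_smul, LinearMap.smul_apply, h, smul_add, smul_smul]
    congr 2
    ring_nf

end WeightedTaylor

section Specialization

variable (k : Type u) [Field k] {m s : ℕ} (P : Fin s → Finset (Fin m))

/-- For `t = 0` the coefficient `t^{σ_S ∖ σ_{S ∖ i}}` is `1` if omitting `i` does not change the union,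
and `0` otherwise. -/
theorem barD_eq_taylorD : barD k P = taylorD (fun _ => (0 : k)) P := by
  refine Finsupp.lhom_ext fun S r => ?_
  rw [taylorD_single, barD, Finsupp.linearCombination_single, Finset.sum_filter, Finset.smul_sum]
  refine Finset.sum_congr rfl fun i hi => ?_
  split_ifs with h
  · rw [h, Finset.sdiff_self, Finset.prod_empty, mul_one, Finsupp.smul_single, smul_eq_mul,
      neg_one_pow_card_filter]
    rfl
  · have : (S.biUnion P \ (S.erase i).biUnion P).Nonempty := by
      rw [Finset.sdiff_nonempty]
      exact fun h' => h (Finset.Subset.antisymm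
        (Finset.biUnion_subset_biUnion_of_subset_left _ (Finset.erase_subset _ _)) h')
    obtain ⟨a, ha⟩ := this
    rw [Finset.prod_eq_zero ha rfl]
    simp

/-- For `t = 0` the coefficient `t^{σ_S ∩ σ_T}` is `1` if the two unions are disjoint, and `0`
otherwise. -/
theorem barMul_eq_taylorMul : barMul k P = taylorMul (fun _ => (0 : k)) P := by
  refine Finsupp.lhom_ext fun S r => Finsupp.lhom_ext fun T r' => ?_
  rw [taylorMul_single, barMul, Finsupp.linearCombination_single, LinearMap.smul_apply,
    Finsupp.linearCombination_single]
  by_cases hST : Disjoint S T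
  · by_cases h : ∀ i ∈ S, ∀ j ∈ T, Disjoint (P i) (P j)
    · have h' : S.biUnion P ∩ T.biUnion P = ∅ := by
        rw [← Finset.disjoint_iff_inter_eq_empty, Finset.disjoint_biUnion_left]
        exact fun i hi => (Finset.disjoint_biUnion_right _ _ _).2 fun j hj => h i hi j hj
      rw [if_pos ⟨hST, h⟩, if_pos hST, h', neg_one_pow_card_filter, Finset.prod_product]
      simp only [Finsupp.smul_single, smul_eq_mul, Finset.prod_empty, mul_one, mul_assoc]
      rfl
    · have h' : (S.biUnion P ∩ T.biUnion P).Nonempty := by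
        push Not at h
        obtain ⟨i, hi, j, hj, hij⟩ := h
        obtain ⟨a, hai, haj⟩ := Finset.not_disjoint_iff.1 hij
        exact ⟨a, Finset.mem_inter.2
          ⟨Finset.mem_biUnion.2 ⟨i, hi, hai⟩, Finset.mem_biUnion.2 ⟨j, hj, haj⟩⟩⟩
      obtain ⟨a, ha⟩ := h'
      rw [if_neg fun h' => h h'.2, if_pos hST, Finset.prod_eq_zero ha rfl]
      simp
  · rw [if_neg fun h => hST h.1, if_neg hST, smul_zero, smul_zero]

theorem barIsDGA : BarIsDGA k P where
  one_mul x := by rw [barMul_eq_taylorMul]; exact taylor_one_mul _ P x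
  mul_one x := by rw [barMul_eq_taylorMul]; exact taylor_mul_one _ P x
  mul_assoc x y z := by rw [barMul_eq_taylorMul]; exact taylorMul_assoc _ P x y z
  mul_mem p q x y hx hy := by rw [barMul_eq_taylorMul]; exact taylorMul_mem _ P p q x y hx hy
  d_mem n x hx := by rw [barD_eq_taylorD]; exact taylorD_mem _ P n x hx
  d_d x := by rw [barD_eq_taylorD]; exact taylorD_taylorD _ P x
  leibniz p x y hx := by
    rw [barD_eq_taylorD, barMul_eq_taylorMul]; exact taylor_leibniz _ P p x y hx

end Specialization

/-! ### Exactness of the Taylor complex -/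

section TaylorExactness

variable {k : Type u} [Field k] {m s : ℕ}

theorem indicatorVector_apply (A : Finset (Fin m)) (c : Fin m) :
    indicatorVector A c = if c ∈ A then 1 else 0 := by
  simp [indicatorVector, Finsupp.finsetSum_apply, Finsupp.single_apply]

theorem prod_X_eq_monomial (A : Finset (Fin m)) :
    ∏ a ∈ A, (MvPolynomial.X a : MvPolynomial (Fin m) k) =
      MvPolynomial.monomial (indicatorVector A) 1 := by
  rw [indicatorVector, MvPolynomial.monomial_sum_one]
  rfl

variable (k) (P : Fin s → Finset (Fin m))

/-- The value at `x^b e_S` of the contracting homotopy of the Taylor complex: insert the index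
`v(U)`, where `U` is the support of the multidegree `x^b x_{σ_S}`, keeping the multidegree. -/
def homotopyValue (v : Finset (Fin m) → Fin s) (S : Finset (Fin s)) (b : Fin m →₀ ℕ) :
    Finset (Fin s) →₀ MvPolynomial (Fin m) k :=
  if v (S.biUnion P ∪ b.support) ∈ S then 0 else
    posSign k (v (S.biUnion P ∪ b.support)) (insert (v (S.biUnion P ∪ b.support)) S) •
      Finsupp.single (insert (v (S.biUnion P ∪ b.support)) S)
        (MvPolynomial.monomial
          (b - indicatorVector (P (v (S.biUnion P ∪ b.support)) \ S.biUnion P)) 1)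

/-- The `k`-linear contracting homotopy of the Taylor complex. -/
def taylorHomotopy (v : Finset (Fin m) → Fin s) :
    (Finset (Fin s) →₀ MvPolynomial (Fin m) k) →ₗ[k] (Finset (Fin s) →₀ MvPolynomial (Fin m) k) :=
  Finsupp.lsum k fun S => (MvPolynomial.basisMonomials (Fin m) k).constr k (homotopyValue k P v S)

variable {k P}

theorem taylorHomotopy_single (v : Finset (Fin m) → Fin s) (S : Finset (Fin s)) (b : Fin m →₀ ℕ) :
    taylorHomotopy k P v (Finsupp.single S (MvPolynomial.monomial b 1)) =
      homotopyValue k P v S b := by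
  rw [taylorHomotopy, Finsupp.lsum_single]
  have := (MvPolynomial.basisMonomials (Fin m) k).constr_basis k (homotopyValue k P v S) b
  rwa [MvPolynomial.coe_basisMonomials] at this

theorem homotopyValue_mem (v : Finset (Fin m) → Fin s) (S : Finset (Fin s)) (b : Fin m →₀ ℕ) :
    homotopyValue k P v S b ∈ taylorPiece (Fin s) (MvPolynomial (Fin m) k) (S.card + 1) := by
  unfold homotopyValue
  split_ifs with h
  · exact zero_mem _
  · rw [← Finset.card_insert_of_notMem h]
    rw [← algebraMap_smul (MvPolynomial (Fin m) k)]
    exact Submodule.smul_mem _ _ (single_mem_taylorPiece rfl _)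

theorem posSign_map {R : Type*} [CommRing R] [Algebra k R] {ι : Type*} [LinearOrder ι] (i : ι)
    (S : Finset ι) : algebraMap k R (posSign k i S) = posSign R i S := by
  simp only [posSign, map_prod]
  exact Finset.prod_congr rfl fun j _ => by split_ifs <;> simp

theorem taylorD_single_monomial (S : Finset (Fin s)) (b : Fin m →₀ ℕ) :
    taylorD MvPolynomial.X P (Finsupp.single S (MvPolynomial.monomial b (1 : k))) =
      ∑ j ∈ S, posSign k j S • Finsupp.single (S.erase j) (MvPolynomial.monomial
        (b + indicatorVector (S.biUnion P \ (S.erase j).biUnion P)) (1 : k)) := by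
  rw [taylorD_single]
  refine Finset.sum_congr rfl fun j _ => ?_
  rw [prod_X_eq_monomial, Finsupp.smul_single, ← posSign_map (k := k), Algebra.smul_def,
    mul_left_comm, MvPolynomial.monomial_mul, one_mul]

/-- The multidegree of a term of `d(x^b e_S)` has the same support as that of `x^b e_S`. -/
theorem support_erase (S : Finset (Fin s)) (j : Fin s) (b : Fin m →₀ ℕ) :
    (S.erase j).biUnion P ∪
      (b + indicatorVector (S.biUnion P \ (S.erase j).biUnion P)).support =
      S.biUnion P ∪ b.support := by
  have h : (S.erase j).biUnion P ⊆ S.biUnion P :=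
    Finset.biUnion_subset_biUnion_of_subset_left _ (Finset.erase_subset _ _)
  ext c
  have := @h c
  simp only [Finset.mem_union, Finsupp.mem_support_iff, Finsupp.add_apply, indicatorVector_apply,
    Finset.mem_sdiff]
  by_cases c1 : c ∈ S.biUnion P <;> by_cases c2 : c ∈ (S.erase j).biUnion P
  · simp [-Finset.mem_biUnion, c1, c2]
  · simp [-Finset.mem_biUnion, c1, c2]
  · exact absurd (this c2) c1
  · simp [-Finset.mem_biUnion, c1, c2]

/-- The homotopy contracts the Taylor complex because the inserted index depends only on the support of
the multidegree, which the differential preserves. -/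
theorem taylorHomotopy_contracts_single (v : Finset (Fin m) → Fin s)
    (hv : ∀ U, (∃ i, P i ⊆ U) → P (v U) ⊆ U) (S : Finset (Fin s)) (hS : S.Nonempty)
    (b : Fin m →₀ ℕ) :
    taylorD MvPolynomial.X P (taylorHomotopy k P v
        (Finsupp.single S (MvPolynomial.monomial b (1 : k)))) +
      taylorHomotopy k P v (taylorD MvPolynomial.X P
        (Finsupp.single S (MvPolynomial.monomial b (1 : k)))) =
      Finsupp.single S (MvPolynomial.monomial b (1 : k)) := by
  obtain ⟨j₀, hj₀⟩ := hS
  have hvU := hv (S.biUnion P ∪ b.support)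
    ⟨j₀, (Finset.subset_biUnion_of_mem P hj₀).trans Finset.subset_union_left⟩
  rw [taylorD_single_monomial, map_sum, taylorHomotopy_single]
  simp only [map_smul, taylorHomotopy_single]
  have hval : ∀ j, homotopyValue k P v (S.erase j)
      (b + indicatorVector (S.biUnion P \ (S.erase j).biUnion P)) =
      if v (S.biUnion P ∪ b.support) ∈ S.erase j then 0 else
      posSign k (v (S.biUnion P ∪ b.support)) (insert (v (S.biUnion P ∪ b.support)) (S.erase j)) •
      Finsupp.single (insert (v (S.biUnion P ∪ b.support)) (S.erase j))
        (MvPolynomial.monomial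
          (b + indicatorVector (S.biUnion P \ (S.erase j).biUnion P) -
            indicatorVector (P (v (S.biUnion P ∪ b.support)) \ (S.erase j).biUnion P)) 1) := by
    intro j
    rw [homotopyValue, support_erase]
  simp only [hval]
  rw [homotopyValue]
  generalize v (S.biUnion P ∪ b.support) = i at hvU
  by_cases hi : i ∈ S
  · rw [if_pos hi, map_zero, zero_add, Finset.sum_eq_single i]
    · obtain ⟨U, hiU, rfl⟩ : ∃ U, i ∉ U ∧ S = insert i U :=
        ⟨S.erase i, by simp, (Finset.insert_erase hi).symm⟩
      rw [Finset.erase_insert hiU, if_neg hiU, smul_smul, posSign_mul_self, one_smul]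
      congr 2
      have : (insert i U).biUnion P \ U.biUnion P = P i \ U.biUnion P := by
        rw [Finset.biUnion_insert, Finset.union_sdiff_right]
      rw [this, add_tsub_cancel_right]
    · intro j hj hji
      rw [if_pos (Finset.mem_erase.2 ⟨hji.symm, hi⟩), smul_zero]
    · exact fun h => absurd hi h
  · rw [if_neg hi]
    have hD : taylorD MvPolynomial.X P (posSign k i (insert i S) • Finsupp.single (insert i S)
        (MvPolynomial.monomial (b - indicatorVector (P i \ S.biUnion P)) (1 : k))) =
        posSign k i (insert i S) • taylorD MvPolynomial.X P (Finsupp.single (insert i S)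
        (MvPolynomial.monomial (b - indicatorVector (P i \ S.biUnion P)) (1 : k))) :=
      ((taylorD MvPolynomial.X P).restrictScalars k).map_smul _ _
    rw [hD, taylorD_single_monomial, Finset.sum_insert hi, smul_add, smul_smul, posSign_mul_self,
      one_smul, Finset.erase_insert hi, add_assoc]
    -- the truncated subtraction of exponents in the homotopy is exact
    have hb : ∀ c ∈ P i, c ∉ S.biUnion P → b c ≠ 0 := by
      intro c hc hcS
      have := hvU hc
      rw [Finset.mem_union] at this
      exact Finsupp.mem_support_iff.1 (this.resolve_left hcS)
    have h1 : b - indicatorVector (P i \ S.biUnion P) +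
        indicatorVector ((insert i S).biUnion P \ S.biUnion P) = b := by
      ext c
      have := hb c
      simp only [Finsupp.add_apply, Finsupp.tsub_apply, indicatorVector_apply,
        Finset.biUnion_insert, Finset.mem_sdiff, Finset.mem_union]
      by_cases c1 : c ∈ S.biUnion P <;> by_cases c2 : c ∈ P i <;>
        simp only [c1, c2, and_true, not_true, not_false_iff, or_true, or_false, or_self, and_false,
          and_self, if_true, if_false] <;> grind
    rw [h1, Finset.smul_sum, ← Finset.sum_add_distrib, add_eq_left]
    refine Finset.sum_eq_zero fun j hj => ?_
    have hij : i ≠ j := fun e => hi (e ▸ hj)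
    rw [if_neg fun h => hi (Finset.mem_of_mem_erase h), Finset.erase_insert_of_ne hij, smul_smul,
      smul_smul]
    have h2 : b - indicatorVector (P i \ S.biUnion P) + indicatorVector ((insert i S).biUnion P \
        (insert i (S.erase j)).biUnion P) = b + indicatorVector (S.biUnion P \
        (S.erase j).biUnion P) - indicatorVector (P i \ (S.erase j).biUnion P) := by
      have hsub : (S.erase j).biUnion P ⊆ S.biUnion P :=
        Finset.biUnion_subset_biUnion_of_subset_left _ (Finset.erase_subset _ _)
      ext c
      have := hb c
      have := @hsub c
      simp only [Finsupp.add_apply, Finsupp.tsub_apply, indicatorVector_apply,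
        Finset.biUnion_insert, Finset.mem_sdiff, Finset.mem_union]
      by_cases c1 : c ∈ S.biUnion P <;> by_cases c2 : c ∈ P i <;>
        by_cases c3 : c ∈ (S.erase j).biUnion P <;>
        simp only [c1, c2, c3, and_true, not_true, not_false_iff, or_true, or_false, or_self,
          and_false, and_self, if_true, if_false] <;> grind
    rw [h2, ← add_smul]
    have h3 := posSign_erase_mul (R := k) (Finset.mem_insert_self i S)
      (Finset.mem_insert_of_mem hj) hij
    rw [Finset.erase_insert hi, Finset.erase_insert_of_ne hij] at h3
    -- the terms of `dh` and `hd` that remove `j ≠ i` cancel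
    have hsgn : posSign k i (insert i S) * posSign k j (insert i S) +
        posSign k j S * posSign k i (insert i (S.erase j)) = 0 := by
      have q1 := posSign_mul_self (R := k) j S
      have q2 := posSign_mul_self (R := k) j (insert i S)
      linear_combination posSign k j S * posSign k j (insert i S) * h3
        - posSign k i (insert i S) * posSign k j (insert i S) * q1
        - posSign k j S * posSign k i (insert i (S.erase j)) * q2
    rw [hsgn, zero_smul]

theorem taylorHomotopy_contracts (v : Finset (Fin m) → Fin s)
    (hv : ∀ U, (∃ i, P i ⊆ U) → P (v U) ⊆ U) (n : ℕ)
    (x : Finset (Fin s) →₀ MvPolynomial (Fin m) k)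
    (hx : x ∈ taylorPiece (Fin s) (MvPolynomial (Fin m) k) (n + 1)) :
    taylorD MvPolynomial.X P (taylorHomotopy k P v x) +
      taylorHomotopy k P v (taylorD MvPolynomial.X P x) = x ∧
    taylorHomotopy k P v x ∈ taylorPiece (Fin s) (MvPolynomial (Fin m) k) (n + 2) := by
  refine supported_induction (C := fun x => taylorD MvPolynomial.X P (taylorHomotopy k P v x) +
      taylorHomotopy k P v (taylorD MvPolynomial.X P x) = x ∧
    taylorHomotopy k P v x ∈ taylorPiece (Fin s) (MvPolynomial (Fin m) k) (n + 2)) ?_ ?_ ?_ x hx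
  · simp
  · rintro x y ⟨hx, hx'⟩ ⟨hy, hy'⟩
    refine ⟨?_, by rw [map_add]; exact add_mem hx' hy'⟩
    nth_rewrite 3 [← hx, ← hy]
    simp only [map_add]
    abel
  · intro S hS r
    have hS' : S.card = n + 1 := hS
    induction r using MvPolynomial.induction_on' with
    | monomial b c =>
      have hc : Finsupp.single S (MvPolynomial.monomial b c) =
          c • Finsupp.single S (MvPolynomial.monomial b (1 : k)) := by
        rw [Finsupp.smul_single, MvPolynomial.smul_monomial, smul_eq_mul, mul_one]
      have hD : ∀ y, taylorD MvPolynomial.X P (c • y) = c • taylorD MvPolynomial.X P y :=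
        fun y => ((taylorD (R := MvPolynomial (Fin m) k) MvPolynomial.X P).restrictScalars k).map_smul c y
      constructor
      · rw [hc, map_smul, hD, hD, map_smul, ← smul_add,
          taylorHomotopy_contracts_single v hv S (Finset.card_pos.1 (by omega)) b]
      · rw [hc, map_smul, taylorHomotopy_single, ← algebraMap_smul (MvPolynomial (Fin m) k)]
        have := homotopyValue_mem (k := k) (P := P) v S b
        rw [hS'] at this
        exact Submodule.smul_mem _ _ this
    | add p q hp hq =>
      refine ⟨?_, by rw [Finsupp.single_add, map_add]; exact add_mem hp.2 hq.2⟩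
      rw [Finsupp.single_add]
      nth_rewrite 3 [← hp.1, ← hq.1]
      simp only [map_add]
      abel

/-- The Taylor complex is exact in positive degrees. -/
theorem taylor_exact_succ (n : ℕ) (x : Finset (Fin s) →₀ MvPolynomial (Fin m) k)
    (hx : x ∈ taylorPiece (Fin s) (MvPolynomial (Fin m) k) (n + 1))
    (hd : taylorD MvPolynomial.X P x = 0) :
    ∃ y ∈ taylorPiece (Fin s) (MvPolynomial (Fin m) k) (n + 2), taylorD MvPolynomial.X P y = x := by
  rcases isEmpty_or_nonempty (Fin s) with hs | hs
  · refine ⟨0, zero_mem _, ?_⟩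
    rw [map_zero]
    refine supported_induction (C := fun x => 0 = x) rfl (fun x y hx hy => by rw [← hx, ← hy, add_zero])
      (fun S hS r => ?_) x hx
    have hS' : S.card = n + 1 := hS
    rw [Finset.eq_empty_of_isEmpty S] at hS'
    simp at hS'
  · have : ∀ U : Finset (Fin m), ∃ i : Fin s, (∃ i, P i ⊆ U) → P i ⊆ U := by
      intro U
      by_cases h : ∃ i, P i ⊆ U
      · exact ⟨h.choose, fun _ => h.choose_spec⟩
      · exact ⟨Classical.arbitrary _, fun h' => absurd h' h⟩
    choose v hv using this
    obtain ⟨h1, h2⟩ := taylorHomotopy_contracts v hv n x hx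
    refine ⟨_, h2, ?_⟩
    rw [hd, map_zero, add_zero] at h1
    exact h1

/-- The image of the Taylor differential in degree `0` is the ideal of the monomials `x_{P i}`. -/
theorem taylor_exact_zero (x : Finset (Fin s) →₀ MvPolynomial (Fin m) k)
    (hx : x ∈ taylorPiece (Fin s) (MvPolynomial (Fin m) k) 0)
    (hI : x ∅ ∈ generatedIdeal k P) :
    ∃ y ∈ taylorPiece (Fin s) (MvPolynomial (Fin m) k) 1, taylorD MvPolynomial.X P y = x := by
  obtain ⟨c, hc⟩ := (Ideal.mem_span_range_iff_exists_fun).1 hI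
  refine ⟨∑ i, Finsupp.single {i} (-c i), sum_mem fun i _ => single_mem_taylorPiece (Finset.card_singleton i) _, ?_⟩
  have hx0 : x = Finsupp.single ∅ (x ∅) := by
    refine supported_induction (C := fun x => x = Finsupp.single ∅ (x ∅)) (by simp)
      (fun x y hx hy => ?_) (fun S hS r => ?_) x hx
    · rw [Finsupp.add_apply, Finsupp.single_add, ← hx, ← hy]
    · obtain rfl := Finset.card_eq_zero.1 hS
      simp
  rw [map_sum, hx0, ← hc, Finsupp.single_finsetSum]
  refine Finset.sum_congr rfl fun i _ => ?_
  rw [taylorD_single, Finset.sum_singleton]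
  simp [posSign, sqfreeMonomial]

theorem taylorD_apply_empty_mem (x : Finset (Fin s) →₀ MvPolynomial (Fin m) k)
    (hx : x ∈ taylorPiece (Fin s) (MvPolynomial (Fin m) k) 1) :
    taylorD MvPolynomial.X P x ∅ ∈ generatedIdeal k P := by
  refine supported_induction (C := fun x => taylorD MvPolynomial.X P x ∅ ∈ generatedIdeal k P)
    (by simp) (fun x y hx hy => by rw [map_add]; exact add_mem hx hy) (fun S hS r => ?_) x hx
  obtain ⟨i, rfl⟩ := Finset.card_eq_one.1 hS
  rw [taylorD_single, Finset.sum_singleton]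
  simp only [Finset.erase_singleton, Finsupp.single_eq_same, Finset.singleton_biUnion,
    Finset.biUnion_empty, Finset.sdiff_empty]
  exact Ideal.mul_mem_left _ _ (Ideal.mul_mem_left _ _ (Ideal.subset_span ⟨i, rfl⟩))

end TaylorExactness

/-! ### The Taylor resolution and its multiplication -/

section TaylorResolution

variable (k : Type u) [Field k] {m s : ℕ} (P : Fin s → Finset (Fin m))

/-- The Taylor complex of the monomials `x_{P i}`. -/
def taylorComplex : ChainComplex (ModuleCat.{u} (MvPolynomial (Fin m) k)) ℕ :=
  ChainComplex.of
    (fun n => ModuleCat.of (MvPolynomial (Fin m) k)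
      (taylorPiece (Fin s) (MvPolynomial (Fin m) k) n))
    (fun n => ModuleCat.ofHom ((taylorD MvPolynomial.X P).restrict (taylorD_mem MvPolynomial.X P n)))
    (fun n => by
      refine ModuleCat.hom_ext (LinearMap.ext fun x => ?_)
      exact Subtype.ext (taylorD_taylorD MvPolynomial.X P x.1))

/-- The underlying vector of an element of the Taylor complex. -/
def taylorVal (n : ℕ) : (taylorComplex k P).X n →ₗ[MvPolynomial (Fin m) k]
    (Finset (Fin s) →₀ MvPolynomial (Fin m) k) :=
  (taylorPiece (Fin s) (MvPolynomial (Fin m) k) n).subtype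

/-- An element of the Taylor complex, given by its underlying vector. -/
def taylorMk (n : ℕ) (x : Finset (Fin s) →₀ MvPolynomial (Fin m) k)
    (hx : x ∈ taylorPiece (Fin s) (MvPolynomial (Fin m) k) n) : (taylorComplex k P).X n :=
  (⟨x, hx⟩ : taylorPiece (Fin s) (MvPolynomial (Fin m) k) n)

variable {k P}

theorem taylorVal_mem {n : ℕ} (x : (taylorComplex k P).X n) :
    taylorVal k P n x ∈ taylorPiece (Fin s) (MvPolynomial (Fin m) k) n :=
  Subtype.property (p := fun x => x ∈ taylorPiece (Fin s) (MvPolynomial (Fin m) k) n) x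

theorem taylorVal_mk {n : ℕ} (x : Finset (Fin s) →₀ MvPolynomial (Fin m) k)
    (hx : x ∈ taylorPiece (Fin s) (MvPolynomial (Fin m) k) n) :
    taylorVal k P n (taylorMk k P n x hx) = x := rfl

theorem taylorVal_injective (n : ℕ) : Function.Injective (taylorVal k P n) :=
  Subtype.val_injective

theorem taylorVal_d_succ (n : ℕ) (x : (taylorComplex k P).X (n + 1)) :
    taylorVal k P n (((taylorComplex k P).d (n + 1) n).hom x) =
      taylorD MvPolynomial.X P (taylorVal k P (n + 1) x) := by
  have : (taylorComplex k P).d (n + 1) n = ModuleCat.ofHom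
      ((taylorD MvPolynomial.X P).restrict (taylorD_mem MvPolynomial.X P n)) :=
    ChainComplex.of_d
      (fun n => ModuleCat.of (MvPolynomial (Fin m) k)
        (taylorPiece (Fin s) (MvPolynomial (Fin m) k) n))
      (fun n => ModuleCat.ofHom
        ((taylorD MvPolynomial.X P).restrict (taylorD_mem MvPolynomial.X P n))) n
  rw [this]
  rfl

theorem taylorVal_d (n : ℕ) (x : (taylorComplex k P).X n) :
    taylorVal k P (n - 1) (((taylorComplex k P).d n (n - 1)).hom x) =
      taylorD MvPolynomial.X P (taylorVal k P n x) := by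
  cases n with
  | zero =>
    rw [HomologicalComplex.shape _ _ _ (by simp), taylorD_zero _ _ _ (taylorVal_mem x)]
    exact map_zero _
  | succ n => exact taylorVal_d_succ n x

instance taylorComplex_projective (n : ℕ) : Projective ((taylorComplex k P).X n) := by
  have : Module.Free (MvPolynomial (Fin m) k) (taylorPiece (Fin s) (MvPolynomial (Fin m) k) n) :=
    Module.Free.of_equiv (Finsupp.supportedEquivFinsupp {S : Finset (Fin s) | S.card = n}).symm
  exact (IsProjective.iff_projective (R := MvPolynomial (Fin m) k)
    (taylorPiece (Fin s) (MvPolynomial (Fin m) k) n)).1 inferInstance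

/-- An induction principle: additive properties may be checked on the elements `r e_S`. -/
theorem taylorComplex_induction {n : ℕ} {C : (taylorComplex k P).X n → Prop} (zero : C 0)
    (add : ∀ x y, C x → C y → C (x + y))
    (single : ∀ (S : Finset (Fin s)) (hS : S.card = n) (r : MvPolynomial (Fin m) k),
      C (taylorMk k P n (Finsupp.single S r) (single_mem_taylorPiece hS r)))
    (x : (taylorComplex k P).X n) : C x := by
  have key : ∀ y ∈ taylorPiece (Fin s) (MvPolynomial (Fin m) k) n,
      ∃ h : y ∈ taylorPiece (Fin s) (MvPolynomial (Fin m) k) n, C (taylorMk k P n y h) := by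
    refine supported_induction ⟨zero_mem _, zero⟩ ?_ ?_
    · rintro x y ⟨hx, hx'⟩ ⟨hy, hy'⟩
      exact ⟨add_mem hx hy, add _ _ hx' hy'⟩
    · exact fun S hS r => ⟨_, single S hS r⟩
  exact (key _ (taylorVal_mem x)).2

variable {K : LowerSet (Finset (Fin m))} (hP : IsSimplicialComplement k P K)

variable (k P K) in
/-- The augmentation of the Taylor complex, sending `r e_∅` to the class of `r`. -/
def taylorAug : (taylorComplex k P).X 0 ⟶
    ModuleCat.of (MvPolynomial (Fin m) k) (FaceRing k K) :=
  ModuleCat.ofHom ((stanleyReisnerIdeal k K).mkQ ∘ₗ Finsupp.lapply ∅ ∘ₗ taylorVal k P 0)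

theorem taylorAug_apply (x : (taylorComplex k P).X 0) :
    (taylorAug k P K).hom x = Ideal.Quotient.mk _ (taylorVal k P 0 x ∅) := rfl

include hP in
theorem d_comp_taylorAug : (taylorComplex k P).d 1 0 ≫ taylorAug k P K = 0 := by
  ext x
  change (taylorAug k P K).hom (((taylorComplex k P).d 1 0).hom x) = 0
  rw [taylorAug_apply, taylorVal_d_succ 0 x, Ideal.Quotient.eq_zero_iff_mem, ← hP.ideal_eq]
  exact taylorD_apply_empty_mem _ (taylorVal_mem x)

theorem taylorComplex_exactAt_succ (n : ℕ) : (taylorComplex k P).ExactAt (n + 1) := by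
  rw [HomologicalComplex.exactAt_iff' _ (n + 1 + 1) (n + 1) n (by simp) (by simp),
    ShortComplex.ShortExact.moduleCat_exact_iff_function_exact]
  intro x
  constructor
  · intro hx
    have h1 : ((taylorComplex k P).d (n + 1) n).hom x = 0 := hx
    have h2 := taylorVal_d_succ (P := P) n x
    rw [h1, map_zero] at h2
    obtain ⟨y, hy, hyx⟩ := taylor_exact_succ n _ (taylorVal_mem x) h2.symm
    refine ⟨taylorMk k P (n + 2) y hy, taylorVal_injective (P := P) (n + 1) ?_⟩
    refine (taylorVal_d_succ (n + 1) (taylorMk k P (n + 2) y hy)).trans ?_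
    rw [taylorVal_mk, hyx]
  · rintro ⟨y, rfl⟩
    exact congrArg (fun f => f.hom y) ((taylorComplex k P).d_comp_d (n + 2) (n + 1) n)

include hP in
theorem taylorAug_exact :
    (ShortComplex.mk _ _ (d_comp_taylorAug hP)).Exact := by
  rw [ShortComplex.ShortExact.moduleCat_exact_iff_function_exact]
  intro x
  constructor
  · intro hx
    have h1 : (taylorAug k P K).hom x = 0 := hx
    rw [taylorAug_apply, Ideal.Quotient.eq_zero_iff_mem, ← hP.ideal_eq] at h1
    obtain ⟨y, hy, hyx⟩ := taylor_exact_zero _ (taylorVal_mem x) h1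
    refine ⟨taylorMk k P 1 y hy, taylorVal_injective (P := P) 0 ?_⟩
    refine (taylorVal_d_succ 0 (taylorMk k P 1 y hy)).trans ?_
    rw [taylorVal_mk, hyx]
  · rintro ⟨y, rfl⟩
    exact congrArg (fun f => f.hom y) (d_comp_taylorAug hP)

theorem taylorAug_epi : Epi (taylorAug k P K) := by
  rw [ModuleCat.epi_iff_surjective]
  intro y
  obtain ⟨r, rfl⟩ := Ideal.Quotient.mk_surjective y
  refine ⟨taylorMk k P 0 (Finsupp.single ∅ r) (single_mem_taylorPiece rfl r), ?_⟩
  refine (taylorAug_apply _).trans ?_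
  exact congrArg (Ideal.Quotient.mk _) Finsupp.single_eq_same

/-- The Taylor resolution of the face ring. -/
def taylorResolution : Resolution (MvPolynomial (Fin m) k) (FaceRing k K) where
  complex := taylorComplex k P
  π := (ChainComplex.toSingle₀Equiv _ _).symm ⟨taylorAug k P K, d_comp_taylorAug hP⟩
  quasiIso := ⟨fun n => by
    cases n
    · rw [ChainComplex.quasiIsoAt₀_iff, ShortComplex.quasiIso_iff_of_zeros']
      · refine (ShortComplex.exact_and_epi_g_iff_of_iso ?_).2
          ⟨taylorAug_exact hP, taylorAug_epi⟩
        exact ShortComplex.isoMk (Iso.refl _) (Iso.refl _) (Iso.refl _)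
          ((Category.id_comp _).trans (Category.comp_id _).symm)
          ((Category.id_comp _).trans (Category.comp_id _).symm)
      all_goals rfl
    · rw [quasiIsoAt_iff_exactAt']
      · apply taylorComplex_exactAt_succ
      · apply ChainComplex.exactAt_succ_single_obj⟩

theorem augmentation_taylorResolution :
    augmentation (taylorResolution hP) = taylorAug k P K := by
  change ((ChainComplex.toSingle₀Equiv _ _)
    ((ChainComplex.toSingle₀Equiv _ _).symm ⟨taylorAug k P K, d_comp_taylorAug hP⟩)).1 = _
  rw [Equiv.apply_symm_apply]

variable (k P) in
/-- The components of the product of the Taylor complex, as bilinear maps. -/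
def taylorMulLin (p q n : ℕ) (h : p + q = n) :
    (taylorComplex k P).X p →ₗ[MvPolynomial (Fin m) k] (taylorComplex k P).X q
      →ₗ[MvPolynomial (Fin m) k] (taylorComplex k P).X n :=
  LinearMap.mk₂ (MvPolynomial (Fin m) k)
    (fun x y => taylorMk k P n (taylorMul MvPolynomial.X P (taylorVal k P p x) (taylorVal k P q y))
      (h ▸ taylorMul_mem _ P p q _ _ (taylorVal_mem x) (taylorVal_mem y)))
    (fun _ _ _ => taylorVal_injective n (by simp [taylorVal_mk]))
    (fun _ _ _ => taylorVal_injective n (by simp [taylorVal_mk]))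
    (fun _ _ _ => taylorVal_injective n (by simp [taylorVal_mk]))
    (fun _ _ _ => taylorVal_injective n (by simp [taylorVal_mk]))

variable (k P) in
/-- The components of the product of the Taylor complex. -/
def taylorMulHom (p q n : ℕ) (h : p + q = n) :
    (taylorComplex k P).X p ⊗ (taylorComplex k P).X q ⟶ (taylorComplex k P).X n :=
  ModuleCat.ofHom (TensorProduct.lift (taylorMulLin k P p q n h))

theorem taylorVal_mulHom (p q n : ℕ) (h : p + q = n) (x : (taylorComplex k P).X p)
    (y : (taylorComplex k P).X q) :
    taylorVal k P n ((taylorMulHom k P p q n h).hom (x ⊗ₜ y)) =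
      taylorMul MvPolynomial.X P (taylorVal k P p x) (taylorVal k P q y) := rfl

variable (k P) in
/-- The components of the product of the Taylor complex, zero unless `p + q = n`. -/
def taylorMulZ (p q n : ℕ) :
    (taylorComplex k P).X p ⊗ (taylorComplex k P).X q ⟶ (taylorComplex k P).X n :=
  if h : p + q = n then taylorMulHom k P p q n h else 0

theorem taylorVal_mulZ (p q n : ℕ) (h : p + q = n) (x : (taylorComplex k P).X p)
    (y : (taylorComplex k P).X q) :
    taylorVal k P n ((taylorMulZ k P p q n).hom (x ⊗ₜ y)) =
      taylorMul MvPolynomial.X P (taylorVal k P p x) (taylorVal k P q y) := by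
  rw [taylorMulZ, dif_pos h, taylorVal_mulHom]

theorem taylorMulZ_comp_d (p q n : ℕ) (h : p + q = n + 1) :
    taylorMulZ k P p q (n + 1) ≫ (taylorComplex k P).d (n + 1) n =
      ((taylorComplex k P).d p (p - 1) ▷ (taylorComplex k P).X q) ≫ taylorMulZ k P (p - 1) q n +
      (-1 : ℤˣ) ^ p • (((taylorComplex k P).X p ◁ (taylorComplex k P).d q (q - 1)) ≫
          taylorMulZ k P p (q - 1) n) := by
  refine ModuleCat.hom_ext (TensorProduct.ext' fun x y => taylorVal_injective n ?_)
  have e1 : taylorVal k P n (((taylorComplex k P).d (n + 1) n).hom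
      ((taylorMulZ k P p q (n + 1)).hom (x ⊗ₜ y))) =
      taylorD MvPolynomial.X P (taylorMul MvPolynomial.X P (taylorVal k P p x) (taylorVal k P q y)) := by
    rw [taylorVal_d_succ, taylorVal_mulZ _ _ _ h]
  have e2 : taylorVal k P n ((taylorMulZ k P (p - 1) q n).hom
      (((taylorComplex k P).d p (p - 1)).hom x ⊗ₜ y)) =
      taylorMul MvPolynomial.X P (taylorD MvPolynomial.X P (taylorVal k P p x))
        (taylorVal k P q y) := by
    cases p with
    | zero =>
      rw [HomologicalComplex.shape _ _ _ (by simp), taylorD_zero _ _ _ (taylorVal_mem x)]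
      simp
    | succ p => rw [taylorVal_mulZ _ _ _ (by omega), taylorVal_d]
  have e3 : taylorVal k P n ((taylorMulZ k P p (q - 1) n).hom
      (x ⊗ₜ ((taylorComplex k P).d q (q - 1)).hom y)) =
      taylorMul MvPolynomial.X P (taylorVal k P p x)
        (taylorD MvPolynomial.X P (taylorVal k P q y)) := by
    cases q with
    | zero =>
      rw [HomologicalComplex.shape _ _ _ (by simp), taylorD_zero _ _ _ (taylorVal_mem y)]
      simp
    | succ q => rw [taylorVal_mulZ _ _ _ (by omega), taylorVal_d]
  refine e1.trans ?_
  rw [taylor_leibniz _ _ p _ _ (taylorVal_mem x), ← e2, ← e3]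
  obtain hp | hp := neg_one_pow_eq_or ℤˣ p
  · have hp' : (-1 : MvPolynomial (Fin m) k) ^ p = 1 := by
      have := congrArg (fun u : ℤˣ => ((u : ℤ) : MvPolynomial (Fin m) k)) hp
      simpa using this
    rw [hp, hp', one_smul, one_smul, ← map_add]
    rfl
  · have hp' : (-1 : MvPolynomial (Fin m) k) ^ p = -1 := by
      have := congrArg (fun u : ℤˣ => ((u : ℤ) : MvPolynomial (Fin m) k)) hp
      simpa using this
    rw [hp, hp', neg_smul, one_smul, Units.neg_smul, one_smul, ← map_neg, ← map_add]
    rfl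

variable (k P) in
/-- The product of the Taylor complex in degree `n`. -/
def taylorMulDesc (n : ℕ) :
    (HomologicalComplex.tensorObj (taylorComplex k P) (taylorComplex k P)).X n ⟶
      (taylorComplex k P).X n :=
  HomologicalComplex.mapBifunctorDesc fun p q _ => taylorMulZ k P p q n

theorem ιZ_taylorMulDesc (p q n : ℕ) :
    ιZ (taylorComplex k P) p q n ≫ taylorMulDesc k P n = taylorMulZ k P p q n := by
  by_cases h : p + q = n
  · rw [ιZ_eq _ _ _ _ h]
    exact HomologicalComplex.ι_mapBifunctorDesc ..
  · rw [taylorMulZ, dif_neg h, ιZ, HomologicalComplex.ιMapBifunctorOrZero_eq_zero _ _ _ _ _ _ _ h,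
      Limits.zero_comp]

variable (k P) in
/-- The product of the Taylor complex. -/
def taylorMulChain : HomologicalComplex.tensorObj (taylorComplex k P) (taylorComplex k P) ⟶
    taylorComplex k P where
  f n := taylorMulDesc k P n
  comm' i n hin := by
    obtain rfl : n + 1 = i := hin
    apply HomologicalComplex.mapBifunctor.hom_ext
    intro p q h
    have h' : p + q = n + 1 := h
    have e1 := ι_d (taylorComplex k P) p q n h'
    have e2 := ιZ_taylorMulDesc (k := k) (P := P) p q (n + 1)
    have e3 := ιZ_taylorMulDesc (k := k) (P := P) (p - 1) q n
    have e4 := ιZ_taylorMulDesc (k := k) (P := P) p (q - 1) n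
    have e5 : ιZ (taylorComplex k P) p q (n + 1) ≫ taylorMulDesc k P (n + 1) ≫
        (taylorComplex k P).d (n + 1) n = ιZ (taylorComplex k P) p q (n + 1) ≫
        (HomologicalComplex.tensorObj (taylorComplex k P) (taylorComplex k P)).d (n + 1) n ≫
          taylorMulDesc k P n := by
      rw [reassoc_of% e2, reassoc_of% e1, taylorMulZ_comp_d p q n h', Preadditive.add_comp,
        Linear.units_smul_comp, Category.assoc, Category.assoc, e3, e4]
    rwa [ιZ_eq _ _ _ _ h'] at e5

/-- The product of the Taylor resolution lifts the multiplication of the face ring. -/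
def taylorChainMul : ChainMul (taylorResolution hP) where
  hom := taylorMulChain k P
  lifts := by
    rw [augmentation_taylorResolution]
    have e1 := ιZ_taylorMulDesc (k := k) (P := P) 0 0 0
    rw [ιZ_eq _ _ _ _ rfl] at e1
    refine ((reassoc_of% e1) (taylorAug k P K)).trans ?_
    refine ModuleCat.hom_ext (TensorProduct.ext' fun x y => ?_)
    change (taylorAug k P K).hom ((taylorMulZ k P 0 0 0).hom (x ⊗ₜ y)) =
      (taylorAug k P K).hom x * (taylorAug k P K).hom y
    rw [taylorAug_apply, taylorVal_mulZ 0 0 0 rfl, taylorAug_apply, taylorAug_apply, ← map_mul]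
    congr 1
    refine taylorComplex_induction (C := fun x => taylorMul MvPolynomial.X P (taylorVal k P 0 x)
      (taylorVal k P 0 y) ∅ = taylorVal k P 0 x ∅ * taylorVal k P 0 y ∅) ?_ ?_ ?_ x
    · simp
    · intro x x' hx hx'
      simp only [map_add, LinearMap.add_apply, Finsupp.add_apply, hx, hx', add_mul]
    intro S hS r
    refine taylorComplex_induction (C := fun y => taylorMul MvPolynomial.X P
      (taylorVal k P 0 (taylorMk k P 0 (Finsupp.single S r) _))
      (taylorVal k P 0 y) ∅ = taylorVal k P 0 (taylorMk k P 0 (Finsupp.single S r) _) ∅ *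
        taylorVal k P 0 y ∅) ?_ ?_ ?_ y
    · simp
    · intro x x' hx hx'
      simp only [map_add, Finsupp.add_apply, hx, hx', mul_add]
    intro T hT r'
    obtain rfl := Finset.card_eq_zero.1 hS
    obtain rfl := Finset.card_eq_zero.1 hT
    rw [taylorVal_mk, taylorVal_mk, taylorMul_single]
    simp [shuffleSign]

/-- The underlying vector of an element of the Taylor resolution. -/
def resVal (n : ℕ) : (taylorResolution hP).complex.X n →ₗ[MvPolynomial (Fin m) k]
    (Finset (Fin s) →₀ MvPolynomial (Fin m) k) :=
  taylorVal k P n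

/-- An element of the Taylor resolution, given by its underlying vector. -/
def resMk (n : ℕ) (x : Finset (Fin s) →₀ MvPolynomial (Fin m) k)
    (hx : x ∈ taylorPiece (Fin s) (MvPolynomial (Fin m) k) n) :
    (taylorResolution hP).complex.X n :=
  taylorMk k P n x hx

theorem resVal_mk (n : ℕ) (x : Finset (Fin s) →₀ MvPolynomial (Fin m) k)
    (hx : x ∈ taylorPiece (Fin s) (MvPolynomial (Fin m) k) n) :
    resVal hP n (resMk hP n x hx) = x := rfl

theorem resVal_mem (n : ℕ) (x : (taylorResolution hP).complex.X n) :
    resVal hP n x ∈ taylorPiece (Fin s) (MvPolynomial (Fin m) k) n :=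
  taylorVal_mem (P := P) x

theorem resVal_injective (n : ℕ) : Function.Injective (resVal hP n) :=
  taylorVal_injective (P := P) n

theorem resVal_d (n : ℕ) (x : (taylorResolution hP).complex.X n) :
    resVal hP (n - 1) (((taylorResolution hP).complex.d n (n - 1)).hom x) =
      taylorD MvPolynomial.X P (resVal hP n x) :=
  taylorVal_d (P := P) n x

theorem augmentation_apply (x : (taylorResolution hP).complex.X 0) :
    (augmentation (taylorResolution hP)).hom x = Ideal.Quotient.mk _ (resVal hP 0 x ∅) := by
  rw [augmentation_taylorResolution]
  rfl

theorem resVal_elMul (p q : ℕ) (x : (taylorResolution hP).complex.X p)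
    (y : (taylorResolution hP).complex.X q) :
    resVal hP (p + q) (elMul (taylorChainMul hP) p q (p + q) x y) =
      taylorMul MvPolynomial.X P (resVal hP p x) (resVal hP q y) := by
  refine Eq.trans ?_ (taylorVal_mulZ (k := k) (P := P) p q (p + q) rfl x y)
  rw [← ιZ_taylorMulDesc]
  rfl

/-- An induction principle: additive properties may be checked on the elements `r e_S`. -/
theorem res_induction {n : ℕ} {C : (taylorResolution hP).complex.X n → Prop} (zero : C 0)
    (add : ∀ x y, C x → C y → C (x + y))
    (single : ∀ (S : Finset (Fin s)) (hS : S.card = n) (r : MvPolynomial (Fin m) k),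
      C (resMk hP n (Finsupp.single S r) (single_mem_taylorPiece hS r)))
    (x : (taylorResolution hP).complex.X n) : C x :=
  taylorComplex_induction (P := P) zero add single x

end TaylorResolution

/-! ### Reduction modulo the variables -/

section Reduction

/-- The weighted Taylor differential commutes with a change of coefficients. -/
theorem mapRange_taylorD {ι α R R' : Type*} [LinearOrder ι] [DecidableEq α] [CommRing R]
    [CommRing R'] (f : R →+* R') (t : α → R) (P : ι → Finset α) (x : Finset ι →₀ R) :
    Finsupp.mapRange f (map_zero f) (taylorD t P x) =
      taylorD (fun a => f (t a)) P (Finsupp.mapRange f (map_zero f) x) := by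
  change Finsupp.mapRange.addMonoidHom f.toAddMonoidHom _ =
    taylorD _ P (Finsupp.mapRange.addMonoidHom f.toAddMonoidHom x)
  induction x using Finsupp.induction_linear with
  | zero => simp
  | add x y hx hy => simp only [map_add, hx, hy]
  | single S r =>
    have hs : ∀ i, f (posSign R i S) = posSign R' i S := fun i => by
      simp only [posSign, map_prod]
      exact Finset.prod_congr rfl fun j _ => by split_ifs <;> simp
    rw [taylorD_single, map_sum]
    simp only [Finsupp.mapRange.addMonoidHom_apply, Finsupp.mapRange_single]
    rw [taylorD_single]
    refine Finset.sum_congr rfl fun i _ => ?_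
    simp [hs, -Finsupp.single_mul]

/-- The weighted Taylor product commutes with a change of coefficients. -/
theorem mapRange_taylorMul {ι α R R' : Type*} [LinearOrder ι] [DecidableEq α] [CommRing R]
    [CommRing R'] (f : R →+* R') (t : α → R) (P : ι → Finset α) (x y : Finset ι →₀ R) :
    Finsupp.mapRange f (map_zero f) (taylorMul t P x y) =
      taylorMul (fun a => f (t a)) P (Finsupp.mapRange f (map_zero f) x)
        (Finsupp.mapRange f (map_zero f) y) := by
  change Finsupp.mapRange.addMonoidHom f.toAddMonoidHom _ =
    taylorMul _ P (Finsupp.mapRange.addMonoidHom f.toAddMonoidHom x)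
      (Finsupp.mapRange.addMonoidHom f.toAddMonoidHom y)
  induction x using Finsupp.induction_linear with
  | zero => simp
  | add x y hx hy => simp only [map_add, LinearMap.add_apply, hx, hy]
  | single S r =>
  induction y using Finsupp.induction_linear with
  | zero => simp
  | add x y hx hy => simp only [map_add, hx, hy]
  | single T r' =>
    have hs : f (shuffleSign R S T) = shuffleSign R' S T := by
      simp only [shuffleSign, map_prod]
      exact Finset.prod_congr rfl fun i _ => Finset.prod_congr rfl fun j _ => by
        split_ifs <;> simp
    rw [taylorMul_single]
    split_ifs with h
    · simp only [Finsupp.mapRange.addMonoidHom_apply, Finsupp.mapRange_single]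
      rw [taylorMul_single, if_pos h]
      simp [hs, -Finsupp.single_mul]
    · simp only [Finsupp.mapRange.addMonoidHom_apply, Finsupp.mapRange_single]
      rw [taylorMul_single, if_neg h]
      simp

variable (k : Type u) [Field k] {m s : ℕ} (P : Fin s → Finset (Fin m))

/-- Reduction of the coefficients modulo the variables. -/
def reduce (x : Finset (Fin s) →₀ MvPolynomial (Fin m) k) : Bar k s :=
  Finsupp.mapRange MvPolynomial.constantCoeff (map_zero _) x

variable {k}

theorem reduce_add (x y : Finset (Fin s) →₀ MvPolynomial (Fin m) k) :
    reduce k (x + y) = reduce k x + reduce k y := by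
  ext S; simp [reduce]

theorem reduce_smul (r : MvPolynomial (Fin m) k) (x : Finset (Fin s) →₀ MvPolynomial (Fin m) k) :
    reduce k (r • x) = MvPolynomial.constantCoeff r • reduce k x := by
  ext S; simp [reduce]

theorem reduce_single (S : Finset (Fin s)) (r : MvPolynomial (Fin m) k) :
    reduce k (Finsupp.single S r) = Finsupp.single S (MvPolynomial.constantCoeff r) := by
  simp [reduce]

theorem reduce_taylorD (x : Finset (Fin s) →₀ MvPolynomial (Fin m) k) :
    reduce k (taylorD MvPolynomial.X P x) = barD k P (reduce k x) := by
  rw [reduce, mapRange_taylorD, barD_eq_taylorD]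
  simp [reduce]

theorem reduce_taylorMul (x y : Finset (Fin s) →₀ MvPolynomial (Fin m) k) :
    reduce k (taylorMul MvPolynomial.X P x y) = barMul k P (reduce k x) (reduce k y) := by
  rw [reduce, mapRange_taylorMul, barMul_eq_taylorMul]
  simp [reduce]

/-- The identity map from the algebra `k` on which the variables act as zero to the field `k`. -/
def trivialEquiv (k : Type u) [Field k] (m : ℕ) : TrivialAlgebra k m ≃+* k := RingEquiv.refl k

theorem trivialEquiv_smul (r : MvPolynomial (Fin m) k) (b : TrivialAlgebra k m) :
    trivialEquiv k m (r • b) = MvPolynomial.constantCoeff r * trivialEquiv k m b := rfl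

theorem trivialEquiv_symm_smul (r : MvPolynomial (Fin m) k) (c : k) :
    (trivialEquiv k m).symm (MvPolynomial.constantCoeff r * c) = r • (trivialEquiv k m).symm c := rfl

/-- The module `P_n ⊗_R B`. -/
abbrev TensorX {R A : Type u} (B : Type u) [CommRing R] [CommRing A] [Algebra R A] [CommRing B]
    [Algebra R B] (P : Resolution R A) (n : ℕ) : Type u := (P.complex.X n) ⊗[R] B

variable {P} {K : LowerSet (Finset (Fin m))} (hP : IsSimplicialComplement k P K)

/-- The identification `T_n ⊗_{k[x]} k → Λ_n`, for the Taylor resolution `T`. -/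
def tensorToBar (n : ℕ) : TensorX (TrivialAlgebra k m) (taylorResolution hP) n →+ Bar k s :=
  TensorProduct.liftAddHom
    { toFun := fun x =>
        { toFun := fun b => trivialEquiv k m b • reduce k (resVal hP n x)
          map_zero' := by rw [map_zero, zero_smul]
          map_add' := fun b c => by rw [map_add, add_smul] }
      map_zero' := by
        ext b : 1
        change trivialEquiv k m b • reduce k (resVal hP n 0) = 0
        rw [map_zero]
        simp [reduce]
      map_add' := fun x y => by
        ext b : 1
        change trivialEquiv k m b • reduce k (resVal hP n (x + y)) =
          trivialEquiv k m b • reduce k (resVal hP n x) +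
          trivialEquiv k m b • reduce k (resVal hP n y)
        rw [map_add, reduce_add, smul_add] }
    (fun r x b => by
      change trivialEquiv k m b • reduce k (resVal hP n (r • x)) =
        trivialEquiv k m (r • b) • reduce k (resVal hP n x)
      rw [map_smul, reduce_smul, trivialEquiv_smul, smul_smul, mul_comm])

/-- The inverse of `tensorToBar`, extended by zero to the other degrees. -/
def barToTensor (n : ℕ) : Bar k s →+ TensorX (TrivialAlgebra k m) (taylorResolution hP) n where
  toFun f := ∑ S : Finset (Fin s), if h : S.card = n then
    resMk hP n (Finsupp.single S 1) (single_mem_taylorPiece h 1) ⊗ₜ (trivialEquiv k m).symm (f S)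
    else 0
  map_zero' := Finset.sum_eq_zero fun S _ => by
    split_ifs with h
    · rw [Finsupp.zero_apply, map_zero, TensorProduct.tmul_zero]
    · rfl
  map_add' f g := by
    rw [← Finset.sum_add_distrib]
    refine Finset.sum_congr rfl fun S _ => ?_
    split_ifs with h
    · rw [Finsupp.add_apply, map_add, TensorProduct.tmul_add]
    · rw [add_zero]

theorem barToTensor_smul (n : ℕ) (c : k) (f : Bar k s) :
    barToTensor hP n (c • f) =
      (MvPolynomial.C c : MvPolynomial (Fin m) k) • barToTensor hP n f := by
  change (∑ S : Finset (Fin s), if h : S.card = n then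
    resMk hP n (Finsupp.single S 1) (single_mem_taylorPiece h 1) ⊗ₜ
      (trivialEquiv k m).symm ((c • f) S) else 0) = (MvPolynomial.C c : MvPolynomial (Fin m) k) •
    (∑ S : Finset (Fin s), if h : S.card = n then
      resMk hP n (Finsupp.single S 1) (single_mem_taylorPiece h 1) ⊗ₜ
      (trivialEquiv k m).symm (f S) else 0)
  rw [Finset.smul_sum]
  refine Finset.sum_congr rfl fun S _ => ?_
  split_ifs with h
  · rw [← TensorProduct.tmul_smul, ← trivialEquiv_symm_smul, MvPolynomial.constantCoeff_C]
    rfl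
  · rw [smul_zero]

theorem tensorToBar_tmul (n : ℕ) (x : (taylorResolution hP).complex.X n) (b : TrivialAlgebra k m) :
    tensorToBar hP n (x ⊗ₜ b) = trivialEquiv k m b • reduce k (resVal hP n x) := rfl

theorem tensorToBar_mem (n : ℕ) (w : TensorX (TrivialAlgebra k m) (taylorResolution hP) n) :
    tensorToBar hP n w ∈ barPiece k s n := by
  induction w using TensorProduct.induction_on with
  | zero => rw [map_zero]; exact zero_mem _
  | add x y hx hy => rw [map_add]; exact add_mem hx hy
  | tmul x b =>
    rw [tensorToBar_tmul]
    refine Submodule.smul_mem _ _ ?_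
    refine res_induction hP (C := fun x => reduce k (resVal hP n x) ∈ barPiece k s n)
      ?_ ?_ ?_ x
    · rw [map_zero]
      simp [reduce]
    · intro x y hx hy
      rw [map_add, reduce_add]
      exact add_mem hx hy
    · intro S hS r
      rw [resVal_mk, reduce_single]
      exact Finsupp.single_mem_supported k _ hS

theorem barToTensor_single (n : ℕ) (S : Finset (Fin s)) (h : S.card = n) (c : k) :
    barToTensor hP n (Finsupp.single S c) =
      resMk hP n (Finsupp.single S 1) (single_mem_taylorPiece h 1) ⊗ₜ
        (trivialEquiv k m).symm c := by
  change (∑ T : Finset (Fin s), if h : T.card = n then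
    resMk hP n (Finsupp.single T 1) (single_mem_taylorPiece h 1) ⊗ₜ
      (trivialEquiv k m).symm (Finsupp.single S c T) else 0) = _
  rw [Finset.sum_eq_single S]
  · rw [dif_pos h, Finsupp.single_eq_same]
  · intro T _ hT
    split_ifs
    · rw [Finsupp.single_eq_of_ne hT, map_zero, TensorProduct.tmul_zero]
    · rfl
  · simp

theorem tensorToBar_barToTensor (n : ℕ) (f : Bar k s) (hf : f ∈ barPiece k s n) :
    tensorToBar hP n (barToTensor hP n f) = f := by
  refine supported_induction (C := fun f => tensorToBar hP n (barToTensor hP n f) = f) ?_ ?_ ?_ f hf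
  · rw [map_zero, map_zero]
  · intro x y hx hy
    rw [map_add, map_add, hx, hy]
  · intro S hS c
    rw [barToTensor_single hP n S hS, tensorToBar_tmul, resVal_mk, reduce_single]
    simp

theorem barToTensor_tensorToBar (n : ℕ)
    (w : TensorX (TrivialAlgebra k m) (taylorResolution hP) n) :
    barToTensor hP n (tensorToBar hP n w) = w := by
  induction w using TensorProduct.induction_on with
  | zero => rw [map_zero, map_zero]
  | add x y hx hy => rw [map_add, map_add, hx, hy]
  | tmul x b =>
    refine res_induction hP (C := fun x => barToTensor hP n (tensorToBar hP n (x ⊗ₜ b)) =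
      x ⊗ₜ b) ?_ ?_ ?_ x
    · rw [TensorProduct.zero_tmul, map_zero, map_zero]
    · intro x y hx hy
      rw [TensorProduct.add_tmul, map_add, map_add, hx, hy]
    · intro S hS r
      have h1 : resMk hP n (Finsupp.single S r) (single_mem_taylorPiece hS r) =
          r • resMk hP n (Finsupp.single S 1) (single_mem_taylorPiece hS 1) :=
        resVal_injective hP n (by
          rw [map_smul, resVal_mk, resVal_mk, Finsupp.smul_single, smul_eq_mul, mul_one])
      rw [tensorToBar_tmul, resVal_mk, reduce_single, Finsupp.smul_single,
        barToTensor_single hP n S hS, h1, TensorProduct.smul_tmul, smul_eq_mul,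
        mul_comm, trivialEquiv_symm_smul, RingEquiv.symm_apply_apply]

theorem tensorToBar_tensorD (n : ℕ)
    (w : TensorX (TrivialAlgebra k m) (taylorResolution hP) n) :
    tensorToBar hP (n - 1) (tensorD (TrivialAlgebra k m) (taylorResolution hP) n (n - 1) w) =
      barD k P (tensorToBar hP n w) := by
  induction w using TensorProduct.induction_on with
  | zero => simp only [map_zero]
  | add x y hx hy => rw [map_add, map_add, map_add, map_add, hx, hy]
  | tmul x b =>
    rw [tensorD, LinearMap.rTensor_tmul, tensorToBar_tmul, resVal_d, reduce_taylorD,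
      tensorToBar_tmul, map_smul]

theorem tensorToBar_tensorD_succ (n : ℕ)
    (w : TensorX (TrivialAlgebra k m) (taylorResolution hP) (n + 1)) :
    tensorToBar hP n (tensorD (TrivialAlgebra k m) (taylorResolution hP) (n + 1) n w) =
      barD k P (tensorToBar hP (n + 1) w) :=
  tensorToBar_tensorD hP (n + 1) w

theorem tensorToBar_chainPair (p q : ℕ)
    (x : TensorX (TrivialAlgebra k m) (taylorResolution hP) p)
    (y : TensorX (TrivialAlgebra k m) (taylorResolution hP) q) :
    tensorToBar hP (p + q)
        (chainPair (TrivialAlgebra k m) (taylorChainMul hP) p q (p + q) x y) =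
      barMul k P (tensorToBar hP p x) (tensorToBar hP q y) := by
  induction x using TensorProduct.induction_on with
  | zero => simp only [map_zero, LinearMap.zero_apply]
  | add x x' hx hx' => simp only [map_add, LinearMap.add_apply, hx, hx']
  | tmul x b =>
  induction y using TensorProduct.induction_on with
  | zero => simp only [map_zero]
  | add x x' hx hx' => simp only [map_add, hx, hx']
  | tmul y c =>
    rw [chainPair_tmul, tensorToBar_tmul, resVal_elMul, reduce_taylorMul, tensorToBar_tmul,
      tensorToBar_tmul, map_smul, map_smul, LinearMap.smul_apply, smul_smul, map_mul, mul_comm]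

theorem barToTensor_mem (n : ℕ) (z : barCycles k P n) :
    barToTensor hP n z.1 ∈ torCycles (TrivialAlgebra k m) (taylorResolution hP) n := by
  have h := tensorToBar_tensorD hP n (barToTensor hP n z.1)
  rw [tensorToBar_barToTensor hP n _ z.2.2, LinearMap.mem_ker.1 z.2.1] at h
  have h2 := congrArg (barToTensor hP (n - 1)) h
  rw [barToTensor_tensorToBar, map_zero] at h2
  exact h2

theorem tensorToBar_mem_barCycles (n : ℕ)
    (z : torCycles (TrivialAlgebra k m) (taylorResolution hP) n) :
    tensorToBar hP n z.1 ∈ barCycles k P n := by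
  refine ⟨?_, tensorToBar_mem hP n z.1⟩
  have h := tensorToBar_tensorD hP n z.1
  have hz : tensorD (TrivialAlgebra k m) (taylorResolution hP) n (n - 1) z.1 = 0 := z.2
  rw [hz, map_zero] at h
  exact h.symm

/-- The class in `Tor_n(k(K), k)` of a cycle of the algebra `Λ(P)`. -/
def barToTor (n : ℕ) : barCycles k P n →ₗ[k] FaceTor k K n where
  toFun z := torClass (TrivialAlgebra k m) (taylorResolution hP) n
    ⟨barToTensor hP n z.1, barToTensor_mem hP n z⟩
  map_add' x y := by
    refine Eq.trans ?_ (map_add (torClass (TrivialAlgebra k m) (taylorResolution hP) n) _ _)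
    exact congrArg (torClass (TrivialAlgebra k m) (taylorResolution hP) n)
      (Subtype.ext (map_add (barToTensor hP n) _ _))
  map_smul' c x := by
    refine Eq.trans ?_ (map_smul (torClass (TrivialAlgebra k m) (taylorResolution hP) n)
      (MvPolynomial.C c) _)
    exact congrArg (torClass (TrivialAlgebra k m) (taylorResolution hP) n)
      (Subtype.ext (barToTensor_smul hP n c x.1))

theorem barToTor_apply (n : ℕ) (z : barCycles k P n) :
    barToTor hP n z = torClass (TrivialAlgebra k m) (taylorResolution hP) n
      ⟨barToTensor hP n z.1, barToTensor_mem hP n z⟩ := rfl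

theorem barToTor_tensorToBar (n : ℕ)
    (z : torCycles (TrivialAlgebra k m) (taylorResolution hP) n) :
    barToTor hP n ⟨tensorToBar hP n z.1, tensorToBar_mem_barCycles hP n z⟩ =
      torClass (TrivialAlgebra k m) (taylorResolution hP) n z := by
  rw [barToTor_apply]
  exact congrArg (torClass (TrivialAlgebra k m) (taylorResolution hP) n)
    (Subtype.ext (barToTensor_tensorToBar hP n z.1))

theorem barToTor_surjective (n : ℕ) : Function.Surjective (barToTor hP n) := by
  intro t
  obtain ⟨z, rfl⟩ := torClass_surjective (TrivialAlgebra k m) (taylorResolution hP) n t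
  exact ⟨_, barToTor_tensorToBar hP n z⟩

theorem barToTor_eq_zero_iff (n : ℕ) (z : barCycles k P n) :
    barToTor hP n z = 0 ↔ z.1 ∈ (barPiece k s (n + 1)).map (barD k P) := by
  refine (torClass_eq_zero_iff _ (taylorResolution hP) n _).trans ?_
  constructor
  · rintro ⟨w, hw⟩
    refine ⟨tensorToBar hP (n + 1) w, tensorToBar_mem hP _ w, ?_⟩
    rw [← tensorToBar_tensorD_succ hP, hw, tensorToBar_barToTensor hP n _ z.2.2]
  · rintro ⟨w, hw, hwz⟩
    refine ⟨barToTensor hP (n + 1) w, ?_⟩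
    have h := tensorToBar_tensorD_succ hP n (barToTensor hP (n + 1) w)
    rw [tensorToBar_barToTensor hP _ _ hw, hwz] at h
    have h2 := congrArg (barToTensor hP n) h
    rw [barToTensor_tensorToBar] at h2
    exact h2

theorem ker_barToTor (n : ℕ) : ((barPiece k s (n + 1)).map (barD k P)).submoduleOf
    (LinearMap.ker (barD k P) ⊓ barPiece k s n) = LinearMap.ker (barToTor hP n) := by
  ext z
  rw [LinearMap.mem_ker, barToTor_eq_zero_iff]
  rfl

/-- The isomorphism `H_n(Λ(P)) ≅ Tor_n(k(K), k)`. -/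
def barTorEquiv (n : ℕ) : BarHomology k P n ≃ₗ[k] FaceTor k K n :=
  (Submodule.quotEquivOfEq _ _ (ker_barToTor hP n)).trans
    ((barToTor hP n).quotKerEquivOfSurjective (barToTor_surjective hP n))

theorem barTorEquiv_barClass (n : ℕ) (z : barCycles k P n) :
    barTorEquiv hP n (barClass k P n z) = barToTor hP n z := rfl

theorem barTorEquiv_one :
    barTorEquiv hP 0 (barClass k P 0 ⟨barOne k s, barOne_mem k P⟩) = faceTorOne k K := by
  rw [barTorEquiv_barClass, barToTor_apply]
  refine torClass_eq_torOne (taylorResolution hP)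
    (resMk hP 0 (Finsupp.single ∅ 1) (single_mem_taylorPiece Finset.card_empty 1)) ?_ _ ?_
  · rw [augmentation_apply, resVal_mk, Finsupp.single_eq_same, map_one]
  · exact barToTensor_single hP 0 ∅ Finset.card_empty 1

theorem barMul_mem_barCycles (p q : ℕ) (a : barCycles k P p) (b : barCycles k P q) :
    barMul k P a.1 b.1 ∈ barCycles k P (p + q) := by
  have hA := barIsDGA k P
  have ha : barD k P a.1 = 0 := a.2.1
  have hb : barD k P b.1 = 0 := b.2.1
  refine ⟨LinearMap.mem_ker.2 ?_, hA.mul_mem p q _ _ a.2.2 b.2.2⟩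
  rw [hA.leibniz p _ _ a.2.2, ha, hb]
  simp

theorem barTorEquiv_mul (p q : ℕ) (a : barCycles k P p) (b : barCycles k P q) :
    barTorEquiv hP (p + q)
      (barClass k P (p + q) ⟨barMul k P a.1 b.1, barMul_mem_barCycles p q a b⟩) =
        faceTorMul k K (barTorEquiv hP p (barClass k P p a))
          (barTorEquiv hP q (barClass k P q b)) := by
  rw [barTorEquiv_barClass, barTorEquiv_barClass, barTorEquiv_barClass, barToTor_apply]
  refine Eq.trans ?_ (torMul_torClass (taylorChainMul hP) p q
    ⟨barToTensor hP p a.1, barToTensor_mem hP p a⟩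
    ⟨barToTensor hP q b.1, barToTensor_mem hP q b⟩).symm
  refine congrArg (torClass (TrivialAlgebra k m) (taylorResolution hP) (p + q)) (Subtype.ext ?_)
  have h := tensorToBar_chainPair hP p q (barToTensor hP p a.1) (barToTensor hP q b.1)
  rw [tensorToBar_barToTensor hP _ _ a.2.2, tensorToBar_barToTensor hP _ _ b.2.2] at h
  have h2 := congrArg (barToTensor hP (p + q)) h
  rw [barToTensor_tensorToBar] at h2
  exact h2.symm

end Reduction

/-! ### The multigrading -/

section Multigrading

variable {k : Type u} [Field k] {m s : ℕ}

theorem finsupp_mvPolynomial_induction {C : (Finset (Fin s) →₀ MvPolynomial (Fin m) k) → Prop}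
    (zero : C 0) (add : ∀ x y, C x → C y → C (x + y))
    (single : ∀ S b c, C (Finsupp.single S (MvPolynomial.monomial b c)))
    (x : Finset (Fin s) →₀ MvPolynomial (Fin m) k) : C x := by
  induction x using Finsupp.induction_linear with
  | zero => exact zero
  | add x y hx hy => exact add x y hx hy
  | single S r =>
    induction r using MvPolynomial.induction_on' with
    | monomial b c => exact single S b c
    | add p q hp hq => rw [Finsupp.single_add]; exact add _ _ hp hq

variable (k) (P : Fin s → Finset (Fin m))

/-- The projection to the part of multidegree `a`, where `x^b e_S` has multidegree `b` plus the
indicator vector of `⋃_{i ∈ S} P i`. -/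
def degPart (a : Fin m →₀ ℕ) :
    (Finset (Fin s) →₀ MvPolynomial (Fin m) k) →ₗ[k] (Finset (Fin s) →₀ MvPolynomial (Fin m) k) :=
  Finsupp.lsum k fun S => (MvPolynomial.basisMonomials (Fin m) k).constr k fun b =>
    if b + indicatorVector (S.biUnion P) = a then Finsupp.single S (MvPolynomial.monomial b 1)
    else 0

variable {k P}

theorem degPart_single (a : Fin m →₀ ℕ) (S : Finset (Fin s)) (b : Fin m →₀ ℕ) (c : k) :
    degPart k P a (Finsupp.single S (MvPolynomial.monomial b c)) =
      if b + indicatorVector (S.biUnion P) = a then Finsupp.single S (MvPolynomial.monomial b c)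
      else 0 := by
  have h1 : (MvPolynomial.monomial b c : MvPolynomial (Fin m) k) =
      c • MvPolynomial.basisMonomials (Fin m) k b := by
    rw [MvPolynomial.coe_basisMonomials, MvPolynomial.smul_monomial, smul_eq_mul, mul_one]
  rw [degPart, Finsupp.lsum_single, h1, map_smul, Module.Basis.constr_basis,
    MvPolynomial.coe_basisMonomials]
  split_ifs
  · rw [Finsupp.smul_single]
  · rw [smul_zero]

theorem degPart_degPart (a b : Fin m →₀ ℕ) (x : Finset (Fin s) →₀ MvPolynomial (Fin m) k) :
    degPart k P a (degPart k P b x) = if a = b then degPart k P b x else 0 := by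
  refine finsupp_mvPolynomial_induction (C := fun x => degPart k P a (degPart k P b x) =
    if a = b then degPart k P b x else 0) (by simp) ?_ ?_ x
  · intro x y hx hy
    rw [map_add, map_add, hx, hy]
    split_ifs <;> simp
  · intro S e c
    rw [degPart_single]
    by_cases h : e + indicatorVector (S.biUnion P) = b
    · rw [if_pos h, degPart_single, h]
      simp only [eq_comm]
    · simp [h]

theorem degPart_monomial_smul (a b : Fin m →₀ ℕ) (c : k)
    (x : Finset (Fin s) →₀ MvPolynomial (Fin m) k) :
    degPart k P (a + b) ((MvPolynomial.monomial a c : MvPolynomial (Fin m) k) • x) =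
      (MvPolynomial.monomial a c : MvPolynomial (Fin m) k) • degPart k P b x := by
  refine finsupp_mvPolynomial_induction (C := fun x => degPart k P (a + b)
    ((MvPolynomial.monomial a c : MvPolynomial (Fin m) k) • x) =
      (MvPolynomial.monomial a c : MvPolynomial (Fin m) k) • degPart k P b x) (by simp) ?_ ?_ x
  · intro x y hx hy
    rw [smul_add, map_add, map_add, smul_add, hx, hy]
  · intro S e c'
    rw [Finsupp.smul_single, smul_eq_mul, MvPolynomial.monomial_mul, degPart_single,
      degPart_single, add_assoc]
    simp only [add_right_inj]
    split_ifs
    · rw [Finsupp.smul_single, smul_eq_mul, MvPolynomial.monomial_mul]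
    · rw [smul_zero]

theorem degPart_mem (a : Fin m →₀ ℕ) (n : ℕ) (x : Finset (Fin s) →₀ MvPolynomial (Fin m) k)
    (hx : x ∈ taylorPiece (Fin s) (MvPolynomial (Fin m) k) n) :
    degPart k P a x ∈ taylorPiece (Fin s) (MvPolynomial (Fin m) k) n := by
  refine supported_induction
    (C := fun x => degPart k P a x ∈ taylorPiece (Fin s) (MvPolynomial (Fin m) k) n) ?_ ?_ ?_ x hx
  · simp
  · intro x y hx hy
    rw [map_add]
    exact add_mem hx hy
  · intro S hS r
    induction r using MvPolynomial.induction_on' with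
    | monomial b c =>
      rw [degPart_single]
      split_ifs
      · exact single_mem_taylorPiece hS _
      · exact zero_mem _
    | add p q hp hq => rw [Finsupp.single_add, map_add]; exact add_mem hp hq

/-- The Taylor differential is homogeneous of multidegree zero. -/
theorem degPart_taylorD (a : Fin m →₀ ℕ) (x : Finset (Fin s) →₀ MvPolynomial (Fin m) k) :
    degPart k P a (taylorD MvPolynomial.X P x) = taylorD MvPolynomial.X P (degPart k P a x) := by
  refine finsupp_mvPolynomial_induction (C := fun x => degPart k P a (taylorD MvPolynomial.X P x) =
    taylorD MvPolynomial.X P (degPart k P a x)) (by simp) ?_ ?_ x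
  · intro x y hx hy
    rw [map_add, map_add, map_add, map_add, hx, hy]
  · intro S b c
    have h1 : (Finsupp.single S (MvPolynomial.monomial b c) :
        Finset (Fin s) →₀ MvPolynomial (Fin m) k) =
        c • Finsupp.single S (MvPolynomial.monomial b (1 : k)) := by
      rw [Finsupp.smul_single, MvPolynomial.smul_monomial, smul_eq_mul, mul_one]
    have h2 : ∀ j ∈ S, b + indicatorVector (S.biUnion P \ (S.erase j).biUnion P) +
        indicatorVector ((S.erase j).biUnion P) = b + indicatorVector (S.biUnion P) := by
      intro j _
      have h : (S.erase j).biUnion P ⊆ S.biUnion P :=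
        Finset.biUnion_subset_biUnion_of_subset_left _ (Finset.erase_subset _ _)
      rw [add_assoc]
      congr 1
      exact Finset.sum_sdiff h
    rw [h1, LinearMap.map_smul_of_tower, map_smul, map_smul, LinearMap.map_smul_of_tower]
    congr 1
    rw [taylorD_single_monomial, map_sum, degPart_single]
    split_ifs with h
    · rw [taylorD_single_monomial]
      refine Finset.sum_congr rfl fun j hj => ?_
      rw [map_smul, degPart_single, h2 j hj, if_pos h]
    · rw [map_zero]
      refine Finset.sum_eq_zero fun j hj => ?_
      rw [map_smul, degPart_single, h2 j hj, if_neg h, smul_zero]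

/-- Modulo the variables, multidegree `a` retains only the `e_S` such that `⋃_{i ∈ S} P i` has indicator
vector `a`. -/
theorem reduce_degPart_mem (a : Fin m →₀ ℕ) (x : Finset (Fin s) →₀ MvPolynomial (Fin m) k) :
    reduce k (degPart k P a x) ∈
      Finsupp.supported k k {S | indicatorVector (S.biUnion P) = a} := by
  refine finsupp_mvPolynomial_induction (C := fun x => reduce k (degPart k P a x) ∈
      Finsupp.supported k k {S | indicatorVector (S.biUnion P) = a}) (by simp [reduce]) ?_ ?_ x
  · intro x y hx hy
    rw [map_add, reduce_add]
    exact add_mem hx hy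
  · intro S b c
    rw [degPart_single]
    split_ifs with h
    · rw [reduce_single, MvPolynomial.constantCoeff_monomial]
      split_ifs with hb
      · refine Finsupp.single_mem_supported k _ ?_
        rw [hb, zero_add] at h
        exact h
      · simp
    · simp [reduce]

theorem indicatorVector_injective :
    Function.Injective (indicatorVector : Finset (Fin m) → Fin m →₀ ℕ) := by
  intro A B h
  ext c
  have := DFunLike.congr_fun h c
  rw [indicatorVector_apply, indicatorVector_apply] at this
  by_cases h1 : c ∈ A <;> by_cases h2 : c ∈ B <;> simp_all

variable {K : LowerSet (Finset (Fin m))} (hP : IsSimplicialComplement k P K)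

/-- The projection of the Taylor resolution to its part of multidegree `a`. -/
def resPart (n : ℕ) (a : Fin m →₀ ℕ) :
    (taylorResolution hP).complex.X n →+ (taylorResolution hP).complex.X n where
  toFun x := resMk hP n (degPart k P a (resVal hP n x)) (degPart_mem a n _ (resVal_mem hP n x))
  map_zero' := resVal_injective hP n (by rw [resVal_mk, map_zero, map_zero])
  map_add' x y := resVal_injective hP n (by
    refine Eq.trans ?_ (map_add (resVal hP n) _ _).symm
    exact (congrArg (degPart k P a) (map_add (resVal hP n) x y)).trans (map_add _ _ _))

theorem resVal_resPart (n : ℕ) (a : Fin m →₀ ℕ) (x : (taylorResolution hP).complex.X n) :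
    resVal hP n (resPart hP n a x) = degPart k P a (resVal hP n x) := rfl

/-- The part of multidegree `a` of the Taylor resolution. -/
def resDeg (n : ℕ) (a : Fin m →₀ ℕ) : AddSubgroup ((taylorResolution hP).complex.X n) :=
  (resPart hP n a).eqLocus (AddMonoidHom.id _)

theorem mem_resDeg (n : ℕ) (a : Fin m →₀ ℕ) (x : (taylorResolution hP).complex.X n) :
    x ∈ resDeg hP n a ↔ resPart hP n a x = x := Iff.rfl

theorem resPart_mem (n : ℕ) (a : Fin m →₀ ℕ) (x : (taylorResolution hP).complex.X n) :
    resPart hP n a x ∈ resDeg hP n a := by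
  refine resVal_injective hP n ?_
  change degPart k P a (degPart k P a _) = degPart k P a _
  rw [degPart_degPart, if_pos rfl]

theorem resPart_of_ne (n : ℕ) {a b : Fin m →₀ ℕ} (h : a ≠ b)
    (x : (taylorResolution hP).complex.X n) (hx : x ∈ resDeg hP n b) : resPart hP n a x = 0 := by
  refine resVal_injective hP n ?_
  rw [← (mem_resDeg hP n b x).1 hx, map_zero]
  change degPart k P a (degPart k P b _) = 0
  rw [degPart_degPart, if_neg h]

theorem single_mem_resDeg (n : ℕ) (S : Finset (Fin s)) (hS : S.card = n) (b : Fin m →₀ ℕ) (c : k) :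
    resMk hP n (Finsupp.single S (MvPolynomial.monomial b c)) (single_mem_taylorPiece hS _) ∈
      resDeg hP n (b + indicatorVector (S.biUnion P)) := by
  refine resVal_injective hP n ?_
  change degPart k P _ (resVal hP n (resMk hP n _ _)) = _
  rw [resVal_mk, degPart_single, if_pos rfl]
  rfl

theorem isInternal_resDeg (n : ℕ) : DirectSum.IsInternal (resDeg hP n) := by
  constructor
  · rw [injective_iff_map_eq_zero]
    intro x hx
    have key : ∀ (a : Fin m →₀ ℕ) (x : DirectSum _ fun a => resDeg hP n a),
        resPart hP n a (DirectSum.coeAddMonoidHom (resDeg hP n) x) = x a := by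
      intro a x
      induction x using DirectSum.induction_on with
      | zero => simp
      | add x y hx hy => rw [map_add, map_add, hx, hy]; rfl
      | of b x =>
        rw [DirectSum.coeAddMonoidHom_of]
        by_cases h : a = b
        · subst h
          rw [DirectSum.of_eq_same]
          exact x.2
        · rw [resPart_of_ne hP n h _ x.2, DirectSum.of_eq_of_ne _ _ _ h]
          rfl
    refine DFinsupp.ext fun a => Subtype.ext ?_
    refine (key a x).symm.trans ?_
    rw [hx, map_zero]
    rfl
  · intro x
    refine res_induction hP
      (C := fun x => ∃ z, DirectSum.coeAddMonoidHom (resDeg hP n) z = x) ?_ ?_ ?_ x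
    · exact ⟨0, map_zero _⟩
    · rintro _ _ ⟨x, rfl⟩ ⟨y, rfl⟩
      exact ⟨x + y, map_add _ _ _⟩
    · intro S hS r
      induction r using MvPolynomial.induction_on' with
      | monomial b c =>
        exact ⟨DirectSum.of (fun a => resDeg hP n a) _ ⟨_, single_mem_resDeg hP n S hS b c⟩,
          DirectSum.coeAddMonoidHom_of _ _ _⟩
      | add p q hp hq =>
        obtain ⟨x, hx⟩ := hp
        obtain ⟨y, hy⟩ := hq
        refine ⟨x + y, ?_⟩
        rw [map_add, hx, hy]
        refine resVal_injective hP n ?_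
        rw [map_add, resVal_mk, resVal_mk, resVal_mk, Finsupp.single_add]

theorem resPart_monomial_smul (n : ℕ) (a b : Fin m →₀ ℕ) (c : k)
    (x : (taylorResolution hP).complex.X n) :
    resPart hP n (a + b) ((MvPolynomial.monomial a c : MvPolynomial (Fin m) k) • x) =
      (MvPolynomial.monomial a c : MvPolynomial (Fin m) k) • resPart hP n b x := by
  refine resVal_injective hP n ?_
  rw [resVal_resPart, map_smul, degPart_monomial_smul, map_smul, resVal_resPart]

theorem resPart_d (i j : ℕ) (a : Fin m →₀ ℕ) (x : (taylorResolution hP).complex.X i) :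
    resPart hP j a (((taylorResolution hP).complex.d i j).hom x) =
      ((taylorResolution hP).complex.d i j).hom (resPart hP i a x) := by
  by_cases h : j + 1 = i
  · subst h
    refine resVal_injective hP j ?_
    have h1 := resVal_d hP (j + 1) x
    have h2 := resVal_d hP (j + 1) (resPart hP (j + 1) a x)
    rw [resVal_resPart] at h2 ⊢
    refine (congrArg (degPart k P a) h1).trans (Eq.trans ?_ h2.symm)
    exact degPart_taylorD a _
  · rw [(taylorResolution hP).complex.shape i j h]
    exact map_zero _

/-- The Stanley-Reisner ideal contains the terms of its elements. -/
theorem stanleyReisnerIdeal_monomial_coeff (K : LowerSet (Finset (Fin m)))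
    {p : MvPolynomial (Fin m) k} (hp : p ∈ stanleyReisnerIdeal k K) (a : Fin m →₀ ℕ) :
    (MvPolynomial.monomial a (p.coeff a) : MvPolynomial (Fin m) k) ∈ stanleyReisnerIdeal k K := by
  revert a
  refine Submodule.span_induction (p := fun p _ =>
    ∀ a, (MvPolynomial.monomial a (p.coeff a) : MvPolynomial (Fin m) k) ∈ stanleyReisnerIdeal k K)
    ?_ ?_ ?_ ?_ hp
  · rintro _ ⟨σ, hσ, rfl⟩ a
    have h : sqfreeMonomial k σ ∈ stanleyReisnerIdeal k K :=
      Ideal.subset_span ⟨σ, hσ, rfl⟩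
    rw [sqfreeMonomial, prod_X_eq_monomial] at h ⊢
    rw [MvPolynomial.coeff_monomial]
    split_ifs with h1
    · rwa [← h1]
    · rw [map_zero]
      exact zero_mem _
  · simp
  · intro x y _ _ hx hy a
    rw [MvPolynomial.coeff_add, map_add]
    exact add_mem (hx a) (hy a)
  · intro r x _ hx a
    rw [smul_eq_mul]
    induction r using MvPolynomial.induction_on' with
    | monomial e c =>
      rw [MvPolynomial.coeff_monomial_mul']
      split_ifs with h
      · rw [← add_tsub_cancel_of_le h, ← MvPolynomial.monomial_mul, add_tsub_cancel_left]
        exact Ideal.mul_mem_left _ _ (hx _)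
      · rw [map_zero]
        exact zero_mem _
    | add p q hp hq =>
      rw [add_mul, MvPolynomial.coeff_add, map_add]
      exact add_mem hp hq

/-- The augmentation of the Taylor resolution is homogeneous of multidegree zero. -/
theorem augmentation_resPart (a : Fin m →₀ ℕ) (x : (taylorResolution hP).complex.X 0) :
    (augmentation (taylorResolution hP)).hom (resPart hP 0 a x) =
      Ideal.Quotient.mk _ (MvPolynomial.monomial a ((resVal hP 0 x ∅).coeff a)) := by
  rw [augmentation_apply]
  congr 1
  rw [resVal_resPart]
  refine finsupp_mvPolynomial_induction (C := fun x => degPart k P a x ∅ =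
    MvPolynomial.monomial a ((x ∅).coeff a)) (by simp) ?_ ?_ _
  · intro x y hx hy
    rw [map_add, Finsupp.add_apply, Finsupp.add_apply, hx, hy, MvPolynomial.coeff_add, map_add]
  · intro S b c
    rw [degPart_single]
    by_cases hS : S = ∅
    · subst hS
      rw [Finset.biUnion_empty, indicatorVector, Finset.sum_empty, add_zero,
        Finsupp.single_eq_same, MvPolynomial.coeff_monomial]
      split_ifs with h
      · rw [Finsupp.single_eq_same, h]
      · rw [map_zero, Finsupp.zero_apply]
    · rw [Finsupp.single_eq_of_ne (Ne.symm hS), MvPolynomial.coeff_zero, map_zero]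
      split_ifs
      · exact Finsupp.single_eq_of_ne (Ne.symm hS)
      · rfl

/-- The Taylor resolution with its multigrading. -/
def taylorMultigraded : MultigradedResolution k K where
  res := taylorResolution hP
  deg := resDeg hP
  isInternal := isInternal_resDeg hP
  smul_mem n a b c x hx := by
    rw [mem_resDeg, resPart_monomial_smul, (mem_resDeg hP n b x).1 hx]
  d_mem i j a x hx := by
    rw [mem_resDeg, resPart_d, (mem_resDeg hP i a x).1 hx]
  augmentation_mem a x hx := by
    rw [← (mem_resDeg hP 0 a x).1 hx, augmentation_resPart]
    exact ⟨_, rfl⟩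

theorem barToTensor_mem_tensorDeg (n : ℕ) (σ : Finset (Fin m)) (z : Bar k s)
    (hz : z ∈ barPieceAt k P σ n) :
    barToTensor hP n z ∈ (taylorMultigraded hP).tensorDeg k n (indicatorVector σ) := by
  refine supported_induction (C := fun z => barToTensor hP n z ∈
    (taylorMultigraded hP).tensorDeg k n (indicatorVector σ)) ?_ ?_ ?_ z hz
  · rw [map_zero]
    exact zero_mem _
  · intro x y hx hy
    rw [map_add]
    exact add_mem hx hy
  · rintro S ⟨hS, hσ⟩ c
    rw [barToTensor_single hP n S hS]
    refine AddSubgroup.subset_closure ⟨_, ?_, _, rfl⟩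
    have h := single_mem_resDeg hP n S hS 0 1
    rw [zero_add, hσ] at h
    exact h

theorem tensorToBar_mem_barPieceAt (n : ℕ) (σ : Finset (Fin m))
    (x : (taylorResolution hP).complex.X n) (hx : x ∈ resDeg hP n (indicatorVector σ))
    (b : TrivialAlgebra k m) : tensorToBar hP n (x ⊗ₜ b) ∈ barPieceAt k P σ n := by
  have h1 := tensorToBar_mem hP n (x ⊗ₜ b)
  rw [tensorToBar_tmul] at h1 ⊢
  have h2 : trivialEquiv k m b • reduce k (resVal hP n x) ∈
      Finsupp.supported k k {S | indicatorVector (S.biUnion P) = indicatorVector σ} := by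
    refine Submodule.smul_mem _ _ ?_
    rw [← (mem_resDeg hP n _ x).1 hx, resVal_resPart]
    exact reduce_degPart_mem _ _
  exact fun S hS => ⟨h1 hS, indicatorVector_injective (h2 hS)⟩

section DegreeZeroPart

variable (G : MultigradedResolution k K)

/-- To prove an additive property, check it on homogeneous elements. -/
theorem MultigradedResolution.induction {G : MultigradedResolution k K} {n : ℕ}
    {C : G.res.complex.X n → Prop} (zero : C 0) (add : ∀ x y, C x → C y → C (x + y))
    (homogeneous : ∀ a, ∀ x ∈ G.deg n a, C x) (x : G.res.complex.X n) : C x := by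
  obtain ⟨z, rfl⟩ := (G.isInternal n).2 x
  induction z using DirectSum.induction_on with
  | zero => rw [map_zero]; exact zero
  | add x y hx hy => rw [map_add]; exact add _ _ hx hy
  | of a x => rw [DirectSum.coeAddMonoidHom_of]; exact homogeneous a _ x.2

variable {G} (f : G.res.complex ⟶ (taylorResolution hP).complex)

/-- The sum over all `a` of the components from degree `a` to degree `a` of a map. -/
def degreeZeroAdd (n : ℕ) : G.res.complex.X n →+ (taylorResolution hP).complex.X n :=
  (DirectSum.toAddMonoid fun a => ((resPart hP n a).comp (f.f n).hom.toAddMonoidHom).comp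
    (G.deg n a).subtype).comp
  (AddEquiv.ofBijective (DirectSum.coeAddMonoidHom (G.deg n)) (G.isInternal n)).symm.toAddMonoidHom

theorem degreeZeroAdd_apply (n : ℕ) (a : Fin m →₀ ℕ) (x : G.res.complex.X n) (hx : x ∈ G.deg n a) :
    degreeZeroAdd hP f n x = resPart hP n a ((f.f n).hom x) := by
  have h : (AddEquiv.ofBijective (DirectSum.coeAddMonoidHom (G.deg n)) (G.isInternal n)).symm x =
      DirectSum.of (fun a => G.deg n a) a ⟨x, hx⟩ := by
    rw [AddEquiv.symm_apply_eq]
    exact (DirectSum.coeAddMonoidHom_of (G.deg n) a ⟨x, hx⟩).symm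
  change DirectSum.toAddMonoid _
    ((AddEquiv.ofBijective (DirectSum.coeAddMonoidHom (G.deg n)) (G.isInternal n)).symm x) = _
  rw [h, DirectSum.toAddMonoid_of]
  rfl

theorem degreeZeroAdd_smul (n : ℕ) (r : MvPolynomial (Fin m) k) (x : G.res.complex.X n) :
    degreeZeroAdd hP f n (r • x) = r • degreeZeroAdd hP f n x := by
  refine G.induction (C := fun x => degreeZeroAdd hP f n (r • x) = r • degreeZeroAdd hP f n x)
    ?_ ?_ ?_ x
  · rw [smul_zero, map_zero, smul_zero]
  · intro x y hx hy
    rw [smul_add, map_add, map_add, smul_add, hx, hy]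
  · intro a x hx
    induction r using MvPolynomial.induction_on' with
    | monomial e c =>
      rw [degreeZeroAdd_apply hP f n a x hx,
        degreeZeroAdd_apply hP f n _ _ (G.smul_mem n e a c x hx), map_smul,
        resPart_monomial_smul]
    | add p q hp hq => rw [add_smul, map_add, hp, hq, add_smul]

/-- The part of multidegree zero of a chain map from a multigraded resolution to the Taylor
resolution. -/
def degreeZeroMap : G.res.complex ⟶ (taylorResolution hP).complex where
  f n := ModuleCat.ofHom
    { toFun := degreeZeroAdd hP f n
      map_add' := map_add _
      map_smul' := degreeZeroAdd_smul hP f n }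
  comm' i j _ := by
    refine ModuleCat.hom_ext (LinearMap.ext fun x => ?_)
    change ((taylorResolution hP).complex.d i j).hom (degreeZeroAdd hP f i x) =
      degreeZeroAdd hP f j ((G.res.complex.d i j).hom x)
    refine G.induction (C := fun x => ((taylorResolution hP).complex.d i j).hom
      (degreeZeroAdd hP f i x) = degreeZeroAdd hP f j ((G.res.complex.d i j).hom x)) ?_ ?_ ?_ x
    · simp only [map_zero]
    · intro x y hx hy
      simp only [map_add, hx, hy]
    · intro a x hx
      rw [degreeZeroAdd_apply hP f i a x hx, degreeZeroAdd_apply hP f j a _ (G.d_mem i j a x hx),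
        ← resPart_d]
      exact congrArg (resPart hP j a) (congrArg (fun g => g.hom x) (f.comm i j))

theorem degreeZeroMap_apply (n : ℕ) (x : G.res.complex.X n) :
    ((degreeZeroMap hP f).f n).hom x = degreeZeroAdd hP f n x := rfl

/-- The part of multidegree zero of a comparison map is again a comparison map, since the
Stanley-Reisner ideal is homogeneous. -/
theorem degreeZeroMap_augmentation
    (hf : f.f 0 ≫ augmentation (taylorResolution hP) = augmentation G.res) :
    (degreeZeroMap hP f).f 0 ≫ augmentation (taylorResolution hP) = augmentation G.res := by
  refine ModuleCat.hom_ext (LinearMap.ext fun x => ?_)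
  change (augmentation (taylorResolution hP)).hom (degreeZeroAdd hP f 0 x) =
    (augmentation G.res).hom x
  refine G.induction (C := fun x => (augmentation (taylorResolution hP)).hom
    (degreeZeroAdd hP f 0 x) = (augmentation G.res).hom x) ?_ ?_ ?_ x
  · simp only [map_zero]
  · intro x y hx hy
    simp only [map_add, hx, hy]
  · intro a x hx
    have h : (augmentation (taylorResolution hP)).hom ((f.f 0).hom x) =
        (augmentation G.res).hom x := congrArg (fun g => g.hom x) hf
    obtain ⟨c, hc⟩ := G.augmentation_mem a x hx
    rw [hc] at h ⊢
    rw [degreeZeroAdd_apply hP f 0 a x hx, augmentation_resPart]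
    rw [augmentation_apply] at h
    have h1 := stanleyReisnerIdeal_monomial_coeff K (Ideal.Quotient.eq.1 h) a
    refine Ideal.Quotient.eq.2 ?_
    rwa [MvPolynomial.coeff_sub, MvPolynomial.coeff_monomial, if_pos rfl, map_sub] at h1

end DegreeZeroPart

/-- The classes of cycles with support `σ` are those of multidegree `σ`. -/
theorem range_barHomologyAtIncl (n : ℕ) (σ : Finset (Fin m)) :
    LinearMap.range ((barTorEquiv hP n).toLinearMap ∘ₗ barHomologyAtIncl k P σ n) =
      multidegreeTor k K n (indicatorVector σ) := by
  apply le_antisymm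
  · rintro _ ⟨y, rfl⟩
    obtain ⟨z, rfl⟩ := Submodule.mkQ_surjective _ y
    refine Submodule.subset_span ⟨taylorMultigraded hP,
      ⟨barToTensor hP n z.1, barToTensor_mem hP n ⟨z.1, z.2.1, barPieceAt_le k P σ n z.2.2⟩⟩,
      barToTensor_mem_tensorDeg hP n σ z.1 z.2.2, rfl⟩
  · refine Submodule.span_le.2 ?_
    rintro _ ⟨G, z, hz, rfl⟩
    obtain ⟨f, hf⟩ := exists_comparison G.res (taylorResolution hP)
    have hg := degreeZeroMap_augmentation hP f hf
    have hmem : tensorToBar hP n (tensorMap (degreeZeroMap hP f) n z.1) ∈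
        barPieceAt k P σ n := by
      refine AddSubgroup.closure_induction (p := fun w _ =>
        tensorToBar hP n (tensorMap (B := TrivialAlgebra k m) (degreeZeroMap hP f) n w) ∈
          barPieceAt k P σ n) ?_ ?_ ?_ ?_ hz
      · rintro _ ⟨x, hx, b, rfl⟩
        refine tensorToBar_mem_barPieceAt hP n σ _ ?_ b
        rw [degreeZeroMap_apply, degreeZeroAdd_apply hP f n _ x hx]
        exact resPart_mem hP n _ _
      · rw [map_zero, map_zero]
        exact zero_mem _
      · intro x y _ _ hx hy
        rw [map_add, map_add]
        exact add_mem hx hy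
      · intro x _ hx
        rw [map_neg, map_neg]
        exact neg_mem hx
    rw [← torClass_tensorMap (degreeZeroMap hP f) hg n z]
    refine ⟨Submodule.mkQ _ ⟨tensorToBar hP n (tensorMap (degreeZeroMap hP f) n z.1),
      (tensorToBar_mem_barCycles hP n ⟨_, tensorMap_mem (degreeZeroMap hP f) n z⟩).1, hmem⟩, ?_⟩
    exact barToTor_tensorToBar hP n ⟨_, tensorMap_mem (degreeZeroMap hP f) n z⟩

end Multigrading

/-! ### Homology of quotients -/

section HomologyAlgebra

variable {k : Type u} [Field k] {V W : Type*} [AddCommGroup V] [Module k V] [AddCommGroup W]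
  [Module k W]

/-- The map on homology induced by a linear map that commutes with the differentials. -/
def HomologyAt.map {d : V →ₗ[k] V} {d' : W →ₗ[k] W} {C C' : Submodule k V} {E E' : Submodule k W}
    (f : V →ₗ[k] W) (hf : ∀ x, f (d x) = d' (f x)) (h : ∀ x ∈ C, f x ∈ E)
    (h' : ∀ x ∈ C', f x ∈ E') : HomologyAt d C C' →ₗ[k] HomologyAt d' E E' :=
  Submodule.mapQ _ _
    (f.restrict fun x hx => ⟨LinearMap.mem_ker.2 (by
      rw [← hf, LinearMap.mem_ker.1 hx.1, map_zero]), h x hx.2⟩)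
    fun x hx => by
      obtain ⟨y, hy, hyx⟩ := hx
      exact ⟨f y, h' y hy, (hf y).symm.trans (congrArg f hyx)⟩

/-- Equal cycles and boundaries give the same homology. -/
def quotientSubmoduleOfCongr {Z Z' B B' : Submodule k V} (hZ : Z = Z') (hB : B = B') :
    (↥Z ⧸ B.submoduleOf Z) ≃ₗ[k] (↥Z' ⧸ B'.submoduleOf Z') := by
  subst hZ hB
  exact LinearEquiv.refl k _

theorem quotientSubmoduleOfCongr_mk {Z Z' B B' : Submodule k V} (hZ : Z = Z') (hB : B = B')
    (z : Z) :
    quotientSubmoduleOfCongr hZ hB (Submodule.mkQ _ z) = Submodule.mkQ _ ⟨z.1, hZ ▸ z.2⟩ := by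
  subst hZ hB
  rfl

/-- A surjective chain map with acyclic kernel is an isomorphism on homology. -/
theorem HomologyAt.nonempty_equiv_of_acyclic_ker {d : V →ₗ[k] V} {d' : W →ₗ[k] W}
    {C C' : Submodule k V} {E E' : Submodule k W} (p : V →ₗ[k] W)
    (hC : C.map p = E) (hC' : C'.map p = E')
    (hd : ∀ x ∈ C, p (d x) = d' (p x)) (hd' : ∀ x ∈ C', p (d x) = d' (p x))
    (hmem : ∀ x ∈ C', d x ∈ C) (hdd : ∀ x ∈ C', d (d x) = 0)
    (exact_left : ∀ x ∈ C, p (d x) = 0 → ∃ y ∈ C, p y = 0 ∧ d y = d x)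
    (exact_right : ∀ x ∈ C, d x = 0 → p x = 0 → ∃ y ∈ C', p y = 0 ∧ d y = x) :
    Nonempty (HomologyAt d C C' ≃ₗ[k] HomologyAt d' E E') := by
  let f : ↥(LinearMap.ker d ⊓ C) →ₗ[k] HomologyAt d' E E' :=
    Submodule.mkQ _ ∘ₗ p.restrict (q := LinearMap.ker d' ⊓ E) fun x hx => ⟨LinearMap.mem_ker.2 (by
      rw [← hd x hx.2, LinearMap.mem_ker.1 hx.1, map_zero]),
      hC ▸ Submodule.mem_map_of_mem hx.2⟩
  have hsurj : Function.Surjective f := by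
    intro y
    obtain ⟨⟨e, he, heE⟩, rfl⟩ := Submodule.mkQ_surjective _ y
    rw [← hC] at heE
    obtain ⟨c, hc, rfl⟩ := heE
    obtain ⟨a, ha, hpa, hda⟩ := exact_left c hc ((hd c hc).trans he)
    refine ⟨⟨c - a, LinearMap.mem_ker.2 ?_, sub_mem hc ha⟩, ?_⟩
    · rw [map_sub, hda, sub_self]
    · refine congrArg (Submodule.mkQ _) (Subtype.ext ?_)
      change p (c - a) = p c
      rw [map_sub, hpa, sub_zero]
  have hker : (C'.map d).submoduleOf (LinearMap.ker d ⊓ C) = LinearMap.ker f := by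
    ext ⟨c, hc, hcC⟩
    rw [LinearMap.mem_ker]
    refine Iff.trans ?_ (Submodule.Quotient.mk_eq_zero _).symm
    constructor
    · rintro ⟨x, hx, hxc⟩
      exact ⟨p x, hC' ▸ Submodule.mem_map_of_mem hx, (hd' x hx).symm.trans (congrArg p hxc)⟩
    · rintro ⟨y, hy, hyc⟩
      rw [← hC'] at hy
      obtain ⟨x, hx, rfl⟩ := hy
      have h1 : p (c - d x) = 0 := by
        rw [map_sub, hd' x hx, hyc]
        exact sub_self _
      obtain ⟨a, ha, _, hda⟩ := exact_right (c - d x) (sub_mem hcC (hmem x hx)) (by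
        rw [map_sub, hdd x hx, LinearMap.mem_ker.1 hc, sub_zero]) h1
      refine ⟨x + a, add_mem hx ha, ?_⟩
      change d (x + a) = c
      rw [map_add, hda, add_sub_cancel]
  exact ⟨(Submodule.quotEquivOfEq _ _ hker).trans (f.quotKerEquivOfSurjective hsurj)⟩

/-- The connecting isomorphism: if a complex is acyclic, the homology of a quotient is the homology
of the kernel, one degree lower. -/
theorem HomologyAt.nonempty_equiv_of_acyclic {d : V →ₗ[k] V} {d' : W →ₗ[k] W}
    {C₀ C C' : Submodule k V} {E E' : Submodule k W} {B₀ B : Submodule k V} (p : V →ₗ[k] W)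
    (hC : C.map p = E) (hC' : C'.map p = E')
    (hd : ∀ x ∈ C, p (d x) = d' (p x)) (hd' : ∀ x ∈ C', p (d x) = d' (p x))
    (hmem : ∀ x ∈ C, d x ∈ C₀) (hmem' : ∀ x ∈ C', d x ∈ C)
    (hdd : ∀ x, d (d x) = 0)
    (hB₀ : ∀ x, x ∈ B₀ ↔ x ∈ C₀ ∧ p x = 0) (hB : ∀ x, x ∈ B ↔ x ∈ C ∧ p x = 0)
    (exact_left : ∀ x ∈ C₀, d x = 0 → ∃ y ∈ C, d y = x)
    (exact_right : ∀ x ∈ C, d x = 0 → ∃ y ∈ C', d y = x) :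
    Nonempty (HomologyAt d' E E' ≃ₗ[k] HomologyAt d B₀ B) := by
  -- both homologies are quotients of the relative cycles, by `p` and by `d`, with the same kernel
  let Z : Submodule k V := C ⊓ LinearMap.ker (p ∘ₗ d)
  let f : Z →ₗ[k] HomologyAt d' E E' :=
    Submodule.mkQ _ ∘ₗ p.restrict (q := LinearMap.ker d' ⊓ E) fun x hx => ⟨LinearMap.mem_ker.2
      ((hd x hx.1).symm.trans hx.2), hC ▸ Submodule.mem_map_of_mem hx.1⟩
  let g : Z →ₗ[k] HomologyAt d B₀ B :=
    Submodule.mkQ _ ∘ₗ d.restrict (q := LinearMap.ker d ⊓ B₀) fun x hx =>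
      ⟨hdd x, (hB₀ _).2 ⟨hmem x hx.1, hx.2⟩⟩
  have hf : Function.Surjective f := by
    intro y
    obtain ⟨⟨e, he, heE⟩, rfl⟩ := Submodule.mkQ_surjective _ y
    rw [← hC] at heE
    obtain ⟨c, hc, rfl⟩ := heE
    exact ⟨⟨c, hc, (hd c hc).trans he⟩, rfl⟩
  have hg : Function.Surjective g := by
    intro y
    obtain ⟨⟨e, he, heB⟩, rfl⟩ := Submodule.mkQ_surjective _ y
    obtain ⟨h1, h2⟩ := (hB₀ e).1 heB
    obtain ⟨c, hc, rfl⟩ := exact_left e h1 he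
    exact ⟨⟨c, hc, h2⟩, rfl⟩
  have hker : LinearMap.ker f = LinearMap.ker g := by
    ext ⟨c, hc, hcd⟩
    rw [LinearMap.mem_ker, LinearMap.mem_ker]
    refine (Submodule.Quotient.mk_eq_zero _).trans
      (Iff.trans ?_ (Submodule.Quotient.mk_eq_zero _).symm)
    constructor
    · rintro ⟨y, hy, hyc⟩
      rw [← hC'] at hy
      obtain ⟨x, hx, rfl⟩ := hy
      refine ⟨c - d x, (hB _).2 ⟨sub_mem hc (hmem' x hx), ?_⟩, ?_⟩
      · rw [map_sub, hd' x hx, hyc]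
        exact sub_self _
      · change d (c - d x) = d c
        rw [map_sub, hdd, sub_zero]
    · rintro ⟨b, hb, hbc⟩
      obtain ⟨hb1, hb2⟩ := (hB b).1 hb
      obtain ⟨x, hx, hxc⟩ := exact_right (c - b) (sub_mem hc hb1) (by
        rw [map_sub, hbc]
        exact sub_self _)
      refine ⟨p x, hC' ▸ Submodule.mem_map_of_mem hx, ?_⟩
      rw [← hd' x hx, hxc, map_sub, hb2, sub_zero]
      rfl
  exact ⟨((f.quotKerEquivOfSurjective hf).symm.trans (Submodule.quotEquivOfEq _ _ hker)).trans
    (g.quotKerEquivOfSurjective hg)⟩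

/-- Complementary projections show that a sum map is bijective. -/
theorem bijective_coprod_toModule {ι H N₀ : Type*} [DecidableEq ι] [Fintype ι] {N : ι → Type*}
    [AddCommGroup H] [Module k H] [AddCommGroup N₀] [Module k N₀] [∀ i, AddCommGroup (N i)]
    [∀ i, Module k (N i)] (e₀ : N₀ →ₗ[k] H) (r₀ : H →ₗ[k] N₀) (e : ∀ i, N i →ₗ[k] H)
    (r : ∀ i, H →ₗ[k] N i) (h₀ : ∀ x, r₀ (e₀ x) = x) (h₀' : ∀ i x, r₀ (e i x) = 0)
    (h' : ∀ i x, r i (e₀ x) = 0) (h : ∀ i x, r i (e i x) = x)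
    (hne : ∀ i j, i ≠ j → ∀ x, r i (e j x) = 0) (hsum : ∀ y, e₀ (r₀ y) + ∑ i, e i (r i y) = y) :
    Function.Bijective (LinearMap.coprod e₀ (DirectSum.toModule k ι H e)) := by
  have h1 : ∀ w, r₀ (DirectSum.toModule k ι H e w) = 0 := by
    intro w
    induction w using DirectSum.induction_on with
    | zero => simp
    | add x y hx hy => rw [map_add, map_add, hx, hy, add_zero]
    | of i x => exact (congrArg r₀ (DirectSum.toModule_lof k i x)).trans (h₀' i x)
  have h2 : ∀ i w, r i (DirectSum.toModule k ι H e w) = w i := by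
    intro i w
    induction w using DirectSum.induction_on with
    | zero => simp
    | add x y hx hy => rw [map_add, map_add, hx, hy]; rfl
    | of j x =>
      refine (congrArg (r i) (DirectSum.toModule_lof k j x)).trans ?_
      by_cases hij : i = j
      · subst hij
        rw [DirectSum.of_eq_same, h]
      · rw [DirectSum.of_eq_of_ne _ _ _ hij, hne i j hij]
  constructor
  · rintro ⟨x, w⟩ ⟨x', w'⟩ hxw
    rw [LinearMap.coprod_apply, LinearMap.coprod_apply] at hxw
    refine Prod.ext ?_ (DFinsupp.ext fun i => ?_)
    · have := congrArg r₀ hxw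
      rwa [map_add, map_add, h1, h1, h₀, h₀, add_zero, add_zero] at this
    · have := congrArg (r i) hxw
      rwa [map_add, map_add, h2, h2, h', h', zero_add, zero_add] at this
  · intro y
    refine ⟨(r₀ y, ∑ i, DirectSum.lof k ι N i (r i y)), ?_⟩
    rw [LinearMap.coprod_apply, map_sum]
    simp only [DirectSum.toModule_lof]
    exact hsum y

end HomologyAlgebra

/-! ### The decomposition by supports -/

section Decomposition

variable {k : Type u} [Field k] {m s : ℕ} (P : Fin s → Finset (Fin m))

/-- The projection to the span of the symbols with union `σ`. -/
def barPart (σ : Finset (Fin m)) : Bar k s →ₗ[k] Bar k s :=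
  Finsupp.lsum k fun S => if S.biUnion P = σ then Finsupp.lsingle S else 0

theorem barPart_single (σ : Finset (Fin m)) (S : Finset (Fin s)) (c : k) :
    barPart P σ (Finsupp.single S c) = if S.biUnion P = σ then Finsupp.single S c else 0 := by
  rw [barPart, Finsupp.lsum_single]
  split_ifs <;> simp

theorem barD_single (S : Finset (Fin s)) (c : k) : barD k P (Finsupp.single S c) =
    ∑ i ∈ S with (S.erase i).biUnion P = S.biUnion P,
      Finsupp.single (S.erase i) (c * (-1 : k) ^ (S.filter (· ≤ i)).card) := by
  rw [barD, Finsupp.linearCombination_single, Finset.smul_sum]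
  refine Finset.sum_congr rfl fun i _ => ?_
  rw [Finsupp.smul_single, smul_eq_mul]

theorem barPart_barD (σ : Finset (Fin m)) (x : Bar k s) :
    barPart P σ (barD k P x) = barD k P (barPart P σ x) := by
  induction x using Finsupp.induction_linear with
  | zero => simp
  | add x y hx hy => simp only [map_add, hx, hy]
  | single S c =>
    rw [barPart_single, barD_single, map_sum]
    split_ifs with h
    · rw [barD_single]
      refine Finset.sum_congr rfl fun i hi => ?_
      rw [barPart_single, if_pos ((Finset.mem_filter.1 hi).2.trans h)]
    · rw [map_zero]
      refine Finset.sum_eq_zero fun i hi => ?_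
      rw [barPart_single, if_neg fun h' => h ((Finset.mem_filter.1 hi).2.symm.trans h')]

theorem barPart_of_mem {σ : Finset (Fin m)} {n : ℕ} {x : Bar k s} (hx : x ∈ barPieceAt k P σ n) :
    barPart P σ x = x := by
  refine supported_induction (C := fun x => barPart P σ x = x) (map_zero _) ?_ ?_ x hx
  · intro x y hx hy
    rw [map_add, hx, hy]
  · intro S hS c
    rw [barPart_single, if_pos hS.2]

theorem barPart_of_mem_of_ne {σ τ : Finset (Fin m)} (h : σ ≠ τ) {n : ℕ} {x : Bar k s}
    (hx : x ∈ barPieceAt k P τ n) : barPart P σ x = 0 := by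
  refine supported_induction (C := fun x => barPart P σ x = 0) (map_zero _) ?_ ?_ x hx
  · intro x y hx hy
    rw [map_add, hx, hy, add_zero]
  · intro S hS c
    rw [barPart_single, if_neg fun h' => h (h'.symm.trans hS.2)]

theorem barPart_mem (σ : Finset (Fin m)) (n : ℕ) (x : Bar k s) (hx : x ∈ barPiece k s n) :
    barPart P σ x ∈ barPieceAt k P σ n := by
  refine supported_induction (C := fun x => barPart P σ x ∈ barPieceAt k P σ n) ?_ ?_ ?_ x hx
  · rw [map_zero]
    exact zero_mem _
  · intro x y hx hy
    rw [map_add]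
    exact add_mem hx hy
  · intro S hS c
    rw [barPart_single]
    split_ifs with h
    · exact Finsupp.single_mem_supported k c ⟨hS, h⟩
    · exact zero_mem _

theorem sum_barPart (x : Bar k s) : ∑ σ, barPart P σ x = x := by
  induction x using Finsupp.induction_linear with
  | zero => simp
  | add x y hx hy => simp only [map_add, Finset.sum_add_distrib, hx, hy]
  | single S c => simp only [barPart_single, Finset.sum_ite_eq, Finset.mem_univ, if_true]

/-- The projection of the homology to its part with support `σ`. -/
def barHomologyPart (σ : Finset (Fin m)) (n : ℕ) : BarHomology k P n →ₗ[k] BarHomologyAt k P σ n :=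
  HomologyAt.map (barPart P σ) (barPart_barD P σ) (barPart_mem P σ n) (barPart_mem P σ (n + 1))

theorem barHomologyPart_incl (σ : Finset (Fin m)) (n : ℕ) (x : BarHomologyAt k P σ n) :
    barHomologyPart P σ n (barHomologyAtIncl k P σ n x) = x := by
  obtain ⟨z, rfl⟩ := Submodule.mkQ_surjective _ x
  exact congrArg (Submodule.mkQ _) (Subtype.ext (barPart_of_mem P z.2.2))

theorem barHomologyPart_incl_of_ne {σ τ : Finset (Fin m)} (h : σ ≠ τ) (n : ℕ)
    (x : BarHomologyAt k P τ n) : barHomologyPart P σ n (barHomologyAtIncl k P τ n x) = 0 := by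
  obtain ⟨z, rfl⟩ := Submodule.mkQ_surjective _ x
  refine (congrArg (Submodule.mkQ _) (Subtype.ext ?_)).trans (map_zero (Submodule.mkQ _))
  exact barPart_of_mem_of_ne P h z.2.2

theorem sum_incl_barHomologyPart (n : ℕ) (x : BarHomology k P n) :
    ∑ σ, barHomologyAtIncl k P σ n (barHomologyPart P σ n x) = x := by
  obtain ⟨z, rfl⟩ := Submodule.mkQ_surjective _ x
  let w : Finset (Fin m) → barCycles k P n := fun σ => ⟨barPart P σ z.1, LinearMap.mem_ker.2 (by
    rw [← barPart_barD, LinearMap.mem_ker.1 z.2.1, map_zero]),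
    barPieceAt_le k P σ n (barPart_mem P σ n _ z.2.2)⟩
  change ∑ σ, Submodule.mkQ _ (w σ) = _
  rw [← map_sum]
  refine congrArg (Submodule.mkQ _) (Subtype.ext ?_)
  rw [AddSubmonoidClass.coe_finsetSum]
  exact sum_barPart P z.1

/-- A squarefree monomial lies in an ideal generated by squarefree monomials if and only if it is
divisible by one of the generators. -/
theorem sqfreeMonomial_mem_span (𝓢 : Set (Finset (Fin m))) (τ : Finset (Fin m)) :
    sqfreeMonomial k τ ∈ Ideal.span (sqfreeMonomial k '' 𝓢) ↔ ∃ σ ∈ 𝓢, σ ⊆ τ := by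
  have h : sqfreeMonomial k '' 𝓢 =
      (fun a => MvPolynomial.monomial a (1 : k)) '' (indicatorVector '' 𝓢) := by
    rw [Set.image_image]
    exact Set.image_congr fun σ _ => prod_X_eq_monomial σ
  classical
  rw [h, MvPolynomial.mem_ideal_span_monomial_image, sqfreeMonomial, prod_X_eq_monomial,
    MvPolynomial.support_monomial, if_neg one_ne_zero]
  simp only [Finset.mem_singleton, forall_eq, Set.exists_mem_image]
  refine exists_congr fun σ => and_congr_right fun _ => ⟨fun h c hc => ?_, fun h c => ?_⟩
  · have := h c
    rw [indicatorVector_apply, indicatorVector_apply, if_pos hc] at this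
    by_contra hcτ
    simp [hcτ] at this
  · rw [indicatorVector_apply, indicatorVector_apply]
    by_cases hc : c ∈ σ
    · rw [if_pos hc, if_pos (h hc)]
    · rw [if_neg hc]
      exact Nat.zero_le _

variable {P} {K : LowerSet (Finset (Fin m))} (hP : IsSimplicialComplement k P K)
include hP

/-- The squarefree monomials in `I_K` are those of the nonfaces; equivalently, the nonfaces are the
sets that contain some `P i`. -/
theorem notMem_iff_exists (τ : Finset (Fin m)) : τ ∉ K ↔ ∃ i, P i ⊆ τ := by
  have h := sqfreeMonomial_mem_span (k := k) {σ | σ ∉ K} τ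
  have h' := sqfreeMonomial_mem_span (k := k) (Set.range P) τ
  have he := hP.ideal_eq
  rw [generatedIdeal, stanleyReisnerIdeal,
    show (Set.range fun i => sqfreeMonomial k (P i)) = sqfreeMonomial k '' Set.range P from
      Set.range_comp (sqfreeMonomial k) P] at he
  rw [← he, h', Set.exists_range_iff] at h
  refine Iff.trans ⟨fun hτ => ⟨τ, hτ, subset_rfl⟩, ?_⟩ h.symm
  rintro ⟨σ, hσ, hστ⟩ hτ
  exact hσ (K.lower hστ hτ)

theorem empty_mem : ∅ ∈ K := by
  by_contra h
  obtain ⟨i, hi⟩ := (notMem_iff_exists hP ∅).1 h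
  exact (hP.nonempty i).ne_empty (Finset.subset_empty.1 hi)

theorem biUnion_notMem {S : Finset (Fin s)} (hS : S.Nonempty) : S.biUnion P ∉ K := by
  obtain ⟨i, hi⟩ := hS
  exact (notMem_iff_exists hP _).2 ⟨i, Finset.subset_biUnion_of_mem P hi⟩

theorem biUnion_eq_empty_iff {S : Finset (Fin s)} : S.biUnion P = ∅ ↔ S = ∅ := by
  constructor
  · intro h
    by_contra hS
    exact biUnion_notMem hP (Finset.nonempty_iff_ne_empty.2 hS) (h ▸ empty_mem hP)
  · rintro rfl
    rfl

theorem barUnitPiece_eq (n : ℕ) : barUnitPiece k s n = barPieceAt k P ∅ n := by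
  simp only [barUnitPiece, barPieceAt, biUnion_eq_empty_iff hP]

theorem barPieceAt_eq_bot {σ : Finset (Fin m)} (hσ : σ ∈ K) (h : σ ≠ ∅) (n : ℕ) :
    barPieceAt k P σ n = ⊥ := by
  rw [barPieceAt, ← Finsupp.supported_empty]
  congr 1
  rw [Set.eq_empty_iff_forall_notMem]
  rintro S ⟨-, rfl⟩
  rcases S.eq_empty_or_nonempty with rfl | hS
  · exact h rfl
  · exact biUnion_notMem hP hS hσ

/-- No symbol has a nonempty face of `K` as its union. -/
theorem barHomologyAt_subsingleton {σ : Finset (Fin m)} (hσ : σ ∈ K) (h : σ ≠ ∅) (n : ℕ)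
    (x : BarHomologyAt k P σ n) : x = 0 := by
  obtain ⟨z, rfl⟩ := Submodule.mkQ_surjective _ x
  have hz : z.1 = 0 := (Submodule.mem_bot k).1 (barPieceAt_eq_bot (k := k) hP hσ h n ▸ z.2.2)
  rw [show z = 0 from Subtype.ext hz, map_zero]

/-- The homology of the trivial complex is that of the symbols with empty union. -/
def barHomologyUnitEquiv (n : ℕ) : BarHomologyUnit k P n ≃ₗ[k] BarHomologyAt k P ∅ n :=
  quotientSubmoduleOfCongr (by rw [barUnitPiece_eq hP]) (by rw [barUnitPiece_eq hP])

theorem barHomologyAtIncl_unitEquiv (n : ℕ) (x : BarHomologyUnit k P n) :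
    barHomologyAtIncl k P ∅ n (barHomologyUnitEquiv hP n x) = barHomologyUnitIncl k P n x := by
  obtain ⟨z, rfl⟩ := Submodule.mkQ_surjective _ x
  rw [barHomologyUnitEquiv, quotientSubmoduleOfCongr_mk]
  rfl

theorem barDecomposition_bijective (n : ℕ) : Function.Bijective (barDecomposition k P K n) := by
  classical
  have hK : ∀ σ : {σ // σ ∉ K}, (∅ : Finset (Fin m)) ≠ σ.1 := fun σ h =>
    σ.2 (h ▸ empty_mem hP)
  refine bijective_coprod_toModule (barHomologyUnitIncl k P n)
    ((barHomologyUnitEquiv hP n).symm.toLinearMap ∘ₗ barHomologyPart P ∅ n)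
    (fun σ : {σ // σ ∉ K} => barHomologyAtIncl k P σ.1 n) (fun σ => barHomologyPart P σ.1 n)
    ?_ ?_ ?_ ?_ ?_ ?_
  · intro x
    rw [← barHomologyAtIncl_unitEquiv hP, LinearMap.comp_apply, barHomologyPart_incl]
    exact LinearEquiv.symm_apply_apply _ _
  · intro σ x
    rw [LinearMap.comp_apply, barHomologyPart_incl_of_ne P (hK σ), map_zero]
  · intro σ x
    rw [← barHomologyAtIncl_unitEquiv hP, barHomologyPart_incl_of_ne P (hK σ).symm]
  · exact fun σ x => barHomologyPart_incl P _ n x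
  · exact fun σ τ h x => barHomologyPart_incl_of_ne P (fun h' => h (Subtype.ext h')) n x
  · intro y
    have h1 : barHomologyUnitIncl k P n (((barHomologyUnitEquiv hP n).symm.toLinearMap ∘ₗ
        barHomologyPart P ∅ n) y) = barHomologyAtIncl k P ∅ n (barHomologyPart P ∅ n y) := by
      rw [← barHomologyAtIncl_unitEquiv hP]
      exact congrArg _ (LinearEquiv.apply_symm_apply _ _)
    rw [h1]
    refine Eq.trans ?_ (sum_incl_barHomologyPart P n y)
    rw [← Finset.add_sum_erase _ _ (Finset.mem_univ (∅ : Finset (Fin m)))]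
    congr 1
    rw [← Finset.sum_subtype (Finset.univ.filter (· ∉ K)) (by simp)
      (fun σ => barHomologyAtIncl k P σ n (barHomologyPart P σ n y))]
    refine Finset.sum_subset (fun σ hσ => ?_) fun σ hσ hσ' => ?_
    · exact Finset.mem_erase.2 ⟨(hK ⟨σ, (Finset.mem_filter.1 hσ).2⟩).symm, Finset.mem_univ _⟩
    · have hσK : σ ∈ K := by
        by_contra h
        exact hσ' (Finset.mem_filter.2 ⟨Finset.mem_univ _, h⟩)
      refine (congrArg _ (barHomologyAt_subsingleton hP hσK (Finset.ne_of_mem_erase hσ) n _)).trans ?_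
      exact map_zero _

/-- `Tor_0 = k · 1`: the empty symbol is the only one of degree `0`, and it is not a boundary because the
`P i` are nonempty. -/
theorem smul_faceTorOne_bijective : Function.Bijective fun c : k => c • faceTorOne k K := by
  have h1 : ∀ x ∈ barPiece k s 1, barD k P x = 0 := by
    intro x hx
    refine supported_induction (C := fun x => barD k P x = 0) (map_zero _) ?_ ?_ x hx
    · intro x y hx hy
      rw [map_add, hx, hy, add_zero]
    · intro S hS c
      obtain ⟨i, rfl⟩ := Finset.card_eq_one.1 hS
      rw [barD_single]
      refine Finset.sum_eq_zero fun j hj => ?_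
      obtain ⟨hj, h⟩ := Finset.mem_filter.1 hj
      obtain rfl := Finset.mem_singleton.1 hj
      simp only [Finset.erase_singleton, Finset.biUnion_empty, Finset.singleton_biUnion] at h
      exact absurd h.symm (hP.nonempty j).ne_empty
  have h2 : (fun c : k => c • faceTorOne k K) = fun c => barTorEquiv hP 0
      (barClass k P 0 (c • ⟨barOne k s, barOne_mem k P⟩)) := by
    funext c
    rw [map_smul, map_smul, barTorEquiv_one]
  rw [h2]
  refine (barTorEquiv hP 0).bijective.comp ⟨fun c c' h => ?_, fun y => ?_⟩
  · obtain ⟨x, hx, hxc⟩ := (Submodule.Quotient.eq _).1 h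
    rw [h1 x hx] at hxc
    have h3 := DFunLike.congr_fun hxc ∅
    have h4 : (0 : k) = c * 1 - c' * 1 := by simpa [barOne] using h3
    rw [mul_one, mul_one] at h4
    exact (sub_eq_zero.1 h4.symm)
  · obtain ⟨z, rfl⟩ := Submodule.mkQ_surjective _ y
    refine ⟨z.1 ∅, congrArg (Submodule.mkQ _) (Subtype.ext (Finsupp.ext fun S => ?_))⟩
    change z.1 ∅ * Finsupp.single ∅ 1 S = z.1 S
    by_cases hS : S = ∅
    · rw [hS, Finsupp.single_eq_same, mul_one]
    · rw [Finsupp.single_eq_of_ne hS, mul_zero]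
      by_contra h
      exact hS (Finset.card_eq_zero.1 (z.2.2 (Finsupp.mem_support_iff.2 (Ne.symm h))))

end Decomposition

/-! ### Relative simplicial chains -/

section RelativeSimplicial

variable (k : Type u) [Field k] {ι κ : Type*} [LinearOrder ι] [LinearOrder κ]

open Classical in
/-- The boundary operator of a quotient of simplicial complexes: faces outside of the family `𝓔`
are set to zero. -/
def relD (𝓔 : Set (Finset ι)) : (Finset ι →₀ k) →ₗ[k] (Finset ι →₀ k) :=
  Finsupp.linearCombination k fun F : Finset ι =>
    ∑ v ∈ F with F.erase v ∈ 𝓔, Finsupp.single (F.erase v) (posSign k v F)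

/-- The span of the members of `𝓔` with `n` elements. -/
def facePiece (𝓔 : Set (Finset ι)) (n : ℕ) : Submodule k (Finset ι →₀ k) :=
  Finsupp.supported k k {F | F ∈ 𝓔 ∧ F.card = n}

variable {k}

open Classical in
theorem relD_single (𝓔 : Set (Finset ι)) (F : Finset ι) (c : k) :
    relD k 𝓔 (Finsupp.single F c) =
      ∑ v ∈ F with F.erase v ∈ 𝓔, Finsupp.single (F.erase v) (c * posSign k v F) := by
  rw [relD, Finsupp.linearCombination_single, Finset.smul_sum]
  refine Finset.sum_congr rfl fun i _ => ?_
  rw [Finsupp.smul_single, smul_eq_mul]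

theorem relD_univ_single (F : Finset ι) (c : k) : relD k Set.univ (Finsupp.single F c) =
    ∑ v ∈ F, Finsupp.single (F.erase v) (c * posSign k v F) := by
  classical
  rw [relD_single]
  exact Finset.sum_congr (by simp) fun _ _ => rfl

/-- The boundary is the Taylor differential with all weights equal to `1`. -/
theorem relD_univ_relD_univ (x : Finset ι →₀ k) : relD k Set.univ (relD k Set.univ x) = 0 := by
  have h : ∀ x : Finset ι →₀ k,
      relD k Set.univ x = taylorD (fun _ : ℕ => (1 : k)) (fun _ => ∅) x := by
    intro x
    induction x using Finsupp.induction_linear with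
    | zero => simp
    | add x y hx hy => rw [map_add, map_add, hx, hy]
    | single F c => rw [relD_univ_single, taylorD_single]; simp
  rw [h, h, taylorD_taylorD]

theorem relD_univ_mem {𝓔 : Set (Finset ι)} (h𝓔 : IsLowerSet 𝓔) (n : ℕ) (x : Finset ι →₀ k)
    (hx : x ∈ facePiece k 𝓔 n) : relD k Set.univ x ∈ facePiece k 𝓔 (n - 1) := by
  refine supported_induction (C := fun x => relD k Set.univ x ∈ facePiece k 𝓔 (n - 1)) ?_ ?_ ?_ x hx
  · rw [map_zero]
    exact zero_mem _
  · intro x y hx hy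
    rw [map_add]
    exact add_mem hx hy
  · rintro F ⟨hF, hn⟩ c
    rw [relD_univ_single]
    refine sum_mem fun v hv => Finsupp.single_mem_supported k _ ⟨h𝓔 (Finset.erase_subset _ _) hF, ?_⟩
    rw [Finset.card_erase_of_mem hv, hn]

theorem posSign_map_orderEmbedding (e : κ ↪o ι) (a : κ) (E : Finset κ) :
    posSign k (e a) (E.map e.toEmbedding) = posSign k a E := by
  rw [posSign, Finset.prod_map, posSign]
  refine Finset.prod_congr rfl fun b _ => ?_
  simp

theorem relD_univ_eq_zero {𝓔 : Set (Finset ι)} {x : Finset ι →₀ k} (hx : x ∈ facePiece k 𝓔 0) :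
    relD k Set.univ x = 0 := by
  refine supported_induction (C := fun x => relD k Set.univ x = 0) (map_zero _)
    (fun x y hx hy => by rw [map_add, hx, hy, add_zero]) ?_ x hx
  rintro F ⟨-, hF⟩ c
  rw [relD_univ_single, Finset.card_eq_zero.1 hF, Finset.sum_empty]

section Acyclic

variable (k) (v : Finset ι → ι)

/-- The homotopy that adds the vertex `v F` to a face `F`. -/
def coneHomotopy : (Finset ι →₀ k) →ₗ[k] (Finset ι →₀ k) :=
  Finsupp.linearCombination k fun F : Finset ι =>
    if v F ∈ F then 0 else Finsupp.single (insert (v F) F) (posSign k (v F) (insert (v F) F))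

variable {k}

theorem coneHomotopy_single_of_mem {F : Finset ι} (h : v F ∈ F) (c : k) :
    coneHomotopy k v (Finsupp.single F c) = 0 := by
  rw [coneHomotopy, Finsupp.linearCombination_single, if_pos h, smul_zero]

theorem coneHomotopy_single_of_notMem {F : Finset ι} (h : v F ∉ F) (c : k) :
    coneHomotopy k v (Finsupp.single F c) =
      Finsupp.single (insert (v F) F) (c * posSign k (v F) (insert (v F) F)) := by
  rw [coneHomotopy, Finsupp.linearCombination_single, if_neg h, Finsupp.smul_single, smul_eq_mul]

variable (𝓔 : Set (Finset ι)) (T : Set ι)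

/-- Conditions under which adding and removing the vertex `v F` of a face `F` contracts the complex
`𝓔`, up to faces with fewer vertices in `T`. -/
structure IsConing : Prop where
  lower : IsLowerSet 𝓔
  notMem : ∀ F ∈ 𝓔, v F ∉ T
  insert_mem : ∀ F ∈ 𝓔, insert (v F) F ∈ 𝓔
  erase : ∀ F ∈ 𝓔, ∀ x ∈ F, x ∉ T → v (F.erase x) = v F

open Classical in
/-- The number of vertices in `T`. -/
def weight (F : Finset ι) : ℕ := (F.filter (· ∈ T)).card

variable {v 𝓔 T}

theorem weight_insert {x : ι} (h : x ∉ T) (F : Finset ι) : weight T (insert x F) = weight T F := by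
  classical
  rw [weight, weight, Finset.filter_insert, if_neg h]

theorem weight_erase_lt {x : ι} (h : x ∈ T) {F : Finset ι} (hx : x ∈ F) :
    weight T (F.erase x) < weight T F := by
  classical
  refine Finset.card_lt_card ⟨Finset.filter_subset_filter _ (Finset.erase_subset _ _), fun h' => ?_⟩
  have := h' (Finset.mem_filter.2 ⟨hx, h⟩)
  simp at this

/-- The homotopy formula, up to faces with fewer vertices in `T`. -/
theorem IsConing.homotopy_single (h : IsConing v 𝓔 T) {F : Finset ι} (hF : F ∈ 𝓔) :
    Finsupp.single F 1 - relD k Set.univ (coneHomotopy k v (Finsupp.single F 1)) -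
      coneHomotopy k v (relD k Set.univ (Finsupp.single F 1)) ∈
        Finsupp.supported k k {G | weight T G < weight T F} := by
  have hlow : ∀ x ∈ F, x ∈ T → ∀ c : k, coneHomotopy k v (Finsupp.single (F.erase x) c) ∈
      Finsupp.supported k k {G | weight T G < weight T F} := by
    intro x hx hxT c
    by_cases hv : v (F.erase x) ∈ F.erase x
    · rw [coneHomotopy_single_of_mem v hv]
      exact zero_mem _
    · rw [coneHomotopy_single_of_notMem v hv]
      refine Finsupp.single_mem_supported k _ ?_
      change weight T _ < _
      rw [weight_insert (h.notMem _ (h.lower (Finset.erase_subset _ _) hF))]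
      exact weight_erase_lt hxT hx
  by_cases hv : v F ∈ F
  · rw [coneHomotopy_single_of_mem v hv, map_zero, sub_zero, relD_univ_single, map_sum,
      ← Finset.add_sum_erase _ _ hv]
    have h1 : v (F.erase (v F)) = v F := h.erase F hF _ hv (h.notMem F hF)
    have h2 : coneHomotopy k v (Finsupp.single (F.erase (v F)) (1 * posSign k (v F) F)) =
        Finsupp.single F 1 := by
      rw [coneHomotopy_single_of_notMem v (by rw [h1]; simp), h1, Finset.insert_erase hv,
        one_mul, posSign_mul_self]
    rw [h2, sub_add_cancel_left]
    refine neg_mem (sum_mem fun x hx => ?_)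
    obtain ⟨hxv, hxF⟩ := Finset.mem_erase.1 hx
    by_cases hxT : x ∈ T
    · exact hlow x hxF hxT _
    · rw [coneHomotopy_single_of_mem v]
      · exact zero_mem _
      · rw [h.erase F hF x hxF hxT]
        exact Finset.mem_erase.2 ⟨hxv.symm, hv⟩
  · rw [coneHomotopy_single_of_notMem v hv, relD_univ_single, Finset.sum_insert hv,
      Finset.erase_insert hv, one_mul, posSign_mul_self, relD_univ_single, map_sum,
      sub_add_cancel_left, ← neg_add', ← Finset.sum_add_distrib]
    refine neg_mem (sum_mem fun x hx => ?_)
    have hxv : x ≠ v F := fun h => hv (h ▸ hx)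
    by_cases hxT : x ∈ T
    · refine add_mem (Finsupp.single_mem_supported k _ ?_) (hlow x hx hxT _)
      change weight T _ < _
      rw [← weight_insert (h.notMem F hF) F]
      exact weight_erase_lt hxT (Finset.mem_insert_of_mem hx)
    · have h1 := h.erase F hF x hx hxT
      rw [coneHomotopy_single_of_notMem v (by
        rw [h1]; exact fun h => hv (Finset.mem_of_mem_erase h)), h1,
        Finset.erase_insert_of_ne hxv.symm, ← Finsupp.single_add]
      refine (congrArg (· ∈ _) ((congrArg _ ?_).trans (Finsupp.single_zero _))).mpr (zero_mem _)
      have h2 := posSign_erase_mul (R := k) (Finset.mem_insert_self (v F) F)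
        (Finset.mem_insert_of_mem hx) hxv.symm
      rw [Finset.erase_insert hv, Finset.erase_insert_of_ne hxv.symm] at h2
      have h3 := posSign_mul_self (R := k) (v F) (insert (v F) F)
      have h4 := posSign_mul_self (R := k) (v F) (insert (v F) (F.erase x))
      linear_combination posSign k (v F) (insert (v F) F) *
        posSign k (v F) (insert (v F) (F.erase x)) * h2 -
        posSign k (v F) (insert (v F) F) * posSign k x (insert (v F) F) * h4 -
        posSign k x F * posSign k (v F) (insert (v F) (F.erase x)) * h3

theorem IsConing.coneHomotopy_mem (h : IsConing v 𝓔 T) {n : ℕ} {x : Finset ι →₀ k}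
    (hx : x ∈ facePiece k 𝓔 n) : coneHomotopy k v x ∈ facePiece k 𝓔 (n + 1) := by
  refine supported_induction (C := fun x => coneHomotopy k v x ∈ facePiece k 𝓔 (n + 1))
    ?_ ?_ ?_ x hx
  · rw [map_zero]
    exact zero_mem _
  · intro x y hx hy
    rw [map_add]
    exact add_mem hx hy
  · rintro F ⟨hF, hn⟩ c
    by_cases hv : v F ∈ F
    · rw [coneHomotopy_single_of_mem v hv]
      exact zero_mem _
    · rw [coneHomotopy_single_of_notMem v hv]
      refine Finsupp.single_mem_supported k _ ⟨h.insert_mem F hF, ?_⟩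
      rw [Finset.card_insert_of_notMem hv, hn]

/-- A complex with a coning is acyclic: the homotopy replaces a cycle by a homologous one with fewer
vertices in `T`. -/
theorem IsConing.exists_relD_eq (h : IsConing v 𝓔 T) {n : ℕ} {x : Finset ι →₀ k}
    (hx : x ∈ facePiece k 𝓔 n) (hd : relD k Set.univ x = 0) :
    ∃ y ∈ facePiece k 𝓔 (n + 1), relD k Set.univ y = x := by
  obtain ⟨N, hN⟩ : ∃ N, x ∈ Finsupp.supported k k {G | weight T G < N} := by
    refine ⟨x.support.sup (weight T) + 1, fun G hG => ?_⟩
    exact Nat.lt_succ_of_le (Finset.le_sup (f := weight T) hG)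
  induction N generalizing x with
  | zero =>
    refine ⟨0, zero_mem _, ?_⟩
    have : {G : Finset ι | weight T G < 0} = ∅ := by simp
    rw [this, Finsupp.supported_empty, Submodule.mem_bot] at hN
    rw [hN, map_zero]
  | succ N ih =>
    have hy := h.coneHomotopy_mem hx
    have hmem : x - relD k Set.univ (coneHomotopy k v x) - coneHomotopy k v (relD k Set.univ x) ∈
        Finsupp.supported k k {G | weight T G < N} := by
      have hx' : x ∈ Finsupp.supported k k {G | G ∈ 𝓔 ∧ weight T G < N + 1} :=
        fun G hG => ⟨(hx hG).1, hN hG⟩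
      refine supported_induction (C := fun x => x - relD k Set.univ (coneHomotopy k v x) -
        coneHomotopy k v (relD k Set.univ x) ∈ Finsupp.supported k k {G | weight T G < N})
        ?_ ?_ ?_ x hx'
      · simp
      · intro x y hx hy
        simp only [map_add]
        convert add_mem hx hy using 1
        abel
      · rintro F ⟨hF, hw⟩ c
        have h1 : Finsupp.single F c = c • Finsupp.single F (1 : k) := by
          rw [Finsupp.smul_single, smul_eq_mul, mul_one]
        rw [h1]
        simp only [map_smul, ← smul_sub]
        refine Submodule.smul_mem _ _ (Finsupp.supported_mono ?_ (h.homotopy_single hF))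
        exact fun G hG => lt_of_lt_of_le hG (Nat.le_of_lt_succ hw)
    rw [hd, map_zero, sub_zero] at hmem
    obtain ⟨y, hy', hyx⟩ := ih (sub_mem hx (relD_univ_mem h.lower (n + 1) _ hy)) (by
      rw [map_sub, hd, relD_univ_relD_univ, sub_zero]) hmem
    exact ⟨coneHomotopy k v x + y, add_mem hy hy', by rw [map_add, hyx, add_sub_cancel]⟩

end Acyclic

section Quotient

variable (k) (e : κ ↪ ι) (𝓔 : Set (Finset κ))

open Classical in
/-- The projection to the span of a family of faces, reindexed along an injection of the vertex
sets. -/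
def faceProj [Fintype κ] : (Finset ι →₀ k) →ₗ[k] (Finset κ →₀ k) where
  toFun x := Finsupp.equivFunOnFinite.symm fun E => if E ∈ 𝓔 then x (E.map e) else 0
  map_add' x y := by
    ext E
    simp only [Finsupp.equivFunOnFinite_symm_apply_apply, Finsupp.add_apply]
    split_ifs <;> simp
  map_smul' c x := by
    ext E
    simp only [Finsupp.equivFunOnFinite_symm_apply_apply, Finsupp.smul_apply, RingHom.id_apply]
    split_ifs <;> simp

variable {k e 𝓔} [Fintype κ]

omit [LinearOrder ι] [LinearOrder κ] in
open Classical in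
theorem faceProj_apply (x : Finset ι →₀ k) (E : Finset κ) :
    faceProj k e 𝓔 x E = if E ∈ 𝓔 then x (E.map e) else 0 := rfl

omit [LinearOrder ι] in
open Classical in
theorem faceProj_single_map (E : Finset κ) (c : k) :
    faceProj k e 𝓔 (Finsupp.single (E.map e) c) = if E ∈ 𝓔 then Finsupp.single E c else 0 := by
  ext E'
  rw [faceProj_apply]
  by_cases h : E = E'
  · subst h
    split_ifs <;> simp
  · rw [Finsupp.single_eq_of_ne (fun h' => h (Finset.map_injective e h'.symm))]
    split_ifs <;> simp [Finsupp.single_eq_of_ne (Ne.symm h)]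

omit [LinearOrder ι] [LinearOrder κ] in
theorem faceProj_single_of_ne {F : Finset ι} (h : ∀ E ∈ 𝓔, E.map e ≠ F) (c : k) :
    faceProj k e 𝓔 (Finsupp.single F c) = 0 := by
  classical
  ext E
  rw [faceProj_apply]
  split_ifs with hE
  · rw [Finsupp.single_eq_of_ne (h E hE)]
    rfl
  · rfl

variable {𝓓 𝓑 : Set (Finset ι)}

/-- The faces of `𝓓` outside of the subcomplex `𝓑` are the images of the members of `𝓔`. -/
structure IsFaceQuotient (e : κ ↪o ι) (𝓓 𝓑 : Set (Finset ι)) (𝓔 : Set (Finset κ)) : Prop where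
  lower : IsLowerSet 𝓓
  lower' : IsLowerSet 𝓑
  subset : 𝓑 ⊆ 𝓓
  map_mem : ∀ E ∈ 𝓔, E.map e.toEmbedding ∈ 𝓓 \ 𝓑
  exists_map : ∀ F ∈ 𝓓, F ∉ 𝓑 → ∃ E ∈ 𝓔, E.map e.toEmbedding = F

variable {e : κ ↪o ι} (h : IsFaceQuotient e 𝓓 𝓑 𝓔)
include h

theorem IsFaceQuotient.faceProj_of_mem {F : Finset ι} (hF : F ∈ 𝓑) (c : k) :
    faceProj k e.toEmbedding 𝓔 (Finsupp.single F c) = 0 := by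
  refine faceProj_single_of_ne ?_ c
  rintro E hE rfl
  exact (h.map_mem E hE).2 hF

/-- The projection from `𝓓` to the quotient `𝓓 / 𝓑` is a chain map. -/
theorem IsFaceQuotient.faceProj_relD (x : Finset ι →₀ k) (n : ℕ) (hx : x ∈ facePiece k 𝓓 n) :
    faceProj k e.toEmbedding 𝓔 (relD k Set.univ x) =
      relD k 𝓔 (faceProj k e.toEmbedding 𝓔 x) := by
  classical
  refine supported_induction (C := fun x => faceProj k e.toEmbedding 𝓔 (relD k Set.univ x) =
      relD k 𝓔 (faceProj k e.toEmbedding 𝓔 x)) (by simp) ?_ ?_ x hx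
  · intro x y hx hy
    simp only [map_add, hx, hy]
  · rintro F ⟨hF, -⟩ c
    rw [relD_univ_single, map_sum]
    by_cases hB : F ∈ 𝓑
    · rw [h.faceProj_of_mem hB, map_zero]
      exact Finset.sum_eq_zero fun v _ =>
        h.faceProj_of_mem (h.lower' (Finset.erase_subset _ _) hB) _
    · obtain ⟨E, hE, rfl⟩ := h.exists_map F hF hB
      rw [faceProj_single_map, if_pos hE, relD_single, Finset.sum_map, Finset.sum_filter]
      refine Finset.sum_congr rfl fun a _ => ?_
      rw [← Finset.map_erase, faceProj_single_map]
      refine if_congr Iff.rfl ?_ rfl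
      rw [← posSign_map_orderEmbedding e]
      rfl

/-- The kernel of the projection from `𝓓` to `𝓓 / 𝓑` consists of the chains of `𝓑`. -/
theorem IsFaceQuotient.mem_iff (n : ℕ) (x : Finset ι →₀ k) : x ∈ facePiece k 𝓑 n ↔
    x ∈ facePiece k 𝓓 n ∧ faceProj k e.toEmbedding 𝓔 x = 0 := by
  classical
  constructor
  · intro hx
    refine ⟨fun F hF => ⟨h.subset (hx hF).1, (hx hF).2⟩, ?_⟩
    ext E
    rw [faceProj_apply, Finsupp.zero_apply]
    split_ifs with hE
    · by_contra hne
      exact (h.map_mem E hE).2 (hx (Finsupp.mem_support_iff.2 hne)).1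
    · rfl
  · rintro ⟨hx, hp⟩ F hF
    refine ⟨?_, (hx hF).2⟩
    by_contra hB
    obtain ⟨E, hE, rfl⟩ := h.exists_map F (hx hF).1 hB
    have := DFunLike.congr_fun hp E
    rw [faceProj_apply, if_pos hE] at this
    exact Finsupp.mem_support_iff.1 hF this

theorem IsFaceQuotient.map_eq (n : ℕ) :
    (facePiece k 𝓓 n).map (faceProj k e.toEmbedding 𝓔) = facePiece k 𝓔 n := by
  classical
  apply le_antisymm
  · rintro _ ⟨x, hx, rfl⟩ E hE
    rw [Finset.mem_coe, Finsupp.mem_support_iff, faceProj_apply] at hE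
    split_ifs at hE with h1
    · refine ⟨h1, ?_⟩
      rw [← Finset.card_map e.toEmbedding]
      exact (hx (Finsupp.mem_support_iff.2 hE)).2
    · exact absurd rfl hE
  · intro y hy
    refine supported_induction (C := fun y =>
      y ∈ (facePiece k 𝓓 n).map (faceProj k e.toEmbedding 𝓔)) (zero_mem _)
      (fun _ _ hx hy => add_mem hx hy) ?_ y hy
    rintro E ⟨hE, hn⟩ c
    have hmem : E.map e.toEmbedding ∈ {F | F ∈ 𝓓 ∧ F.card = n} :=
      ⟨(h.map_mem E hE).1, by rw [Finset.card_map, hn]⟩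
    refine ⟨Finsupp.single (E.map e.toEmbedding) c, Finsupp.single_mem_supported k _ hmem, ?_⟩
    rw [faceProj_single_map, if_pos hE]

theorem IsFaceQuotient.relD_mem (n : ℕ) (y : Finset κ →₀ k) (hy : y ∈ facePiece k 𝓔 n) :
    relD k 𝓔 y ∈ facePiece k 𝓔 (n - 1) := by
  rw [← h.map_eq] at hy
  obtain ⟨x, hx, rfl⟩ := hy
  rw [← h.faceProj_relD x n hx, ← h.map_eq]
  exact Submodule.mem_map_of_mem (relD_univ_mem h.lower n x hx)

theorem IsFaceQuotient.relD_relD (n : ℕ) (y : Finset κ →₀ k) (hy : y ∈ facePiece k 𝓔 n) :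
    relD k 𝓔 (relD k 𝓔 y) = 0 := by
  rw [← h.map_eq] at hy
  obtain ⟨x, hx, rfl⟩ := hy
  rw [← h.faceProj_relD x n hx, ← h.faceProj_relD _ _ (relD_univ_mem h.lower n x hx),
    relD_univ_relD_univ, map_zero]

/-- Dividing by an acyclic subcomplex does not change the homology. -/
theorem IsFaceQuotient.nonempty_equiv {v : Finset ι → ι} {T : Set ι} (hv : IsConing v 𝓑 T)
    (n : ℕ) : Nonempty (HomologyAt (relD k Set.univ) (facePiece k 𝓓 n) (facePiece k 𝓓 (n + 1)) ≃ₗ[k]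
      HomologyAt (relD k 𝓔) (facePiece k 𝓔 n) (facePiece k 𝓔 (n + 1))) := by
  refine HomologyAt.nonempty_equiv_of_acyclic_ker (faceProj k e.toEmbedding 𝓔) (h.map_eq n)
    (h.map_eq (n + 1)) (fun x hx => h.faceProj_relD x _ hx) (fun x hx => h.faceProj_relD x _ hx)
    (fun x hx => relD_univ_mem h.lower _ x hx) (fun x _ => relD_univ_relD_univ x) ?_ ?_
  · intro x hx hp
    have h1 := (h.mem_iff (n - 1) _).2 ⟨relD_univ_mem h.lower n x hx, hp⟩
    rcases n with _ | n
    · exact ⟨0, zero_mem _, map_zero _, by rw [map_zero, relD_univ_eq_zero hx]⟩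
    · obtain ⟨y, hy, hyx⟩ := hv.exists_relD_eq h1 (relD_univ_relD_univ x)
      exact ⟨y, ((h.mem_iff _ _).1 hy).1, ((h.mem_iff _ _).1 hy).2, hyx⟩
  · intro x hx hd hp
    obtain ⟨y, hy, hyx⟩ := hv.exists_relD_eq ((h.mem_iff n x).2 ⟨hx, hp⟩) hd
    exact ⟨y, ((h.mem_iff _ _).1 hy).1, ((h.mem_iff _ _).1 hy).2, hyx⟩

/-- If the whole complex is acyclic, the homology of a quotient is that of the subcomplex. -/
theorem IsFaceQuotient.nonempty_equiv_of_isConing {v : Finset ι → ι} {T : Set ι}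
    (hv : IsConing v 𝓓 T) (n : ℕ) :
    Nonempty (HomologyAt (relD k 𝓔) (facePiece k 𝓔 (n + 1)) (facePiece k 𝓔 (n + 2)) ≃ₗ[k]
      HomologyAt (relD k Set.univ) (facePiece k 𝓑 n) (facePiece k 𝓑 (n + 1))) :=
  HomologyAt.nonempty_equiv_of_acyclic (faceProj k e.toEmbedding 𝓔) (h.map_eq (n + 1))
    (h.map_eq (n + 2)) (fun x hx => h.faceProj_relD x _ hx) (fun x hx => h.faceProj_relD x _ hx)
    (fun x hx => relD_univ_mem h.lower _ x hx) (fun x hx => relD_univ_mem h.lower _ x hx)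
    relD_univ_relD_univ (h.mem_iff n) (h.mem_iff (n + 1)) (fun _ hx => hv.exists_relD_eq hx)
    (fun _ hx => hv.exists_relD_eq hx)

end Quotient
end RelativeSimplicial

/-! ### The joint complex of indices and points -/

section DoubleComplex

variable {m s : ℕ}

/-- The indices of the sets `P i` as vertices of the joint complex. -/
def indexVertex (m s : ℕ) : Fin s ↪o Fin s ⊕ₗ Fin m :=
  OrderEmbedding.ofMapLEIff (fun i => Sum.inlₗ i) fun _ _ => Sum.Lex.inl_le_inl_iff

/-- The elements of `[m]` as vertices of the joint complex. -/
def pointVertex (m s : ℕ) : Fin m ↪o Fin s ⊕ₗ Fin m :=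
  OrderEmbedding.ofMapLEIff (fun a => Sum.inrₗ a) fun _ _ => Sum.Lex.inr_le_inr_iff

theorem indexVertex_ne_pointVertex (i : Fin s) (a : Fin m) :
    indexVertex m s i ≠ pointVertex m s a := fun h => by
  have h' : (Sum.inl i : Fin s ⊕ Fin m) = Sum.inr a := toLex.injective h
  cases h'

theorem vertex_cases (x : Fin s ⊕ₗ Fin m) :
    (∃ i, x = indexVertex m s i) ∨ ∃ a, x = pointVertex m s a := by
  rcases h : ofLex x with i | a
  · exact Or.inl ⟨i, ofLex.injective h⟩
  · exact Or.inr ⟨a, ofLex.injective h⟩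

/-- The indices in a face of the joint complex. -/
def indexPart (F : Finset (Fin s ⊕ₗ Fin m)) : Finset (Fin s) :=
  Finset.univ.filter fun i => indexVertex m s i ∈ F

/-- The elements of `[m]` in a face of the joint complex. -/
def pointPart (F : Finset (Fin s ⊕ₗ Fin m)) : Finset (Fin m) :=
  Finset.univ.filter fun a => pointVertex m s a ∈ F

theorem mem_indexPart {F : Finset (Fin s ⊕ₗ Fin m)} {i : Fin s} :
    i ∈ indexPart F ↔ indexVertex m s i ∈ F := by simp [indexPart]

theorem mem_pointPart {F : Finset (Fin s ⊕ₗ Fin m)} {a : Fin m} :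
    a ∈ pointPart F ↔ pointVertex m s a ∈ F := by simp [pointPart]

theorem indexPart_mono {F G : Finset (Fin s ⊕ₗ Fin m)} (h : F ⊆ G) :
    indexPart F ⊆ indexPart G := fun _ hi => mem_indexPart.2 (h (mem_indexPart.1 hi))

theorem pointPart_mono {F G : Finset (Fin s ⊕ₗ Fin m)} (h : F ⊆ G) :
    pointPart F ⊆ pointPart G := fun _ hi => mem_pointPart.2 (h (mem_pointPart.1 hi))

theorem indexPart_map (S : Finset (Fin s)) :
    indexPart (S.map (indexVertex m s).toEmbedding) = S := by
  ext i
  rw [mem_indexPart]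
  exact Finset.mem_map' (indexVertex m s).toEmbedding

theorem pointPart_map (τ : Finset (Fin m)) :
    pointPart (τ.map (pointVertex m s).toEmbedding) = τ := by
  ext i
  rw [mem_pointPart]
  exact Finset.mem_map' (pointVertex m s).toEmbedding

theorem pointPart_map_indexVertex (S : Finset (Fin s)) :
    pointPart (S.map (indexVertex m s).toEmbedding) = ∅ := by
  ext a
  simp only [mem_pointPart, Finset.mem_map, Finset.notMem_empty, iff_false]
  rintro ⟨i, -, h⟩
  exact indexVertex_ne_pointVertex i a h

theorem indexPart_map_pointVertex (τ : Finset (Fin m)) :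
    indexPart (τ.map (pointVertex m s).toEmbedding) = ∅ := by
  ext a
  simp only [mem_indexPart, Finset.mem_map, Finset.notMem_empty, iff_false]
  rintro ⟨i, -, h⟩
  exact indexVertex_ne_pointVertex a i h.symm

theorem map_indexPart {F : Finset (Fin s ⊕ₗ Fin m)} (h : pointPart F = ∅) :
    (indexPart F).map (indexVertex m s).toEmbedding = F := by
  ext x
  simp only [Finset.mem_map, mem_indexPart]
  constructor
  · rintro ⟨i, hi, rfl⟩
    exact hi
  · intro hx
    rcases vertex_cases x with ⟨i, rfl⟩ | ⟨a, rfl⟩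
    · exact ⟨i, hx, rfl⟩
    · exact absurd (mem_pointPart.2 hx) (by simp [h])

theorem map_pointPart {F : Finset (Fin s ⊕ₗ Fin m)} (h : indexPart F = ∅) :
    (pointPart F).map (pointVertex m s).toEmbedding = F := by
  ext x
  simp only [Finset.mem_map, mem_pointPart]
  constructor
  · rintro ⟨i, hi, rfl⟩
    exact hi
  · intro hx
    rcases vertex_cases x with ⟨i, rfl⟩ | ⟨a, rfl⟩
    · exact absurd (mem_indexPart.2 hx) (by simp [h])
    · exact ⟨a, hx, rfl⟩

theorem indexPart_insert_index [DecidableEq (Fin s ⊕ₗ Fin m)] (i : Fin s) (F : Finset (Fin s ⊕ₗ Fin m)) :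
    indexPart (insert (indexVertex m s i) F) = insert i (indexPart F) := by
  ext j
  simp [mem_indexPart]

theorem pointPart_insert_index [DecidableEq (Fin s ⊕ₗ Fin m)] (i : Fin s) (F : Finset (Fin s ⊕ₗ Fin m)) :
    pointPart (insert (indexVertex m s i) F) = pointPart F := by
  ext j
  simp [mem_pointPart, (indexVertex_ne_pointVertex i j).symm]

theorem indexPart_insert_point [DecidableEq (Fin s ⊕ₗ Fin m)] (a : Fin m) (F : Finset (Fin s ⊕ₗ Fin m)) :
    indexPart (insert (pointVertex m s a) F) = indexPart F := by
  ext j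
  simp [mem_indexPart, indexVertex_ne_pointVertex j a]

theorem pointPart_insert_point [DecidableEq (Fin s ⊕ₗ Fin m)] (a : Fin m) (F : Finset (Fin s ⊕ₗ Fin m)) :
    pointPart (insert (pointVertex m s a) F) = insert a (pointPart F) := by
  ext j
  simp [mem_pointPart]

theorem indexPart_erase_point [DecidableEq (Fin s ⊕ₗ Fin m)] (a : Fin m) (F : Finset (Fin s ⊕ₗ Fin m)) :
    indexPart (F.erase (pointVertex m s a)) = indexPart F := by
  ext j
  simp [mem_indexPart, indexVertex_ne_pointVertex j a]

theorem pointPart_erase_index [DecidableEq (Fin s ⊕ₗ Fin m)] (i : Fin s) (F : Finset (Fin s ⊕ₗ Fin m)) :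
    pointPart (F.erase (indexVertex m s i)) = pointPart F := by
  ext j
  simp [mem_pointPart, (indexVertex_ne_pointVertex i j).symm]

variable (P : Fin s → Finset (Fin m)) (K : LowerSet (Finset (Fin m))) (σ : Finset (Fin m))

/-- The complex of all `S ⊔ τ`, for a set of indices `S` and a subset `τ` of `σ`, such that
`⋃_{i ∈ S} P i` is contained in `σ ∖ τ`. -/
def jointComplex : Set (Finset (Fin s ⊕ₗ Fin m)) :=
  {F | pointPart F ⊆ σ ∧ (indexPart F).biUnion P ⊆ σ \ pointPart F}

/-- The subcomplex of all `S ⊔ τ` with `⋃_{i ∈ S} P i ≠ σ`. -/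
def unionSubcomplex : Set (Finset (Fin s ⊕ₗ Fin m)) :=
  {F | F ∈ jointComplex P σ ∧ (indexPart F).biUnion P ≠ σ}

/-- The subcomplex of all `S ⊔ τ` with `σ ∖ τ ∉ K`. -/
def nonfaceSubcomplex : Set (Finset (Fin s ⊕ₗ Fin m)) :=
  {F | F ∈ jointComplex P σ ∧ σ \ pointPart F ∉ K}

/-- The sets of indices `S` with `⋃_{i ∈ S} P i = σ`. -/
def unionFamily : Set (Finset (Fin s)) := {S | S.biUnion P = σ}

/-- The subsets of `σ` whose complement in `σ` is a face. -/
def coface : Set (Finset (Fin m)) := {τ | τ ⊆ σ ∧ σ \ τ ∈ K}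

/-- The subsets of `σ` whose complement in `σ` is not a face: the link of the complement of `σ` in the
Alexander dual. -/
def dualLink : Set (Finset (Fin m)) := {τ | τ ⊆ σ ∧ σ \ τ ∉ K}

variable {P K σ}

theorem isLowerSet_jointComplex : IsLowerSet (jointComplex P σ) := fun _ _ hGF hF =>
  ⟨(pointPart_mono hGF).trans hF.1,
    (Finset.biUnion_subset_biUnion_of_subset_left P (indexPart_mono hGF)).trans
      (hF.2.trans (Finset.sdiff_subset_sdiff subset_rfl (pointPart_mono hGF)))⟩

theorem isLowerSet_unionSubcomplex : IsLowerSet (unionSubcomplex P σ) := fun _ _ hGF hF =>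
  ⟨isLowerSet_jointComplex hGF hF.1, fun h => hF.2 (subset_antisymm
    (hF.1.2.trans Finset.sdiff_subset)
    (h ▸ Finset.biUnion_subset_biUnion_of_subset_left P (indexPart_mono hGF)))⟩

theorem isLowerSet_nonfaceSubcomplex : IsLowerSet (nonfaceSubcomplex P K σ) := fun _ _ hGF hF =>
  ⟨isLowerSet_jointComplex hGF hF.1, fun h => hF.2 (K.lower
    (Finset.sdiff_subset_sdiff subset_rfl (pointPart_mono hGF)) h)⟩

/-- Outside of `unionSubcomplex` the set `τ` is empty, and what remains is `Λ^σ`. -/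
theorem isFaceQuotient_union : IsFaceQuotient (indexVertex m s) (jointComplex P σ)
    (unionSubcomplex P σ) (unionFamily P σ) where
  lower := isLowerSet_jointComplex
  lower' := isLowerSet_unionSubcomplex
  subset := fun _ h => h.1
  map_mem S hS := by
    have h : S.biUnion P = σ := hS
    refine ⟨⟨?_, ?_⟩, fun h' => h'.2 ?_⟩
    · rw [pointPart_map_indexVertex]
      exact Finset.empty_subset _
    · rw [pointPart_map_indexVertex, indexPart_map, Finset.sdiff_empty, h]
    · rw [indexPart_map, h]
  exists_map F hF hF' := by
    have h : (indexPart F).biUnion P = σ := by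
      by_contra h
      exact hF' ⟨hF, h⟩
    refine ⟨indexPart F, h, map_indexPart ?_⟩
    have h1 := hF.2
    rw [h] at h1
    refine Finset.eq_empty_of_forall_notMem fun a ha => ?_
    exact (Finset.mem_sdiff.1 (h1 (hF.1 ha))).2 ha

/-- The coning adds to `τ` a point of `σ ∖ ⋃_{i ∈ S} P i`, chosen in terms of the union. -/
theorem exists_isConing_unionSubcomplex (hσ : σ.Nonempty) :
    ∃ v T, IsConing v (unionSubcomplex P σ) T := by
  have h1 : ∀ A : Finset (Fin m), ∃ a, A ⊆ σ → A ≠ σ → a ∈ σ \ A := by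
    intro A
    by_cases h : A ⊆ σ ∧ A ≠ σ
    · obtain ⟨a, ha⟩ := Finset.sdiff_nonempty.2 fun h' => h.2 (subset_antisymm h.1 h')
      exact ⟨a, fun _ _ => ha⟩
    · exact ⟨hσ.choose, fun h' h'' => absurd ⟨h', h''⟩ h⟩
  choose a ha using h1
  refine ⟨fun F => pointVertex m s (a ((indexPart F).biUnion P)), Set.range (indexVertex m s),
    isLowerSet_unionSubcomplex, ?_, ?_, ?_⟩
  · rintro F - ⟨i, hi⟩
    exact indexVertex_ne_pointVertex _ _ hi
  · rintro F ⟨⟨hF1, hF2⟩, hF3⟩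
    have h := Finset.mem_sdiff.1 (ha _ (hF2.trans Finset.sdiff_subset) hF3)
    refine ⟨⟨?_, ?_⟩, ?_⟩
    · simp only [pointPart_insert_point]
      exact Finset.insert_subset h.1 hF1
    · simp only [pointPart_insert_point, indexPart_insert_point]
      intro b hb
      have hb' := Finset.mem_sdiff.1 (hF2 hb)
      refine Finset.mem_sdiff.2 ⟨hb'.1, fun hb'' => ?_⟩
      rcases Finset.mem_insert.1 hb'' with rfl | hb''
      · exact h.2 hb
      · exact hb'.2 hb''
    · simpa only [indexPart_insert_point]
  · rintro F - x - hx
    rcases vertex_cases x with ⟨i, rfl⟩ | ⟨b, rfl⟩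
    · exact absurd ⟨i, rfl⟩ hx
    · simp only [indexPart_erase_point]

/-- Outside of `nonfaceSubcomplex` the set of indices is empty, because no `P i` is a face. -/
theorem isFaceQuotient_nonface (hPK : ∀ τ, τ ∉ K ↔ ∃ i, P i ⊆ τ) :
    IsFaceQuotient (pointVertex m s) (jointComplex P σ) (nonfaceSubcomplex P K σ) (coface K σ) where
  lower := isLowerSet_jointComplex
  lower' := isLowerSet_nonfaceSubcomplex
  subset := fun _ h => h.1
  map_mem τ hτ := by
    refine ⟨⟨?_, ?_⟩, fun h' => h'.2 ?_⟩
    · rw [pointPart_map]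
      exact hτ.1
    · rw [indexPart_map_pointVertex, Finset.biUnion_empty]
      exact Finset.empty_subset _
    · rw [pointPart_map]
      exact hτ.2
  exists_map F hF hF' := by
    have h : σ \ pointPart F ∈ K := by
      by_contra h
      exact hF' ⟨hF, h⟩
    refine ⟨pointPart F, ⟨hF.1, h⟩, map_pointPart ?_⟩
    refine Finset.eq_empty_of_forall_notMem fun i hi => ?_
    exact (hPK _).2 ⟨i, (Finset.subset_biUnion_of_mem P hi).trans hF.2⟩ h

/-- The coning adds to `S` an index `i` with `P i ⊆ σ ∖ τ`, chosen in terms of `τ`. -/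
theorem exists_isConing_nonfaceSubcomplex (hPK : ∀ τ, τ ∉ K ↔ ∃ i, P i ⊆ τ) (hσ : σ ∉ K) :
    ∃ v T, IsConing v (nonfaceSubcomplex P K σ) T := by
  have h1 : ∀ τ : Finset (Fin m), ∃ i, τ ∉ K → P i ⊆ τ := by
    intro τ
    by_cases h : τ ∈ K
    · exact ⟨((hPK σ).1 hσ).choose, fun h' => absurd h h'⟩
    · obtain ⟨i, hi⟩ := (hPK τ).1 h
      exact ⟨i, fun _ => hi⟩
  choose i hi using h1
  refine ⟨fun F => indexVertex m s (i (σ \ pointPart F)), Set.range (pointVertex m s),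
    isLowerSet_nonfaceSubcomplex, ?_, ?_, ?_⟩
  · rintro F - ⟨a, ha⟩
    exact indexVertex_ne_pointVertex _ _ ha.symm
  · rintro F ⟨⟨hF1, hF2⟩, hF3⟩
    refine ⟨⟨?_, ?_⟩, ?_⟩
    · simpa only [pointPart_insert_index]
    · simp only [pointPart_insert_index, indexPart_insert_index, Finset.biUnion_insert]
      exact Finset.union_subset (hi _ hF3) hF2
    · simpa only [pointPart_insert_index]
  · rintro F - x - hx
    rcases vertex_cases x with ⟨j, rfl⟩ | ⟨b, rfl⟩
    · simp only [pointPart_erase_index]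
    · exact absurd ⟨b, rfl⟩ hx

/-- The full simplex on `σ` modulo the link leaves the sets with complement in `K`. -/
theorem isFaceQuotient_coface : IsFaceQuotient (RelEmbedding.refl _ : Fin m ↪o Fin m)
    {τ | τ ⊆ σ} (dualLink K σ) (coface K σ) where
  lower := fun _ _ h h' => h.trans h'
  lower' := fun _ _ h h' => ⟨h.trans h'.1, fun h'' =>
    h'.2 (K.lower (Finset.sdiff_subset_sdiff subset_rfl h) h'')⟩
  subset := fun _ h => h.1
  map_mem τ hτ := by
    have : τ.map (RelEmbedding.refl _ : Fin m ↪o Fin m).toEmbedding = τ := Finset.map_refl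
    rw [this]
    exact ⟨hτ.1, fun h => h.2 hτ.2⟩
  exists_map τ hτ hτ' := by
    refine ⟨τ, ⟨hτ, ?_⟩, Finset.map_refl⟩
    by_contra h
    exact hτ' ⟨hτ, h⟩

/-- The full simplex is a cone over any of its vertices. -/
theorem exists_isConing_simplex (hσ : σ.Nonempty) :
    ∃ v T, IsConing v {τ : Finset (Fin m) | τ ⊆ σ} T := by
  obtain ⟨a, ha⟩ := hσ
  exact ⟨fun _ => a, ∅, fun _ _ h h' => h.trans h', fun _ _ => Set.notMem_empty _,
    fun τ hτ => Finset.insert_subset ha hτ, fun _ _ _ _ _ => rfl⟩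

end DoubleComplex

/-! ### Link and full subcomplex -/

section Comparison

variable {k : Type u} [Field k] {m s : ℕ} {P : Fin s → Finset (Fin m)}
  {K : LowerSet (Finset (Fin m))} {σ : Finset (Fin m)}

/-- Homology only depends on the kernel of the differential on one term and on its image of the other;
this covers differentials that agree there, possibly up to sign. -/
theorem HomologyAt.nonempty_equiv_of_agree {V : Type*} [AddCommGroup V] [Module k V]
    {d d' : V →ₗ[k] V} {C C' E E' : Submodule k V} (hC : C = E) (hC' : C' = E')
    (h : ∀ x ∈ C, d x = 0 ↔ d' x = 0) (h' : C'.map d = C'.map d') :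
    Nonempty (HomologyAt d C C' ≃ₗ[k] HomologyAt d' E E') := by
  subst hC hC'
  refine ⟨quotientSubmoduleOfCongr ?_ h'⟩
  ext x
  exact ⟨fun hx => ⟨(h x hx.2).1 hx.1, hx.2⟩, fun hx => ⟨(h x hx.2).2 hx.1, hx.2⟩⟩

theorem barPieceAt_eq_facePiece (n : ℕ) :
    barPieceAt k P σ n = facePiece k (unionFamily P σ) n := by
  rw [barPieceAt, facePiece]
  congr 1
  ext S
  exact and_comm

theorem barD_eq_relD {n : ℕ} {x : Bar k s} (hx : x ∈ barPieceAt k P σ n) :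
    barD k P x = relD k (unionFamily P σ) x := by
  classical
  refine supported_induction (C := fun x => barD k P x = relD k (unionFamily P σ) x)
    (by simp) (fun x y hx hy => by rw [map_add, map_add, hx, hy]) ?_ x hx
  rintro S ⟨-, hS⟩ c
  rw [barD_single, relD_single]
  refine Finset.sum_congr (Finset.filter_congr fun i _ => ?_) fun i _ => ?_
  · rw [hS]
    rfl
  · rw [neg_one_pow_card_filter]
    rfl

theorem nonempty_barHomologyAt_equiv (n : ℕ) : Nonempty (BarHomologyAt k P σ n ≃ₗ[k]
    HomologyAt (relD k (unionFamily P σ)) (facePiece k (unionFamily P σ) n)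
      (facePiece k (unionFamily P σ) (n + 1))) := by
  refine HomologyAt.nonempty_equiv_of_agree (barPieceAt_eq_facePiece n)
    (barPieceAt_eq_facePiece (n + 1)) (fun x hx => by rw [barD_eq_relD hx]) ?_
  ext y
  constructor
  · rintro ⟨x, hx, rfl⟩
    exact ⟨x, hx, (barD_eq_relD hx).symm⟩
  · rintro ⟨x, hx, rfl⟩
    exact ⟨x, hx, barD_eq_relD hx⟩

theorem posSign_erase_self (v : Fin m) (τ : Finset (Fin m)) :
    posSign k v (τ.erase v) = (-1 : k) ^ (τ.filter (· < v)).card := by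
  rw [posSign, ← neg_one_pow_card_filter]
  congr 2
  ext w
  simp only [Finset.mem_filter, Finset.mem_erase, lt_iff_le_and_ne]
  tauto

theorem neg_posSign_erase {v : Fin m} {τ : Finset (Fin m)} (hv : v ∈ τ) :
    -posSign k v (τ.erase v) = posSign k v τ := by
  conv_rhs => rw [← Finset.insert_erase hv, posSign_insert (Finset.notMem_erase v τ)]
  rw [if_pos le_rfl, neg_one_mul]

/-- The sign of `boundary` counts the vertices before `v`, that of `relD` also counts `v`. -/
theorem boundary_eq_neg_relD (x : Finset (Fin m) →₀ k) :
    boundary k m x = -relD k Set.univ x := by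
  induction x using Finsupp.induction_linear with
  | zero => simp
  | add x y hx hy => rw [map_add, map_add, hx, hy, neg_add]
  | single τ c =>
    rw [boundary, Finsupp.linearCombination_single, relD_univ_single, Finset.smul_sum,
      ← Finset.sum_neg_distrib]
    refine Finset.sum_congr rfl fun v hv => ?_
    rw [Finsupp.smul_single, ← Finsupp.single_neg, smul_eq_mul, ← mul_neg]
    congr 2
    rw [← posSign_erase_self, ← neg_eq_iff_eq_neg, neg_posSign_erase hv]

theorem chains_link_eq (n : ℕ) (i : ℤ) (hi : i + 1 = n) :
    chains k (link (alexanderDual K) σᶜ) i = facePiece k (dualLink K σ) n := by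
  rw [chains, facePiece, hi]
  congr 1
  ext τ
  refine and_congr ?_ Nat.cast_inj
  have h2 : τᶜ ∩ σ = σ \ τ := by ext; simp [and_comm]
  have h1 : (σᶜ ∪ τ)ᶜ = σ \ τ := by ext; simp
  change τᶜ ∉ K ∧ (σᶜ ∪ τ)ᶜ ∉ K ∧ Disjoint σᶜ τ ↔ τ ⊆ σ ∧ σ \ τ ∉ K
  rw [h1]
  constructor
  · rintro ⟨-, h3, h4⟩
    exact ⟨disjoint_compl_left_iff.1 h4, h3⟩
  · rintro ⟨h3, h4⟩
    refine ⟨fun h => h4 (K.lower ?_ h), h4, disjoint_compl_left_iff.2 h3⟩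
    rw [← h2]
    exact Finset.inter_subset_left

theorem nonempty_link_equiv (n : ℕ) (i : ℤ) (hi : i + 1 = n) :
    Nonempty (HomologyAt (relD k Set.univ) (facePiece k (dualLink K σ) n)
      (facePiece k (dualLink K σ) (n + 1)) ≃ₗ[k]
      ReducedHomology k (link (alexanderDual K) σᶜ) i) := by
  refine HomologyAt.nonempty_equiv_of_agree (chains_link_eq n i hi).symm
    (chains_link_eq (n + 1) (i + 1) (by push_cast; omega)).symm
    (fun x hx => by rw [boundary_eq_neg_relD, neg_eq_zero]) ?_
  ext y
  constructor
  · rintro ⟨x, hx, rfl⟩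
    exact ⟨-x, neg_mem hx, by rw [boundary_eq_neg_relD, map_neg, neg_neg]⟩
  · rintro ⟨x, hx, rfl⟩
    exact ⟨-x, neg_mem hx, by rw [boundary_eq_neg_relD, map_neg]⟩

/-- The sign of the complement isomorphism. -/
def dualSign (k : Type u) [Field k] (σ τ : Finset (Fin m)) : k := ∏ v ∈ τ, posSign k v σ

theorem dualSign_mul_self (σ τ : Finset (Fin m)) : dualSign k σ τ * dualSign k σ τ = 1 := by
  rw [dualSign, ← Finset.prod_mul_distrib]
  exact Finset.prod_eq_one fun v _ => posSign_mul_self v σ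

/-- The sign that makes taking complements in `σ` compatible with the boundary of `τ` and the coboundary
of `ρ = σ ∖ (τ ∖ v)`. -/
theorem dualSign_erase {τ ρ : Finset (Fin m)} {v : Fin m} (hτ : τ ⊆ σ) (hρ : ρ ⊆ σ)
    (hv : v ∈ τ) (h : τ.erase v = σ \ ρ) :
    dualSign k σ (τ.erase v) * posSign k v τ =
      (-1 : k) ^ (ρ.filter (· < v)).card * dualSign k σ τ := by
  have h1 : dualSign k σ τ = posSign k v σ * dualSign k σ (τ.erase v) :=
    (Finset.mul_prod_erase τ (fun v => posSign k v σ) hv).symm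
  have h0 : ∀ w, (w ≠ v ∧ w ∈ τ) ↔ (w ∈ σ ∧ w ∉ ρ) := fun w => by
    rw [← Finset.mem_erase, h, Finset.mem_sdiff]
  have h2 : σ = τ ∪ ρ.erase v := by
    ext w
    have hw := h0 w
    have hwτ := @hτ w
    have hwρ := @hρ w
    rw [Finset.mem_union, Finset.mem_erase]
    by_cases hwv : w = v
    · subst hwv
      tauto
    · tauto
  have h3 : Disjoint τ (ρ.erase v) := by
    refine Finset.disjoint_left.2 fun w hw hw' => ?_
    obtain ⟨hwv, hwρ⟩ := Finset.mem_erase.1 hw'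
    exact ((h0 w).1 ⟨hwv, hw⟩).2 hwρ
  have h5 : posSign k v σ = posSign k v τ * posSign k v (ρ.erase v) := by
    conv_lhs => rw [h2]
    exact posSign_union h3
  have h6 := posSign_mul_self (R := k) v (ρ.erase v)
  rw [h1, h5, ← posSign_erase_self]
  linear_combination -(posSign k v τ * dualSign k σ (τ.erase v)) * h6

variable (k K σ)

open Classical in
/-- The isomorphism from the relative chains to the cochains of `K ∩ σ` that sends a set `τ` to `±` the
dual of its complement in `σ`. -/
def complementMap : (Finset (Fin m) →₀ k) →ₗ[k] (Finset (Fin m) → k) :=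
  LinearMap.pi fun ρ => if ρ ∈ restrict K σ then
    dualSign k σ (σ \ ρ) • Finsupp.lapply (σ \ ρ) else 0

variable {k K σ}

open Classical in
theorem complementMap_apply (x : Finset (Fin m) →₀ k) (ρ : Finset (Fin m)) :
    complementMap k K σ x ρ =
      if ρ ∈ restrict K σ then dualSign k σ (σ \ ρ) * x (σ \ ρ) else 0 := by
  rw [complementMap, LinearMap.pi_apply]
  split_ifs <;> rfl

open Classical in
theorem coboundary_apply (L : LowerSet (Finset (Fin m))) (f : Finset (Fin m) → k)
    (ρ : Finset (Fin m)) : coboundary k L f ρ =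
      if ρ ∈ L then ∑ v ∈ ρ, (-1 : k) ^ (ρ.filter (· < v)).card * f (ρ.erase v) else 0 := by
  rw [coboundary, LinearMap.pi_apply]
  split_ifs
  · rw [LinearMap.sum_apply]
    rfl
  · rfl

theorem complementMap_relD {n : ℕ} {x : Finset (Fin m) →₀ k} (hx : x ∈ facePiece k (coface K σ) n) :
    complementMap k K σ (relD k (coface K σ) x) =
      coboundary k (restrict K σ) (complementMap k K σ x) := by
  classical
  refine supported_induction (C := fun x => complementMap k K σ (relD k (coface K σ) x) =
      coboundary k (restrict K σ) (complementMap k K σ x)) (by simp)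
    (fun x y hx hy => by simp only [map_add, hx, hy]) ?_ x hx
  rintro τ ⟨⟨hτσ, hτ⟩, -⟩ c
  funext ρ
  rw [complementMap_apply, coboundary_apply]
  split_ifs with hρ
  swap
  · rfl
  have hρσ : ρ ⊆ σ := hρ.2
  have h1 : ∀ v ∈ ρ, complementMap k K σ (Finsupp.single τ c) (ρ.erase v) =
      if σ \ ρ.erase v = τ then dualSign k σ τ * c else 0 := by
    intro v hv
    have hmem : ρ.erase v ∈ restrict K σ := (restrict K σ).lower (Finset.erase_subset _ _) hρ
    rw [complementMap_apply, if_pos hmem]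
    split_ifs with h
    · rw [h, Finsupp.single_eq_same]
    · rw [Finsupp.single_eq_of_ne h, mul_zero]
  have hs : ∀ (A : Finset (Fin m)) (f : Fin m → k),
      ∑ v ∈ A, f v = ∑ v, if v ∈ A then f v else 0 := fun A f => by
    rw [Finset.sum_ite_mem, Finset.univ_inter]
  rw [Finset.sum_congr rfl fun v hv => congrArg _ (h1 v hv), relD_single, Finsupp.finsetSum_apply,
    Finset.mul_sum, Finset.sum_filter, hs τ, hs ρ]
  refine Finset.sum_congr rfl fun v _ => ?_
  by_cases hv : v ∈ τ ∧ τ.erase v = σ \ ρ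
  · obtain ⟨hvτ, hv⟩ := hv
    have h2 : v ∈ ρ := by
      by_contra h
      exact Finset.notMem_erase v τ (hv ▸ Finset.mem_sdiff.2 ⟨hτσ hvτ, h⟩)
    have h3 : σ \ ρ.erase v = τ := by
      rw [Finset.sdiff_erase (hτσ hvτ), ← hv, Finset.insert_erase hvτ]
    have h4 : τ.erase v ∈ coface K σ := by
      refine ⟨(Finset.erase_subset _ _).trans hτσ, ?_⟩
      rw [hv, Finset.sdiff_sdiff_eq_self hρσ]
      exact hρ.1
    rw [if_pos hvτ, if_pos h4, if_pos h2, if_pos h3, ← hv, Finsupp.single_eq_same, mul_left_comm,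
      dualSign_erase hτσ hρσ hvτ hv]
    ring
  · have h2 : ¬(v ∈ ρ ∧ σ \ ρ.erase v = τ) := by
      rintro ⟨h3, h4⟩
      refine hv ⟨?_, ?_⟩
      · rw [← h4]
        simp [hρσ h3]
      · rw [← h4, Finset.sdiff_erase (hρσ h3), Finset.erase_insert]
        exact fun h => (Finset.mem_sdiff.1 h).2 h3
    have h5 : ∀ c : k, v ∈ τ → (Finsupp.single (τ.erase v) c) (σ \ ρ) = 0 := fun c h =>
      Finsupp.single_eq_of_ne fun h' => hv ⟨h, h'.symm⟩
    trans (0 : k)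
    · split_ifs with h6
      · rw [h5 _ h6, mul_zero]
      · rfl
      · rfl
    · split_ifs with h6 h7
      · exact absurd ⟨h6, h7⟩ h2
      · rw [mul_zero]
      · rfl

theorem map_complementMap (n : ℕ) (i : ℤ) (hi : i + 1 = σ.card - n) :
    (facePiece k (coface K σ) n).map (complementMap k K σ) = cochains k (restrict K σ) i := by
  classical
  apply le_antisymm
  · rintro _ ⟨x, hx, rfl⟩ ρ hρ
    rw [complementMap_apply]
    split_ifs with h
    · by_contra hne
      have h1 := (hx (Finsupp.mem_support_iff.2 (right_ne_zero_of_mul hne))).2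
      refine hρ ⟨h, ?_⟩
      have h2 := Finset.card_sdiff_add_card_eq_card (show ρ ⊆ σ from h.2)
      omega
    · rfl
  · intro f hf
    refine ⟨Finsupp.equivFunOnFinite.symm fun τ =>
      if τ ⊆ σ then dualSign k σ τ * f (σ \ τ) else 0, ?_, ?_⟩
    · intro τ hτ
      rw [Finset.mem_coe, Finsupp.mem_support_iff,
        Finsupp.equivFunOnFinite_symm_apply_apply] at hτ
      split_ifs at hτ with h
      · have h1 : σ \ τ ∈ restrict K σ ∧ ((σ \ τ).card : ℤ) = i + 1 := by
          by_contra h'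
          exact right_ne_zero_of_mul hτ (hf _ h')
        have h2 := Finset.card_sdiff_add_card_eq_card h
        exact ⟨⟨h, h1.1.1⟩, by omega⟩
      · exact absurd rfl hτ
    · funext ρ
      rw [complementMap_apply]
      split_ifs with h
      · rw [Finsupp.equivFunOnFinite_symm_apply_apply, if_pos Finset.sdiff_subset,
          Finset.sdiff_sdiff_eq_self (show ρ ⊆ σ from h.2), ← mul_assoc, dualSign_mul_self, one_mul]
      · exact (hf ρ fun h' => h h'.1).symm

theorem eq_zero_of_complementMap {n : ℕ} {x : Finset (Fin m) →₀ k}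
    (hx : x ∈ facePiece k (coface K σ) n) (h : complementMap k K σ x = 0) : x = 0 := by
  classical
  ext τ
  by_contra hne
  obtain ⟨⟨h1, h2⟩, -⟩ := hx (Finsupp.mem_support_iff.2 hne)
  have h3 := congrFun h (σ \ τ)
  rw [complementMap_apply, if_pos ⟨h2, Finset.sdiff_subset⟩, Finset.sdiff_sdiff_eq_self h1] at h3
  have h4 := dualSign_mul_self (k := k) σ τ
  rcases mul_eq_zero.1 h3 with h5 | h5
  · rw [h5, mul_zero] at h4
    exact zero_ne_one h4
  · exact hne h5

theorem nonempty_cohomology_equiv (n : ℕ) (i : ℤ) (hi : i + 1 = σ.card - n) :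
    Nonempty (HomologyAt (relD k (coface K σ)) (facePiece k (coface K σ) n)
      (facePiece k (coface K σ) (n + 1)) ≃ₗ[k] ReducedCohomology k (restrict K σ) i) := by
  have hq := isFaceQuotient_coface (K := K) (σ := σ)
  refine HomologyAt.nonempty_equiv_of_acyclic_ker (complementMap k K σ) (map_complementMap n i hi)
    (map_complementMap (n + 1) (i - 1) (by push_cast; omega)) (fun x hx => complementMap_relD hx)
    (fun x hx => complementMap_relD hx) (fun x hx => hq.relD_mem _ x hx)
    (fun x hx => hq.relD_relD _ x hx) ?_ ?_
  · intro x hx h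
    exact ⟨0, zero_mem _, map_zero _, by
      rw [map_zero, eq_zero_of_complementMap (hq.relD_mem _ x hx) h]⟩
  · intro x hx _ h
    exact ⟨0, zero_mem _, map_zero _, by rw [map_zero, eq_zero_of_complementMap hx h]⟩

variable (hP : IsSimplicialComplement k P K) (hσ : σ ∉ K)
include hP hσ

theorem nonempty_barHomologyAt_equiv_coface (n : ℕ) : Nonempty (BarHomologyAt k P σ n ≃ₗ[k]
    HomologyAt (relD k (coface K σ)) (facePiece k (coface K σ) n)
      (facePiece k (coface K σ) (n + 1))) := by
  have hne : σ.Nonempty := Finset.nonempty_iff_ne_empty.2 fun h => hσ (h ▸ empty_mem hP)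
  obtain ⟨v, T, hv⟩ := exists_isConing_unionSubcomplex (P := P) hne
  obtain ⟨v', T', hv'⟩ := exists_isConing_nonfaceSubcomplex (notMem_iff_exists hP) hσ
  obtain ⟨e₁⟩ := nonempty_barHomologyAt_equiv (k := k) (P := P) (σ := σ) n
  obtain ⟨e₂⟩ := (isFaceQuotient_union (P := P) (σ := σ)).nonempty_equiv (k := k) hv n
  obtain ⟨e₃⟩ :=
    (isFaceQuotient_nonface (σ := σ) (notMem_iff_exists hP)).nonempty_equiv (k := k) hv' n
  exact ⟨(e₁.trans e₂.symm).trans e₃⟩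

theorem nonempty_barHomologyAt_equiv_link (i : ℕ) (hi : 0 < i) :
    Nonempty (BarHomologyAt k P σ i ≃ₗ[k]
      ReducedHomology k (link (alexanderDual K) σᶜ) ((i : ℤ) - 2)) := by
  have hne : σ.Nonempty := Finset.nonempty_iff_ne_empty.2 fun h => hσ (h ▸ empty_mem hP)
  obtain ⟨n, rfl⟩ := Nat.exists_eq_succ_of_ne_zero hi.ne'
  obtain ⟨v, T, hv⟩ := exists_isConing_simplex hne
  obtain ⟨e₁⟩ := nonempty_barHomologyAt_equiv_coface hP hσ (n + 1)
  obtain ⟨e₂⟩ := (isFaceQuotient_coface (K := K)).nonempty_equiv_of_isConing (k := k) hv n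
  obtain ⟨e₃⟩ := nonempty_link_equiv (k := k) (K := K) (σ := σ) n ((n.succ : ℤ) - 2) (by
    push_cast; omega)
  exact ⟨(e₁.trans e₂).trans e₃⟩

theorem nonempty_barHomologyAt_equiv_cohomology (i : ℕ) :
    Nonempty (BarHomologyAt k P σ i ≃ₗ[k]
      ReducedCohomology k (restrict K σ) ((σ.card : ℤ) - (i : ℤ) - 1)) := by
  obtain ⟨e₁⟩ := nonempty_barHomologyAt_equiv_coface hP hσ i
  obtain ⟨e₂⟩ := nonempty_cohomology_equiv (k := k) (K := K) (σ := σ) i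
    ((σ.card : ℤ) - (i : ℤ) - 1) (by omega)
  exact ⟨e₁.trans e₂⟩

end Comparison

end

end SimplicialComplement

open SimplicialComplement
theorem theorem2p6 (k : Type u) [Field k] (m s : ℕ) (P : Fin s → Finset (Fin m))
    (K : LowerSet (Finset (Fin m))) (hP : IsSimplicialComplement k P K) :
    BarIsDGA k P ∧
    ∃ φ : ∀ n : ℕ, BarHomology k P n ≃ₗ[k] FaceTor k K n,
      -- `φ` is an isomorphism of graded algebras
      (φ 0 (barClass k P 0 ⟨barOne k s, barOne_mem k P⟩) = faceTorOne k K ∧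
        ∀ (p q : ℕ) (a : barCycles k P p) (b : barCycles k P q),
          ∃ hab : barMul k P a.1 b.1 ∈ barCycles k P (p + q),
            φ (p + q) (barClass k P (p + q) ⟨barMul k P a.1 b.1, hab⟩) =
              faceTorMul k K (φ p (barClass k P p a)) (φ q (barClass k P q b))) ∧
      -- the direct sum decomposition
      (∀ n : ℕ, Function.Bijective fun x => φ n (barDecomposition k P K n x)) ∧
      Function.Bijective (fun c : k => c • faceTorOne k K) ∧
      -- the summands
      ∀ i : ℕ, 0 < i → ∀ σ : Finset (Fin m), σ ∉ K →
        LinearMap.range ((φ i).toLinearMap ∘ₗ barHomologyAtIncl k P σ i) =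
            multidegreeTor k K i (indicatorVector σ) ∧
        Nonempty (BarHomologyAt k P σ i ≃ₗ[k]
          ReducedHomology k (link (alexanderDual K) σᶜ) ((i : ℤ) - 2)) ∧
        Nonempty (BarHomologyAt k P σ i ≃ₗ[k]
          ReducedCohomology k (restrict K σ) ((σ.card : ℤ) - (i : ℤ) - 1)) :=
  ⟨barIsDGA k P, barTorEquiv hP,
    ⟨barTorEquiv_one hP, fun p q a b => ⟨barMul_mem_barCycles p q a b, barTorEquiv_mul hP p q a b⟩⟩,
    fun n => (barTorEquiv hP n).bijective.comp (barDecomposition_bijective hP n),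
    smul_faceTorOne_bijective hP,
    fun i hi σ hσ => ⟨range_barHomologyAtIncl hP i σ, nonempty_barHomologyAt_equiv_link hP hσ i hi,
      nonempty_barHomologyAt_equiv_cohomology hP hσ i⟩⟩
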